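/- Let $\mathfrak g$ be a finite-dimensional simple complex Lie algebra with a Cartan subalgebra and a base of the root system, $\theta$ the highest root, $h^\vee=1+\langle\rho,\theta^\vee\rangle$ the dual Coxeter number, $(\,,)$ the Killing form rescaled so that $(\theta,\theta)=2$. Let $\hat{\mathfrak g}=\mathfrak g\otimes\mathbb C[t,t^{-1}]\oplus\mathbb C\underline c$ with $\underline c$ central, $[x(m),y(n)]=[x,y](m+n)+m\,\delta_{m+n,0}(x,y)\underline c$ for $x(n)=x\otimes t^n$, graded by $\deg x(n)=n$, $\deg\underline c=0$. Let $U,B,N$ be the enveloping algebras of $\hat{\mathfrak g}$, $\hat{\mathfrak g}_{\ge0}$, $\hat{\mathfrak g}_{<0}$ with the induced $\mathbb Z$-gradings, and let $\gamma:\hat{\mathfrak g}_{\ge 0}\to\mathbb C$ be the character with $\gamma(\underline c)=2h^\vee$, $\gamma|_{\mathfrak g}=0$, $\gamma|_{\hat{\mathfrak g}_{>0}}=0$; $\mathbb C_{\pm\gamma}$ is the corresponding one-dimensional module, in degree $0$. For graded modules, $\mathcal Hom$ denotes the span of the homogeneous homomorphisms ($f$ has degree $j$ if $f(M_i)\subset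 M'_{i+j}$ for all $i$). $\mathcal Hom_B(U,E)$ is formed with $B$ acting on $U$ by left multiplication, and is a left $U$-module by $(u\varphi)(v)=\varphi(vu)$. Let $N^\circledast=\bigoplus_i N_i^*$ be the graded dual of $N$, with right action $(fn)(n_1)=f(nn_1)$ and with $N_i^*$ in degree $-i$. (0) There is exactly one structure of a graded $U$-bimodule on the graded vector space $S_\gamma=N^\circledast\otimes_{\mathbb C}B$ such that - there is an isomorphism of left $U$-modules $S_\gamma\to\mathcal Hom_B(U,\mathbb C_\gamma\otimes B)$ sending each $f\otimes b$ to a map whose restriction to $N$ is $n\mapsto f(n)b$, and - the map $S_\gamma\to N^\circledast\otimes_N U$, $f\otimes b\mapsto f\otimes b$, is an isomorphism of right $U$-modules. This is the semi-regular bimodule. $S_\gamma\otimes_U M$ is a left $U$-module through the left action on $S_\gamma$, and $\mathcal Hom_U(S_\gamma,M)$ (maps of left $U$-modules) is a left $U$-module by $(u\varphi)(s)=\varphi(su)$. For $k\in\mathbb C$ put $\bar k=-2h^\vee-k$. All isomorphisms below are isomorphisms of graded left $U$-modules. (1) For every $\mathbb Z$-graded $B$-module $E$ whose grading is bounded from below,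 $$S_\gamma\otimes_U(U\otimes_B E)\;\cong\;\mathcal Hom_B(U,\mathbb C_\gamma\otimes E);$$ if $\underline c$ acts on $E$ as the scalar $k$, then it acts on $S_\gamma\otimes_U(U\otimes_B E)$ as the scalar $-\bar k$. (2) For every $\mathbb Z$-graded $B$-module $F$ whose grading is bounded from above, $$\mathcal Hom_U\big(S_\gamma,\mathcal Hom_B(U,F)\big)\;\cong\;U\otimes_B(\mathbb C_{-\gamma}\otimes F);$$ if $\underline c$ acts on $F$ as the scalar $-\bar k$, then it acts on $\mathcal Hom_U(S_\gamma,\mathcal Hom_B(U,F))$ as the scalar $k$. (3) For a dominant integral weight $\lambda$ let $V_\lambda$ be the finite-dimensional irreducible $\mathfrak g$-module with highest weight $\lambda$, placed in degree $0$, let $\lambda^*$ be the highest weight of $V_\lambda^*$, and let $V_{\lambda,k}=U\otimes_B V_\lambda$ be the Weyl module, where $\underline c$ acts on $V_\lambda$ as $k$ and $\hat{\mathfrak g}_{>0}$ acts as $0$. Let $V_{\lambda,k}^*$ be its graded dual (the dual of the part of degree $i$ is in degree $-i$), with $(Xf)(v)=-f(Xv)$ for $X\in\hat{\mathfrak g}$.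 Then for every $\lambda$ and every $k\in\mathbb C$ $$S_\gamma\otimes_U V_{\lambda,k}\;\cong\;V_{\lambda^*,\bar k}^*,\qquad \mathcal Hom_U(S_\gamma,V_{\lambda,\bar k}^*)\;\cong\;V_{\lambda^*,k}.$$ -/

import Mathlib

open scoped TensorProduct

noncomputable section

namespace SemiInf

section

attribute [local instance 100] LieRing.ofAssociativeRing

/-! ### Graded vector spaces, graded homomorphisms, enveloping algebras -/

/-- The enveloping algebra of a complex Lie algebra. -/
abbrev Env (L : Type*) [LieRing L] [LieAlgebra ℂ L] := UniversalEnvelopingAlgebra ℂ L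

/-- The grading of an enveloping algebra that is induced by a grading of the Lie algebra: the part
of degree `n` is spanned by the products `x₁ ⋯ x_r` of homogeneous elements of total degree `n`. -/
def envDeg {L : Type*} [LieRing L] [LieAlgebra ℂ L] (ℒ : ℤ → Submodule ℂ L) (n : ℤ) :
    Submodule ℂ (Env L) :=
  Submodule.span ℂ {u | ∃ l : List (ℤ × L), (∀ p ∈ l, p.2 ∈ ℒ p.1) ∧
    (l.map Prod.fst).sum = n ∧ (l.map fun p => UniversalEnvelopingAlgebra.ι ℂ p.2).prod = u}

/-- Elements of degree `i` of the graded algebra `A` raise degrees in `E` by `i`. -/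
def IsGradedAction {A E : Type*} [Ring A] [Algebra ℂ A] [AddCommGroup E] [Module ℂ E]
    [Module A E] (𝒜 : ℤ → Submodule ℂ A) (ℰ : ℤ → Submodule ℂ E) : Prop :=
  ∀ ⦃i j : ℤ⦄ ⦃a : A⦄ ⦃e : E⦄, a ∈ 𝒜 i → e ∈ ℰ j → a • e ∈ ℰ (i + j)

/-- `E` is the direct sum of the subspaces `ℰ n` and is a graded module over `A` with its
grading `𝒜`. -/
structure IsGradedModule {A E : Type*} [Ring A] [Algebra ℂ A] [AddCommGroup E] [Module ℂ E]
    [Module A E] (𝒜 : ℤ → Submodule ℂ A) (ℰ : ℤ → Submodule ℂ E) : Prop where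
  internal : DirectSum.IsInternal ℰ
  smul_mem : IsGradedAction 𝒜 ℰ

/-- An isomorphism of `A`-modules which respects the gradings in both directions exists. -/
def GradedIso (A : Type*) {M M' : Type*} [Ring A] [AddCommGroup M] [AddCommGroup M']
    [Module ℂ M] [Module ℂ M'] [Module A M] [Module A M']
    (ℳ : ℤ → Submodule ℂ M) (ℳ' : ℤ → Submodule ℂ M') : Prop :=
  ∃ e : M ≃ₗ[A] M', ∀ (n : ℤ) (x : M), x ∈ ℳ n ↔ e x ∈ ℳ' n

/-- The tensor product grading on `M ⊗ M'`. -/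
def tensorDeg {M M' : Type*} [AddCommGroup M] [AddCommGroup M'] [Module ℂ M] [Module ℂ M']
    (ℳ : ℤ → Submodule ℂ M) (ℳ' : ℤ → Submodule ℂ M') (n : ℤ) : Submodule ℂ (M ⊗[ℂ] M') :=
  Submodule.span ℂ {t | ∃ i j : ℤ, i + j = n ∧ ∃ x ∈ ℳ i, ∃ y ∈ ℳ' j, x ⊗ₜ[ℂ] y = t}

/-- The part of degree `n` of the graded dual: the functionals that live on `ℳ (-n)`. -/
def dualDeg {M : Type*} [AddCommGroup M] [Module ℂ M] (ℳ : ℤ → Submodule ℂ M) (n : ℤ) :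
    Submodule ℂ (Module.Dual ℂ M) where
  carrier := {f | ∀ i : ℤ, i ≠ -n → ∀ x ∈ ℳ i, f x = 0}
  zero_mem' := by intro i _ x _; rfl
  add_mem' := by
    intro f g hf hg i hi x hx
    simp [hf i hi x hx, hg i hi x hx]
  smul_mem' := by
    intro c f hf i hi x hx
    simp [hf i hi x hx]

lemma mem_iSup_of_homogeneous {A X : Type*} [AddCommGroup A] [Module ℂ A] [AddCommGroup X]
    [Module ℂ X] (𝒜 : ℤ → Submodule ℂ A) (h𝒜 : ⨆ n, 𝒜 n = ⊤) (W : ℤ → Submodule ℂ X)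
    (T : A →ₗ[ℂ] X →ₗ[ℂ] X)
    (hT : ∀ i j a x, a ∈ 𝒜 i → x ∈ W j → T a x ∈ W (i + j)) (a : A) {x : X}
    (hx : x ∈ ⨆ n, W n) : T a x ∈ ⨆ n, W n := by
  have ha : a ∈ ⨆ n, 𝒜 n := h𝒜 ▸ Submodule.mem_top
  induction ha using Submodule.iSup_induction' with
  | mem i a ha =>
    induction hx using Submodule.iSup_induction' with
    | mem j x hx => exact Submodule.mem_iSup_of_mem _ (hT i j a x ha hx)
    | zero => simp
    | add x y _ _ hx hy => rw [map_add]; exact add_mem hx hy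
  | zero => simp
  | add a b _ _ ha hb => rw [map_add, LinearMap.add_apply]; exact add_mem ha hb

section Env

variable {L : Type*} [LieRing L] [LieAlgebra ℂ L] (ℒ : ℤ → Submodule ℂ L)

lemma ι_mem_envDeg {n : ℤ} {x : L} (hx : x ∈ ℒ n) :
    UniversalEnvelopingAlgebra.ι ℂ x ∈ envDeg ℒ n :=
  Submodule.subset_span ⟨[(n, x)], by simpa using hx, by simp, by simp⟩

lemma one_mem_envDeg : (1 : Env L) ∈ envDeg ℒ 0 :=
  Submodule.subset_span ⟨[], by simp, by simp, by simp⟩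

lemma mul_mem_envDeg {i j : ℤ} {u v : Env L} (hu : u ∈ envDeg ℒ i) (hv : v ∈ envDeg ℒ j) :
    u * v ∈ envDeg ℒ (i + j) := by
  have h := Submodule.mul_mem_mul hu hv
  rw [envDeg, envDeg, Submodule.span_mul_span] at h
  refine Submodule.span_mono ?_ h
  rintro _ ⟨_, ⟨l, hl, hli, rfl⟩, _, ⟨l', hl', hlj, rfl⟩, rfl⟩
  refine ⟨l ++ l', ?_, by simp [hli, hlj], by simp⟩
  intro p hp
  rcases List.mem_append.1 hp with hp | hp
  exacts [hl p hp, hl' p hp]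

/-- The subalgebra generated by a Lie algebra is its whole enveloping algebra. -/
lemma mem_of_ι_mem (A : Subalgebra ℂ (Env L))
    (hA : ∀ x : L, UniversalEnvelopingAlgebra.ι ℂ x ∈ A) (u : Env L) : u ∈ A := by
  let f : L →ₗ⁅ℂ⁆ A :=
    { toFun := fun x => ⟨UniversalEnvelopingAlgebra.ι ℂ x, hA x⟩
      map_add' := fun x y => by ext; simp
      map_smul' := fun c x => by ext; simp
      map_lie' := fun {x y} => by
        ext
        simp only [LieHom.map_lie, LieRing.of_associative_ring_bracket]
        rfl }
  have h : A.val.comp (UniversalEnvelopingAlgebra.lift ℂ f) = AlgHom.id ℂ _ := by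
    apply UniversalEnvelopingAlgebra.hom_ext
    ext x
    have := UniversalEnvelopingAlgebra.lift_ι_apply ℂ f x
    simp only [LieHom.comp_apply, AlgHom.coe_toLieHom, AlgHom.comp_apply, this]
    rfl
  have := DFunLike.congr_fun h u
  simp only [AlgHom.comp_apply, AlgHom.id_apply] at this
  rw [← this]
  exact Subtype.property _

lemma iSup_envDeg (hℒ : ⨆ n, ℒ n = ⊤) : ⨆ n, envDeg ℒ n = ⊤ := by
  have hmul : ∀ u v : Env L, u ∈ ⨆ n, envDeg ℒ n → v ∈ ⨆ n, envDeg ℒ n →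
      u * v ∈ ⨆ n, envDeg ℒ n := by
    intro u v hu hv
    induction hu using Submodule.iSup_induction' with
    | mem i u hu =>
      induction hv using Submodule.iSup_induction' with
      | mem j v hv => exact Submodule.mem_iSup_of_mem _ (mul_mem_envDeg ℒ hu hv)
      | zero => simp
      | add x y _ _ hx hy => rw [mul_add]; exact add_mem hx hy
    | zero => simp
    | add a b _ _ ha hb => rw [add_mul]; exact add_mem ha hb
  let A : Subalgebra ℂ (Env L) := (⨆ n, envDeg ℒ n).toSubalgebra
    (Submodule.mem_iSup_of_mem 0 (one_mem_envDeg ℒ)) hmul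
  refine eq_top_iff.2 fun u _ => mem_of_ι_mem A (fun x => ?_) u
  have hx : x ∈ ⨆ n, ℒ n := hℒ ▸ Submodule.mem_top
  change UniversalEnvelopingAlgebra.ι ℂ x ∈ ⨆ n, envDeg ℒ n
  induction hx using Submodule.iSup_induction' with
  | mem i x hx => exact Submodule.mem_iSup_of_mem _ (ι_mem_envDeg ℒ hx)
  | zero => simp
  | add a b _ _ ha hb => rw [map_add]; exact add_mem ha hb

/-- The anti-involution `u ↦ ū` of the enveloping algebra with `x̄ = -x` for `x` in the
Lie algebra, as a homomorphism to the opposite algebra. -/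
def bar (L : Type*) [LieRing L] [LieAlgebra ℂ L] : Env L →ₐ[ℂ] (Env L)ᵐᵒᵖ :=
  UniversalEnvelopingAlgebra.lift ℂ
    { toFun := fun x => -MulOpposite.op (UniversalEnvelopingAlgebra.ι ℂ x)
      map_add' := fun x y => by rw [map_add, MulOpposite.op_add, neg_add]
      map_smul' := fun c x => by rw [map_smul, MulOpposite.op_smul, smul_neg, RingHom.id_apply]
      map_lie' := fun {x y} => by
        simp only [LieHom.map_lie, LieRing.of_associative_ring_bracket, MulOpposite.op_sub,
          MulOpposite.op_mul, neg_mul_neg]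
        abel }

lemma bar_ι (x : L) : bar L (UniversalEnvelopingAlgebra.ι ℂ x) =
    -MulOpposite.op (UniversalEnvelopingAlgebra.ι ℂ x) :=
  UniversalEnvelopingAlgebra.lift_ι_apply ℂ _ x

lemma unop_bar_mem_envDeg {n : ℤ} {u : Env L} (hu : u ∈ envDeg ℒ n) :
    (bar L u).unop ∈ envDeg ℒ n := by
  induction hu using Submodule.span_induction with
  | mem u hu =>
    obtain ⟨l, hl, rfl, rfl⟩ := hu
    induction l with
    | nil => simpa using one_mem_envDeg ℒ
    | cons p l ih =>
      have h1 := ih fun q hq => hl q (List.mem_cons_of_mem _ hq)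
      have h2 : -(UniversalEnvelopingAlgebra.ι ℂ p.2) ∈ envDeg ℒ p.1 :=
        neg_mem (ι_mem_envDeg ℒ (hl p List.mem_cons_self))
      have h3 := mul_mem_envDeg ℒ h1 h2
      rw [add_comm] at h3
      simpa only [List.map_cons, List.prod_cons, List.sum_cons, map_mul, bar_ι,
        MulOpposite.unop_mul, MulOpposite.unop_neg, MulOpposite.unop_op] using h3
  | zero => simp
  | add a b _ _ ha hb => rw [map_add, MulOpposite.unop_add]; exact add_mem ha hb
  | smul c a _ ha => rw [map_smul, MulOpposite.unop_smul]; exact Submodule.smul_mem _ _ ha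

end Env

/-! ### Graded Lie algebras and the subalgebras `N`, `B` of `U` -/

/-- A `ℤ`-grading of the Lie algebra `L`. -/
structure LieGrading (L : Type*) [LieRing L] [LieAlgebra ℂ L] where
  piece : ℤ → Submodule ℂ L
  internal : DirectSum.IsInternal piece
  lie_mem : ∀ ⦃i j : ℤ⦄ ⦃x y : L⦄, x ∈ piece i → y ∈ piece j → ⁅x, y⁆ ∈ piece (i + j)

namespace LieGrading

variable {L : Type*} [LieRing L] [LieAlgebra ℂ L] (𝒢 : LieGrading L)

lemma iSup_piece : ⨆ n, 𝒢.piece n = ⊤ := 𝒢.internal.submodule_iSup_eq_top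

/-- The sum of the homogeneous parts with degrees in a set that is closed under addition. -/
def part (s : Set ℤ) (hs : ∀ i ∈ s, ∀ j ∈ s, i + j ∈ s) : LieSubalgebra ℂ L where
  __ := ⨆ n : s, 𝒢.piece n
  lie_mem' := by
    intro x y hx hy
    simp only [AddSubsemigroup.mem_carrier, AddSubmonoid.mem_toSubsemigroup,
      Submodule.mem_toAddSubmonoid] at hx hy ⊢
    induction hx using Submodule.iSup_induction' with
    | mem i x hx =>
      induction hy using Submodule.iSup_induction' with
      | mem j y hy =>
        exact Submodule.mem_iSup_of_mem (⟨i + j, hs _ i.2 _ j.2⟩ : s) (𝒢.lie_mem hx hy)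
      | zero => simp
      | add a b _ _ ha hb => rw [lie_add]; exact add_mem ha hb
    | zero => simp
    | add a b _ _ ha hb => rw [add_lie]; exact add_mem ha hb

/-- The induced grading of a subalgebra. -/
def partPiece (K : LieSubalgebra ℂ L) (n : ℤ) : Submodule ℂ K :=
  (𝒢.piece n).comap K.toSubmodule.subtype

lemma iSup_partPiece (s : Set ℤ) (hs : ∀ i ∈ s, ∀ j ∈ s, i + j ∈ s) :
    ⨆ n, 𝒢.partPiece (𝒢.part s hs) n = ⊤ := by
  apply Submodule.map_injective_of_injective (𝒢.part s hs).toSubmodule.injective_subtype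
  rw [Submodule.map_iSup, Submodule.map_top, Submodule.range_subtype]
  apply le_antisymm
  · exact iSup_le fun n => by
      rintro _ ⟨x, _, rfl⟩
      exact x.2
  · change ⨆ n : s, 𝒢.piece n ≤ _
    refine iSup_le fun n => ?_
    refine le_trans ?_ (le_iSup _ (n : ℤ))
    intro x hx
    have hx' : x ∈ 𝒢.part s hs := Submodule.mem_iSup_of_mem n hx
    exact ⟨⟨x, hx'⟩, hx, rfl⟩

/-- The Lie subalgebra `L_{≥0}`. -/
def nonneg : LieSubalgebra ℂ L := 
  𝒢.part {n | 0 ≤ n} fun i (hi : 0 ≤ i) j (hj : 0 ≤ j) => show 0 ≤ i + j from add_nonneg hi hj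

/-- The Lie subalgebra `L_{<0}`. -/
def neg : LieSubalgebra ℂ L := 
  𝒢.part {n | n < 0} fun i (hi : i < 0) j (hj : j < 0) => show i + j < 0 from add_neg hi hj

/-- `U = U(L)`. -/
abbrev U (_ : LieGrading L) : Type _ := Env L

/-- `B = U(L_{≥0})`. -/
abbrev B : Type _ := Env 𝒢.nonneg

/-- `N = U(L_{<0})`. -/
abbrev N : Type _ := Env 𝒢.neg

/-- The grading of `U`. -/
def degU : ℤ → Submodule ℂ 𝒢.U := envDeg 𝒢.piece

/-- The grading of `B`. -/
def degB : ℤ → Submodule ℂ 𝒢.B := envDeg (𝒢.partPiece 𝒢.nonneg)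

/-- The grading of `N`. -/
def degN : ℤ → Submodule ℂ 𝒢.N := envDeg (𝒢.partPiece 𝒢.neg)

lemma iSup_degU : ⨆ n, 𝒢.degU n = ⊤ := iSup_envDeg _ 𝒢.iSup_piece

lemma iSup_degN : ⨆ n, 𝒢.degN n = ⊤ := iSup_envDeg _ (𝒢.iSup_partPiece _ _)

/-- The homomorphism `B → U` given by the inclusion of Lie algebras. -/
def ιB : 𝒢.B →ₐ[ℂ] 𝒢.U :=
  UniversalEnvelopingAlgebra.lift ℂ ((UniversalEnvelopingAlgebra.ι ℂ).comp 𝒢.nonneg.incl)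

/-- The homomorphism `N → U` given by the inclusion of Lie algebras. -/
def ιN : 𝒢.N →ₐ[ℂ] 𝒢.U :=
  UniversalEnvelopingAlgebra.lift ℂ ((UniversalEnvelopingAlgebra.ι ℂ).comp 𝒢.neg.incl)

/-! ### Twisting by a character, induction and coinduction from `B` to `U` -/

/-- For a character `χ` of `L_{≥0}`, the tensor product `ℂ_χ ⊗ E` of representations of `L_{≥0}`,
realized on the space `E`: an element `x` of `L_{≥0}` acts by `e ↦ x e + χ(x) e`. -/
def Twist (_ : LieAlgebra.LieCharacter ℂ 𝒢.nonneg) (E : Type*) : Type _ := E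

/-- The automorphism of `B` with `x ↦ x + χ(x)` for `x` in `L_{≥0}`. -/
def shift (χ : LieAlgebra.LieCharacter ℂ 𝒢.nonneg) : 𝒢.B →ₐ[ℂ] 𝒢.B :=
  UniversalEnvelopingAlgebra.lift ℂ
    { toFun := fun x => UniversalEnvelopingAlgebra.ι ℂ x + algebraMap ℂ 𝒢.B (χ x)
      map_add' := fun x y => by simp only [map_add]; abel
      map_smul' := fun c x => by
        simp only [map_smul, RingHom.id_apply, Algebra.smul_def, map_mul, mul_add,
          Algebra.algebraMap_self]
      map_lie' := fun {x y} => by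
        rw [LieAlgebra.lieCharacter_apply_lie, map_zero, add_zero, LieHom.map_lie]
        simp only [LieRing.of_associative_ring_bracket, mul_add, add_mul]
        rw [← Algebra.commutes (χ x) (UniversalEnvelopingAlgebra.ι ℂ y),
          ← Algebra.commutes (χ y) (UniversalEnvelopingAlgebra.ι ℂ x),
          Algebra.commutes (χ x) (algebraMap ℂ _ (χ y))]
        abel }

section Modules

variable {𝒢} {E : Type*} [AddCommGroup E] [Module ℂ E] [Module 𝒢.B E] [IsScalarTower ℂ 𝒢.B E]
  (χ : LieAlgebra.LieCharacter ℂ 𝒢.nonneg) (ℰ : ℤ → Submodule ℂ E)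

instance : AddCommGroup (𝒢.Twist χ E) := inferInstanceAs (AddCommGroup E)
instance : Module ℂ (𝒢.Twist χ E) := inferInstanceAs (Module ℂ E)
instance : Module 𝒢.B (𝒢.Twist χ E) := Module.compHom E (𝒢.shift χ).toRingHom
instance : IsScalarTower ℂ 𝒢.B (𝒢.Twist χ E) where
  smul_assoc c b e := by
    change (𝒢.shift χ (c • b)) • (show E from e) = c • ((𝒢.shift χ b) • (show E from e))
    rw [map_smul, smul_assoc]

/-- The grading of `ℂ_χ ⊗ E`, with `ℂ_χ` placed in degree `0`. -/
def twistDeg (ℰ : ℤ → Submodule ℂ E) : ℤ → Submodule ℂ (𝒢.Twist χ E) := ℰ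

variable (𝒢) (E) in
/-- The relations `u b ⊗ e = u ⊗ b e`. -/
def indRel : Submodule 𝒢.U (𝒢.U ⊗[ℂ] E) :=
  Submodule.span 𝒢.U {t | ∃ (u : 𝒢.U) (b : 𝒢.B) (e : E),
    (u * 𝒢.ιB b) ⊗ₜ[ℂ] e - u ⊗ₜ[ℂ] (b • e) = t}

variable (𝒢) (E) in
/-- The induced module `U ⊗_B E`. -/
abbrev Ind : Type _ := (𝒢.U ⊗[ℂ] E) ⧸ 𝒢.indRel E

variable (𝒢) in
/-- The grading of `U ⊗_B E`. -/
def indDeg (n : ℤ) : Submodule ℂ (𝒢.Ind E) :=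
  (tensorDeg 𝒢.degU ℰ n).map ((𝒢.indRel E).mkQ.restrictScalars ℂ)

lemma isGradedAction_ind : IsGradedAction 𝒢.degU (indDeg 𝒢 ℰ) := by
  rintro i j u _ hu ⟨t, ht, rfl⟩
  have ht' : t ∈ tensorDeg 𝒢.degU ℰ j := ht
  suffices h : u • t ∈ tensorDeg 𝒢.degU ℰ (i + j) from
    ⟨u • t, h, map_smul (𝒢.indRel E).mkQ u t⟩
  induction ht' using Submodule.span_induction with
  | mem t h =>
    obtain ⟨p, q, rfl, v, hv, e, he, rfl⟩ := h
    exact Submodule.subset_span ⟨i + p, q, by ring, u * v, mul_mem_envDeg _ hu hv, e, he, rfl⟩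
  | zero => simp
  | add a b ha' hb' ha hb => rw [smul_add]; exact add_mem (ha ha') (hb hb')
  | smul c a ha' ha => rw [smul_comm]; exact Submodule.smul_mem _ _ (ha ha')

variable (𝒢) in
/-- The homogeneous `B`-linear maps `U → E` of degree `j`, where `B` acts on `U` by left
multiplication. -/
def coindHom (j : ℤ) : Submodule ℂ (𝒢.U →ₗ[ℂ] E) where
  carrier := {φ | (∀ (b : 𝒢.B) (u : 𝒢.U), φ (𝒢.ιB b * u) = b • φ u) ∧
    ∀ (i : ℤ), ∀ u ∈ 𝒢.degU i, φ u ∈ ℰ (i + j)}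
  zero_mem' := ⟨fun b u => by simp, fun i u _ => by simp⟩
  add_mem' := by
    rintro φ ψ ⟨h1, h2⟩ ⟨h3, h4⟩
    exact ⟨fun b u => by simp [h1, h3], fun i u hu => add_mem (h2 i u hu) (h4 i u hu)⟩
  smul_mem' := by
    rintro c φ ⟨h1, h2⟩
    refine ⟨fun b u => ?_, fun i u hu => Submodule.smul_mem _ _ (h2 i u hu)⟩
    rw [LinearMap.smul_apply, LinearMap.smul_apply, h1, smul_comm]

variable (𝒢) in
/-- The coinduced module: the space `𝓗om_B(U, E)`, spanned by the homogeneous `B`-linear maps. -/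
def Coind : Type _ := ↥(⨆ j, coindHom 𝒢 ℰ j)

instance : AddCommGroup (Coind 𝒢 ℰ) := inferInstanceAs (AddCommGroup ↥(⨆ j, coindHom 𝒢 ℰ j))
instance : Module ℂ (Coind 𝒢 ℰ) := inferInstanceAs (Module ℂ ↥(⨆ j, coindHom 𝒢 ℰ j))

variable {ℰ} in
/-- An element of `𝓗om_B(U, E)` as a map. -/
def Coind.toHom (φ : Coind 𝒢 ℰ) : 𝒢.U →ₗ[ℂ] E := φ.1

variable (𝒢) (E) in
/-- The operator `φ ↦ (v ↦ φ (v u))` on maps `φ : U → E`. -/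
def coindOp : 𝒢.U →ₗ[ℂ] (𝒢.U →ₗ[ℂ] E) →ₗ[ℂ] (𝒢.U →ₗ[ℂ] E) :=
  LinearMap.mk₂ ℂ (fun u φ => φ ∘ₗ LinearMap.mulRight ℂ u)
    (fun u v φ => by ext m; simp [mul_add])
    (fun c u φ => by ext m; simp)
    (fun u φ ψ => by ext m; simp)
    (fun c u φ => by ext m; simp)

lemma coindOp_mem (u : 𝒢.U) {φ : 𝒢.U →ₗ[ℂ] E} (hφ : φ ∈ ⨆ j, coindHom 𝒢 ℰ j) :
    coindOp 𝒢 E u φ ∈ ⨆ j, coindHom 𝒢 ℰ j := by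
  refine mem_iSup_of_homogeneous 𝒢.degU 𝒢.iSup_degU _ (coindOp 𝒢 E) ?_ u hφ
  rintro i j u φ hu ⟨h1, h2⟩
  refine ⟨fun b v => ?_, fun k v hv => ?_⟩
  · change φ (𝒢.ιB b * v * u) = b • φ (v * u)
    rw [mul_assoc, h1]
  · rw [← add_assoc]
    exact h2 _ _ (mul_mem_envDeg _ hv hu)

/-- `U` acts on `𝓗om_B(U, E)` by `(u φ)(v) = φ (v u)`. -/
instance : Module 𝒢.U (Coind 𝒢 ℰ) where
  smul u φ := ⟨coindOp 𝒢 E u φ.1, coindOp_mem ℰ u φ.2⟩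
  one_smul φ := Subtype.ext (LinearMap.ext fun v => congrArg φ.1 (mul_one v))
  mul_smul u v φ := Subtype.ext (LinearMap.ext fun w => congrArg φ.1 (mul_assoc w u v).symm)
  smul_zero u := Subtype.ext (map_zero (coindOp 𝒢 E u))
  smul_add u φ ψ := Subtype.ext (map_add (coindOp 𝒢 E u) φ.1 ψ.1)
  add_smul u v φ := Subtype.ext (LinearMap.map_add₂ (coindOp 𝒢 E) u v φ.1)
  zero_smul φ := Subtype.ext (LinearMap.map_zero₂ (coindOp 𝒢 E) φ.1)

instance : IsScalarTower ℂ 𝒢.U (Coind 𝒢 ℰ) where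
  smul_assoc c u φ := Subtype.ext (LinearMap.map_smul₂ (coindOp 𝒢 E) c u φ.1)

lemma Coind.smul_toHom (u v : 𝒢.U) (φ : Coind 𝒢 ℰ) : (u • φ).toHom v = φ.toHom (v * u) := rfl

variable (𝒢) in
/-- The grading of `𝓗om_B(U, E)`. -/
def coindDeg (j : ℤ) : Submodule ℂ (Coind 𝒢 ℰ) :=
  (coindHom 𝒢 ℰ j).comap (Submodule.subtype (⨆ j, coindHom 𝒢 ℰ j))

end Modules

/-! ### The semi-regular bimodule -/

/-- The graded dual `N^⊛` of `N`. -/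
def Ndual : Type _ := ↥(⨆ n, dualDeg 𝒢.degN n)

instance : AddCommGroup 𝒢.Ndual := inferInstanceAs (AddCommGroup ↥(⨆ n, dualDeg 𝒢.degN n))
instance : Module ℂ 𝒢.Ndual := inferInstanceAs (Module ℂ ↥(⨆ n, dualDeg 𝒢.degN n))

variable {𝒢} in
/-- An element of `N^⊛` as a functional. -/
def Ndual.toDual (f : 𝒢.Ndual) : Module.Dual ℂ 𝒢.N := f.1

/-- The part of degree `n` of `N^⊛`. -/
def degNdual (n : ℤ) : Submodule ℂ 𝒢.Ndual :=
  (dualDeg 𝒢.degN n).comap (Submodule.subtype (⨆ n, dualDeg 𝒢.degN n))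

lemma comp_mulLeft_mem (n : 𝒢.N) {f : Module.Dual ℂ 𝒢.N} (hf : f ∈ ⨆ n, dualDeg 𝒢.degN n) :
    f ∘ₗ LinearMap.mulLeft ℂ n ∈ ⨆ n, dualDeg 𝒢.degN n := by
  let T : 𝒢.N →ₗ[ℂ] Module.Dual ℂ 𝒢.N →ₗ[ℂ] Module.Dual ℂ 𝒢.N :=
    LinearMap.mk₂ ℂ (fun u φ => φ ∘ₗ LinearMap.mulLeft ℂ u)
      (fun u v φ => by ext m; simp [add_mul])
      (fun c u φ => by ext m; simp)
      (fun u φ ψ => by ext m; simp)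
      (fun c u φ => by ext m; simp)
  refine mem_iSup_of_homogeneous 𝒢.degN 𝒢.iSup_degN _ T ?_ n hf
  intro i j n f hn hf k hk m hm
  exact hf (i + k) (by omega) _ (mul_mem_envDeg _ hn hm)

variable {𝒢} in
/-- The right action of `N` on `N^⊛`: `(f n)(m) = f (n m)`. -/
def Ndual.mulRight (f : 𝒢.Ndual) (n : 𝒢.N) : 𝒢.Ndual :=
  ⟨f.1 ∘ₗ LinearMap.mulLeft ℂ n, 𝒢.comp_mulLeft_mem n f.2⟩

/-- The relations `f n ⊗ u = f ⊗ n u`. -/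
def rightRel : Submodule ℂ (𝒢.Ndual ⊗[ℂ] 𝒢.U) :=
  Submodule.span ℂ {t | ∃ (f : 𝒢.Ndual) (n : 𝒢.N) (u : 𝒢.U),
    (f.mulRight n) ⊗ₜ[ℂ] u - f ⊗ₜ[ℂ] (𝒢.ιN n * u) = t}

/-- The space `N^⊛ ⊗_N U`, on which `U` acts from the right by `(f ⊗ v) u = f ⊗ v u`. -/
abbrev RightModel : Type _ := (𝒢.Ndual ⊗[ℂ] 𝒢.U) ⧸ 𝒢.rightRel

end LieGrading

open LieGrading

/-- The semi-regular `U`-bimodule `S_γ` for a character `γ` of `L_{≥0}`. Its space is `N^⊛ ⊗_ℂ B`.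
The left action is the one for which the map
`N^⊛ ⊗ B → 𝓗om_ℂ(N, B) ← 𝓗om_B(U, ℂ_γ ⊗ B)`, that is, `f ⊗ b ↦ (n ↦ f(n) b)` followed by the
inverse of the restriction from `U` to `N`, is an isomorphism of left `U`-modules. The right action
is the one for which the map `N^⊛ ⊗ B → N^⊛ ⊗_N U` is an isomorphism of right `U`-modules.
The two actions commute and respect the gradings. -/
@[ext]
structure SemiregularBimodule {L : Type*} [LieRing L] [LieAlgebra ℂ L] (𝒢 : LieGrading L)
    (γ : LieAlgebra.LieCharacter ℂ 𝒢.nonneg) where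
  /-- The left action. -/
  left : 𝒢.U →ₐ[ℂ] Module.End ℂ (𝒢.Ndual ⊗[ℂ] 𝒢.B)
  /-- The right action. -/
  right : 𝒢.Uᵐᵒᵖ →ₐ[ℂ] Module.End ℂ (𝒢.Ndual ⊗[ℂ] 𝒢.B)
  comm : ∀ (u v : 𝒢.U) (s : 𝒢.Ndual ⊗[ℂ] 𝒢.B),
    left u (right (MulOpposite.op v) s) = right (MulOpposite.op v) (left u s)
  left_model : ∃ α : (𝒢.Ndual ⊗[ℂ] 𝒢.B) ≃ₗ[ℂ] 𝒢.Coind (twistDeg γ 𝒢.degB),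
    (∀ (f : 𝒢.Ndual) (b : 𝒢.B) (n : 𝒢.N), (α (f ⊗ₜ b)).toHom (𝒢.ιN n) = f.toDual n • b) ∧
    ∀ (u : 𝒢.U) (s : 𝒢.Ndual ⊗[ℂ] 𝒢.B), α (left u s) = u • α s
  right_model : ∃ β : (𝒢.Ndual ⊗[ℂ] 𝒢.B) ≃ₗ[ℂ] 𝒢.RightModel,
    ∀ (f : 𝒢.Ndual) (b : 𝒢.B) (u : 𝒢.U),
      β (right (MulOpposite.op u) (f ⊗ₜ b)) = Submodule.Quotient.mk (f ⊗ₜ (𝒢.ιB b * u))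
  left_mem : ∀ (i j : ℤ), ∀ u ∈ 𝒢.degU i, ∀ s ∈ tensorDeg 𝒢.degNdual 𝒢.degB j,
    left u s ∈ tensorDeg 𝒢.degNdual 𝒢.degB (i + j)
  right_mem : ∀ (i j : ℤ), ∀ u ∈ 𝒢.degU i, ∀ s ∈ tensorDeg 𝒢.degNdual 𝒢.degB j,
    right (MulOpposite.op u) s ∈ tensorDeg 𝒢.degNdual 𝒢.degB (i + j)

namespace SemiregularBimodule

variable {L : Type*} [LieRing L] [LieAlgebra ℂ L] {𝒢 : LieGrading L}
  {γ : LieAlgebra.LieCharacter ℂ 𝒢.nonneg} (S : SemiregularBimodule 𝒢 γ)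

/-- The underlying space `N^⊛ ⊗ B` of `S_γ`. -/
def Carrier (_ : SemiregularBimodule 𝒢 γ) : Type _ := 𝒢.Ndual ⊗[ℂ] 𝒢.B

instance : AddCommGroup S.Carrier := inferInstanceAs (AddCommGroup (𝒢.Ndual ⊗[ℂ] 𝒢.B))
instance : Module ℂ S.Carrier := inferInstanceAs (Module ℂ (𝒢.Ndual ⊗[ℂ] 𝒢.B))

/-- The left action of `U` on `S_γ`. -/
instance : Module 𝒢.U S.Carrier := Module.compHom (𝒢.Ndual ⊗[ℂ] 𝒢.B) S.left.toRingHom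

instance : IsScalarTower ℂ 𝒢.U S.Carrier where
  smul_assoc c u s := LinearMap.congr_fun (map_smul S.left c u) s

/-- The right action `s ↦ s u`. -/
def mulRight (u : 𝒢.U) : S.Carrier →ₗ[ℂ] S.Carrier := S.right (MulOpposite.op u)

/-- The grading of `S_γ`. -/
def deg : ℤ → Submodule ℂ S.Carrier := tensorDeg 𝒢.degNdual 𝒢.degB

variable (M : Type*) [AddCommGroup M] [Module ℂ M] [Module 𝒢.U M] [IsScalarTower ℂ 𝒢.U M]
  (ℳ : ℤ → Submodule ℂ M)

/-- The relations `s u ⊗ m = s ⊗ u m`. -/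
def tensorRel : Submodule 𝒢.U (S.Carrier ⊗[ℂ] M) :=
  Submodule.span 𝒢.U {t | ∃ (s : S.Carrier) (u : 𝒢.U) (m : M),
    S.mulRight u s ⊗ₜ[ℂ] m - s ⊗ₜ[ℂ] (u • m) = t}

/-- The left `U`-module `S_γ ⊗_U M`. -/
abbrev Tensor : Type _ := (S.Carrier ⊗[ℂ] M) ⧸ S.tensorRel M

variable {M}

/-- The grading of `S_γ ⊗_U M`. -/
def tensorGrading (n : ℤ) : Submodule ℂ (S.Tensor M) :=
  (tensorDeg S.deg ℳ n).map ((S.tensorRel M).mkQ.restrictScalars ℂ)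

/-- The homogeneous left `U`-linear maps `S_γ → M` of degree `j`. -/
def homPart (j : ℤ) : Submodule ℂ (S.Carrier →ₗ[ℂ] M) where
  carrier := {φ | (∀ (u : 𝒢.U) (s : S.Carrier), φ (u • s) = u • φ s) ∧
    ∀ (i : ℤ), ∀ s ∈ S.deg i, φ s ∈ ℳ (i + j)}
  zero_mem' := ⟨fun b u => by simp, fun i u _ => by simp⟩
  add_mem' := by
    rintro φ ψ ⟨h1, h2⟩ ⟨h3, h4⟩
    exact ⟨fun b u => by simp [h1, h3], fun i u hu => add_mem (h2 i u hu) (h4 i u hu)⟩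
  smul_mem' := by
    rintro c φ ⟨h1, h2⟩
    refine ⟨fun b u => ?_, fun i u hu => Submodule.smul_mem _ _ (h2 i u hu)⟩
    rw [LinearMap.smul_apply, LinearMap.smul_apply, h1, smul_comm]

/-- The left `U`-module `𝓗om_U(S_γ, M)`, spanned by the homogeneous left `U`-linear maps. -/
def Hom : Type _ := ↥(⨆ j, S.homPart ℳ j)

instance : AddCommGroup (S.Hom ℳ) := inferInstanceAs (AddCommGroup ↥(⨆ j, S.homPart ℳ j))
instance : Module ℂ (S.Hom ℳ) := inferInstanceAs (Module ℂ ↥(⨆ j, S.homPart ℳ j))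

variable (M) in
/-- The operator `φ ↦ (s ↦ φ (s u))` on maps `φ : S_γ → M`. -/
def homOp : 𝒢.U →ₗ[ℂ] (S.Carrier →ₗ[ℂ] M) →ₗ[ℂ] (S.Carrier →ₗ[ℂ] M) :=
  LinearMap.mk₂ ℂ (fun u φ => φ ∘ₗ S.mulRight u)
    (fun u v φ => LinearMap.ext fun s => (congrArg φ (LinearMap.congr_fun
      (map_add S.right (MulOpposite.op u) (MulOpposite.op v)) s)).trans (map_add φ _ _))
    (fun c u φ => LinearMap.ext fun s => (congrArg φ (LinearMap.congr_fun
      (map_smul S.right c (MulOpposite.op u)) s)).trans (map_smul φ c _))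
    (fun u φ ψ => by ext m; simp)
    (fun c u φ => by ext m; simp)

lemma homOp_mem (u : 𝒢.U) {φ : S.Carrier →ₗ[ℂ] M} (hφ : φ ∈ ⨆ j, S.homPart ℳ j) :
    S.homOp M u φ ∈ ⨆ j, S.homPart ℳ j := by
  refine mem_iSup_of_homogeneous 𝒢.degU 𝒢.iSup_degU _ (S.homOp M) ?_ u hφ
  rintro i j u φ hu ⟨h1, h2⟩
  refine ⟨fun v s => ?_, fun k s hs => ?_⟩
  · change φ (S.mulRight u (v • s)) = v • φ (S.mulRight u s)
    rw [← h1]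
    exact congrArg φ (S.comm v u s).symm
  · have := h2 _ _ (S.right_mem i k u hu s hs)
    rw [add_comm i k, add_assoc] at this
    exact this

/-- `U` acts on `𝓗om_U(S_γ, M)` by `(u φ)(s) = φ (s u)`. -/
instance : Module 𝒢.U (S.Hom ℳ) where
  smul u φ := ⟨S.homOp M u φ.1, S.homOp_mem ℳ u φ.2⟩
  one_smul φ := Subtype.ext (LinearMap.ext fun s =>
    congrArg φ.1 (LinearMap.congr_fun (map_one S.right) s))
  mul_smul u v φ := Subtype.ext (LinearMap.ext fun s => congrArg φ.1
    (LinearMap.congr_fun (map_mul S.right (MulOpposite.op v) (MulOpposite.op u)) s))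
  smul_zero u := Subtype.ext (map_zero (S.homOp M u))
  smul_add u φ ψ := Subtype.ext (map_add (S.homOp M u) φ.1 ψ.1)
  add_smul u v φ := Subtype.ext (LinearMap.map_add₂ (S.homOp M) u v φ.1)
  zero_smul φ := Subtype.ext (LinearMap.map_zero₂ (S.homOp M) φ.1)

instance : IsScalarTower ℂ 𝒢.U (S.Hom ℳ) where
  smul_assoc c u φ := Subtype.ext (LinearMap.map_smul₂ (S.homOp M) c u φ.1)

/-- The grading of `𝓗om_U(S_γ, M)`. -/
def homGrading (j : ℤ) : Submodule ℂ (S.Hom ℳ) :=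
  (S.homPart ℳ j).comap (Submodule.subtype (⨆ j, S.homPart ℳ j))

end SemiregularBimodule

/-! ### The graded dual of a graded representation -/

section GradedDual

variable {L : Type*} [LieRing L] [LieAlgebra ℂ L] {𝒢 : LieGrading L}
  {M : Type*} [AddCommGroup M] [Module ℂ M] [Module 𝒢.U M] [IsScalarTower ℂ 𝒢.U M]

variable (𝒢 M) in
/-- The operator `f ↦ (m ↦ f (ū m))` on the full dual space. -/
def dualOp : 𝒢.U →ₗ[ℂ] Module.Dual ℂ M →ₗ[ℂ] Module.Dual ℂ M :=
  LinearMap.mk₂ ℂ (fun u f => f ∘ₗ (Algebra.lsmul ℂ ℂ M (bar L u).unop))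
    (fun u v f => by ext m; simp)
    (fun c u f => by ext m; simp)
    (fun u f g => by ext m; simp)
    (fun c u f => by ext m; simp)

variable {ℳ : ℤ → Submodule ℂ M} (h : IsGradedAction 𝒢.degU ℳ)

/-- The graded dual `⨁ (ℳ n)*` of a graded representation `M`. -/
def GradedDual (_ : IsGradedAction 𝒢.degU ℳ) : Type _ := ↥(⨆ n, dualDeg ℳ n)

instance : AddCommGroup (GradedDual h) := inferInstanceAs (AddCommGroup ↥(⨆ n, dualDeg ℳ n))
instance : Module ℂ (GradedDual h) := inferInstanceAs (Module ℂ ↥(⨆ n, dualDeg ℳ n))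

lemma dualOp_mem (h : IsGradedAction 𝒢.degU ℳ) (u : 𝒢.U) {f : Module.Dual ℂ M} (hf : f ∈ ⨆ n, dualDeg ℳ n) :
    dualOp 𝒢 M u f ∈ ⨆ n, dualDeg ℳ n := by
  refine mem_iSup_of_homogeneous 𝒢.degU 𝒢.iSup_degU _ (dualOp 𝒢 M) ?_ u hf
  intro i j u f hu hf k hk m hm
  exact hf (i + k) (by omega) _ (h (unop_bar_mem_envDeg _ hu) hm)

/-- `U` acts on the graded dual by `(u f)(m) = f (ū m)`; so an element `x` of the Lie algebra acts
by `(x f)(m) = -f (x m)`. -/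
instance : Module 𝒢.U (GradedDual h) where
  smul u f := ⟨dualOp 𝒢 M u f.1, dualOp_mem h u f.2⟩
  one_smul f := Subtype.ext (LinearMap.ext fun m => congrArg f.1 (by
    change (bar L 1).unop • m = m
    rw [map_one, MulOpposite.unop_one, one_smul]))
  mul_smul u v f := Subtype.ext (LinearMap.ext fun m => congrArg f.1 (by
    change (bar L (u * v)).unop • m = (bar L v).unop • (bar L u).unop • m
    rw [map_mul, MulOpposite.unop_mul, mul_smul]))
  smul_zero u := Subtype.ext (map_zero (dualOp 𝒢 M u))
  smul_add u f g := Subtype.ext (map_add (dualOp 𝒢 M u) f.1 g.1)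
  add_smul u v f := Subtype.ext (LinearMap.map_add₂ (dualOp 𝒢 M) u v f.1)
  zero_smul f := Subtype.ext (LinearMap.map_zero₂ (dualOp 𝒢 M) f.1)

instance : IsScalarTower ℂ 𝒢.U (GradedDual h) where
  smul_assoc c u f := Subtype.ext (LinearMap.map_smul₂ (dualOp 𝒢 M) c u f.1)

/-- The grading of the graded dual: functionals of degree `n` live on `ℳ (-n)`. -/
def gradedDualDeg (n : ℤ) : Submodule ℂ (GradedDual h) :=
  (dualDeg ℳ n).comap (Submodule.subtype (⨆ n, dualDeg ℳ n))

end GradedDual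

/-! ### Affine Lie algebras -/

/-- An invariant symmetric bilinear form on a Lie algebra. -/
structure InvariantForm (𝔤 : Type*) [LieRing 𝔤] [LieAlgebra ℂ 𝔤] where
  form : LinearMap.BilinForm ℂ 𝔤
  invariant : form.lieInvariant 𝔤
  symm : form.IsSymm

section Affine

open LieAlgebra

variable {𝔤 : Type*} [LieRing 𝔤] [LieAlgebra ℂ 𝔤] (Φ : InvariantForm 𝔤)

/-- The 2-cocycle `(x(m), y(n)) ↦ m δ_{m+n,0} (x, y)` of the loop algebra `𝔤[t, t⁻¹]`. The form is
negated because the cocycle that Mathlib attaches to a form has the factor `n = -m` in place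
of `m`. -/
def affineCocycle : LieModule.Cohomology.twoCocycle ℂ (loopAlgebra ℂ ℤ 𝔤)
    (TrivialLieModule ℂ (loopAlgebra ℂ ℤ 𝔤) ℂ) :=
  LoopAlgebra.twoCocycleOfBilinear ℂ ℤ 𝔤 (-Φ.form)
    (fun x y z => congrArg Neg.neg (Φ.invariant x y z))
    ⟨fun x y => congrArg Neg.neg (Φ.symm.eq x y)⟩

/-- The affine Lie algebra `𝔤 ⊗ ℂ[t, t⁻¹] ⊕ ℂ c`. -/
abbrev Affine : Type _ := ofTwoCocycle (affineCocycle Φ)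

namespace Affine

/-- The element `x(n) = x ⊗ tⁿ`. -/
def current (n : ℤ) : 𝔤 →ₗ[ℂ] Affine Φ where
  toFun x := ofProd _ (AddMonoidAlgebra.single n 1 ⊗ₜ x, 0)
  map_add' x y := by rw [← of_add, Prod.mk_add_mk, TensorProduct.tmul_add, add_zero]
  map_smul' c x := by rw [← of_smul, Prod.smul_mk, TensorProduct.tmul_smul, smul_zero]; rfl

/-- The central element `c`. -/
def center : Affine Φ := ofProd _ (0, (TrivialLieModule.equiv ℂ _ ℂ).symm 1)

/-- The coefficient of `tⁿ`. -/
def coeff (n : ℤ) : Affine Φ →ₗ[ℂ] 𝔤 where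
  toFun x := LoopAlgebra.toFinsupp ℂ ℤ 𝔤 ((ofProd _).symm x).1 n
  map_add' x y := by simp
  map_smul' c x := by simp

/-- The coefficient of `c`. -/
def centralCoeff : Affine Φ →ₗ[ℂ] ℂ where
  toFun x := TrivialLieModule.equiv ℂ _ ℂ ((ofProd _).symm x).2
  map_add' x y := by simp
  map_smul' c x := by simp

@[simp] lemma coeff_current (m n : ℤ) (x : 𝔤) :
    coeff Φ m (current Φ n x) = if m = n then x else 0 := by
  have h : coeff Φ m (current Φ n x) =
    LoopAlgebra.toFinsupp ℂ ℤ 𝔤 (AddMonoidAlgebra.single n 1 ⊗ₜ x) m := rfl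
  rw [h, LoopAlgebra.toFinsupp_single_tmul, Finsupp.single_apply]
  simp only [eq_comm]

@[simp] lemma coeff_center (n : ℤ) : coeff Φ n (center Φ) = 0 := by
  simp [coeff, center]

@[simp] lemma centralCoeff_current (n : ℤ) (x : 𝔤) : centralCoeff Φ (current Φ n x) = 0 := by
  simp [centralCoeff, current]

@[simp] lemma centralCoeff_center : centralCoeff Φ (center Φ) = 1 := by
  simp [centralCoeff, center]

/-- The commutation relations of the affine Lie algebra. -/
lemma lie_current (m n : ℤ) (x y : 𝔤) : ⁅current Φ m x, current Φ n y⁆ =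
    current Φ (m + n) ⁅x, y⁆ + (if m + n = 0 then (m : ℂ) * Φ.form x y else 0) • center Φ := by
  apply (ofProd (affineCocycle Φ)).symm.injective
  refine Prod.ext ?_ ?_
  · change ⁅(AddMonoidAlgebra.single m 1 ⊗ₜ x : loopAlgebra ℂ ℤ 𝔤),
      (AddMonoidAlgebra.single n 1 ⊗ₜ y : loopAlgebra ℂ ℤ 𝔤)⁆ =
      AddMonoidAlgebra.single (m + n) 1 ⊗ₜ ⁅x, y⁆ + _ • 0
    rw [smul_zero, add_zero, ExtendScalars.bracket_tmul, AddMonoidAlgebra.single_mul_single,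
      one_mul]
  · change (TrivialLieModule.equiv ℂ (loopAlgebra ℂ ℤ 𝔤) ℂ).symm
        (LoopAlgebra.residuePairing ℂ ℤ 𝔤 (-Φ.form)
          (AddMonoidAlgebra.single m 1 ⊗ₜ x) (AddMonoidAlgebra.single n 1 ⊗ₜ y)) +
        ⁅(AddMonoidAlgebra.single m 1 ⊗ₜ x : loopAlgebra ℂ ℤ 𝔤),
          (0 : TrivialLieModule ℂ (loopAlgebra ℂ ℤ 𝔤) ℂ)⁆ -
        ⁅(AddMonoidAlgebra.single n 1 ⊗ₜ y : loopAlgebra ℂ ℤ 𝔤),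
          (0 : TrivialLieModule ℂ (loopAlgebra ℂ ℤ 𝔤) ℂ)⁆ =
        0 + _ • (TrivialLieModule.equiv ℂ (loopAlgebra ℂ ℤ 𝔤) ℂ).symm 1
    rw [lie_zero, lie_zero, add_zero, sub_zero, zero_add, ← map_smul, smul_eq_mul, mul_one]
    congr 1
    rw [LoopAlgebra.residuePairing_apply_apply, LoopAlgebra.toFinsupp_single_tmul,
      LoopAlgebra.toFinsupp_single_tmul, Finsupp.sum_single_index (by simp)]
    by_cases h : m + n = 0
    · obtain rfl : n = -m := by omega
      simp
    · rw [if_neg h, Finsupp.single_eq_of_ne (by omega)]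
      simp

lemma lie_center (x : Affine Φ) : ⁅x, center Φ⁆ = 0 := by
  rw [bracket_ofTwoCocycle]
  simp only [center, Equiv.symm_apply_apply, map_zero, lie_zero, trivial_lie_zero,
    add_zero, sub_zero]
  rfl

lemma center_lie (x : Affine Φ) : ⁅center Φ, x⁆ = 0 := by
  rw [← lie_skew, lie_center, neg_zero]

/-- The part of degree `n`, where `x(n)` has degree `n` and `c` has degree `0`. -/
def piece (n : ℤ) : Submodule ℂ (Affine Φ) :=
  LinearMap.range (current Φ n) ⊔ if n = 0 then Submodule.span ℂ {center Φ} else ⊥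

lemma exists_of_mem_piece {n : ℤ} {x : Affine Φ} (hx : x ∈ piece Φ n) :
    ∃ (a : 𝔤) (z : ℂ), (n ≠ 0 → z = 0) ∧ x = current Φ n a + z • center Φ := by
  obtain ⟨_, ⟨a, rfl⟩, y, hy, rfl⟩ := Submodule.mem_sup.1 hx
  split_ifs at hy with h
  · obtain ⟨z, rfl⟩ := Submodule.mem_span_singleton.1 hy
    exact ⟨a, z, fun h' => absurd h h', rfl⟩
  · rw [Submodule.mem_bot] at hy
    exact ⟨a, 0, fun _ => rfl, by simp [hy]⟩

lemma mem_piece (n : ℤ) (a : 𝔤) (z : ℂ) (h : n ≠ 0 → z = 0) :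
    current Φ n a + z • center Φ ∈ piece Φ n := by
  refine Submodule.add_mem_sup ⟨a, rfl⟩ ?_
  split_ifs with hn
  · exact Submodule.mem_span_singleton.2 ⟨z, rfl⟩
  · simp [h hn]

lemma isInternal_piece : DirectSum.IsInternal (piece Φ) := by
  rw [DirectSum.isInternal_submodule_iff_iSupIndep_and_iSup_eq_top]
  constructor
  · let π : ℤ → Affine Φ →ₗ[ℂ] Affine Φ := fun n => current Φ n ∘ₗ coeff Φ n +
      if n = 0 then (centralCoeff Φ).smulRight (center Φ) else 0
    have h1 : ∀ n, ∀ x ∈ piece Φ n, π n x = x := by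
      intro n x hx
      obtain ⟨a, z, hz, rfl⟩ := exists_of_mem_piece Φ hx
      by_cases hn : n = 0
      · simp [π, hn]
      · simp [π, hn, hz hn]
    have h2 : ∀ n m, m ≠ n → ∀ x ∈ piece Φ m, π n x = 0 := by
      intro n m hmn x hx
      obtain ⟨a, z, hz, rfl⟩ := exists_of_mem_piece Φ hx
      by_cases hn : n = 0
      · subst hn
        simp [π, hz hmn, hmn.symm]
      · simp [π, hn, hmn.symm]
    rw [iSupIndep_def]
    intro n
    rw [Submodule.disjoint_def]
    intro x hx hx'
    have : (⨆ m, ⨆ (_ : m ≠ n), piece Φ m) ≤ LinearMap.ker (π n) :=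
      iSup₂_le fun m hm y hy => h2 n m hm y hy
    rw [← h1 n x hx]
    exact this hx'
  · rw [eq_top_iff]
    rintro x -
    have hx : x = ofProd _ (((ofProd _).symm x).1, 0) +
        (centralCoeff Φ x) • center Φ := by
      apply (ofProd (affineCocycle Φ)).symm.injective
      refine Prod.ext ?_ ?_
      · change _ = _ + _ • (0 : loopAlgebra ℂ ℤ 𝔤)
        simp
      · change _ = 0 + centralCoeff Φ x • (TrivialLieModule.equiv ℂ _ ℂ).symm 1
        rw [← map_smul, smul_eq_mul, mul_one, zero_add]
        exact ((TrivialLieModule.equiv ℂ _ ℂ).symm_apply_apply _).symm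
    rw [hx]
    refine add_mem ?_ (Submodule.mem_iSup_of_mem 0 ?_)
    · let ψ : loopAlgebra ℂ ℤ 𝔤 →ₗ[ℂ] Affine Φ :=
        { toFun := fun y => ofProd _ (y, 0)
          map_add' := fun y z => by rw [← of_add, Prod.mk_add_mk, add_zero]
          map_smul' := fun c y => by rw [← of_smul, Prod.smul_mk, smul_zero]; rfl }
      change ψ _ ∈ _
      generalize ((ofProd (affineCocycle Φ)).symm x).1 = y
      rw [← (LoopAlgebra.toFinsupp ℂ ℤ 𝔤).symm_apply_apply y]
      induction LoopAlgebra.toFinsupp ℂ ℤ 𝔤 y using Finsupp.induction_linear with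
      | zero => simp
      | add f g hf hg => rw [map_add, map_add]; exact add_mem hf hg
      | single n a =>
        rw [LoopAlgebra.toFinsupp_symm_single]
        refine Submodule.mem_iSup_of_mem n (Submodule.mem_sup_left ⟨a, rfl⟩)
    · simpa using mem_piece Φ 0 0 (centralCoeff Φ x) (by simp)

/-- The grading of the affine Lie algebra. -/
def grading : LieGrading (Affine Φ) where
  piece := piece Φ
  internal := isInternal_piece Φ
  lie_mem := by
    intro i j x y hx hy
    obtain ⟨a, z, hz, rfl⟩ := exists_of_mem_piece Φ hx
    obtain ⟨b, w, hw, rfl⟩ := exists_of_mem_piece Φ hy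
    rw [lie_add, add_lie, lie_smul, lie_center, smul_zero, add_zero, smul_lie,
      center_lie, smul_zero, add_zero, lie_current]
    exact mem_piece Φ _ _ _ fun h => if_neg h

/-- On elements of nonnegative degrees the cocycle vanishes, and taking the coefficient of `t⁰` is
compatible with brackets. -/
lemma lie_nonneg (x y : (grading Φ).nonneg) :
    coeff Φ 0 ⁅(x : Affine Φ), (y : Affine Φ)⁆ = ⁅coeff Φ 0 x, coeff Φ 0 y⁆ ∧
      centralCoeff Φ ⁅(x : Affine Φ), (y : Affine Φ)⁆ = 0 := by
  obtain ⟨x, hx⟩ := x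
  obtain ⟨y, hy⟩ := y
  change x ∈ ⨆ n : {n : ℤ | 0 ≤ n}, piece Φ n at hx
  change y ∈ ⨆ n : {n : ℤ | 0 ≤ n}, piece Φ n at hy
  change coeff Φ 0 ⁅x, y⁆ = ⁅coeff Φ 0 x, coeff Φ 0 y⁆ ∧ centralCoeff Φ ⁅x, y⁆ = 0
  induction hx using Submodule.iSup_induction' with
  | mem i x hx =>
    induction hy using Submodule.iSup_induction' with
    | mem j y hy =>
      obtain ⟨i, hi⟩ := i
      obtain ⟨j, hj⟩ := j
      change 0 ≤ i at hi
      change 0 ≤ j at hj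
      obtain ⟨a, z, hz, rfl⟩ := exists_of_mem_piece Φ hx
      obtain ⟨b, w, hw, rfl⟩ := exists_of_mem_piece Φ hy
      rw [lie_add, add_lie, lie_smul, lie_center, smul_zero, add_zero, smul_lie,
        center_lie, smul_zero, add_zero, lie_current]
      constructor
      · rcases hi.eq_or_lt with rfl | hi
        · rcases hj.eq_or_lt with rfl | hj
          · simp
          · simp [hj.ne]
        · simp [hi.ne, (add_pos_of_pos_of_nonneg hi hj).ne,
            (add_pos_of_pos_of_nonneg hi hj).ne']
      · rcases hi.eq_or_lt with rfl | hi
        · simp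
        · simp [(add_pos_of_pos_of_nonneg hi hj).ne']
    | zero => simp
    | add a b _ _ ha hb => simp [lie_add, ha.1, hb.1, ha.2, hb.2]
  | zero => simp
  | add a b _ _ ha hb => simp [add_lie, ha.1, hb.1, ha.2, hb.2]

/-- The character of the subalgebra of elements of nonnegative degrees that vanishes on `𝔤` and on
all positive degrees and takes the value `z` at `c`. -/
def levelCharacter (z : ℂ) : LieCharacter ℂ (grading Φ).nonneg where
  toFun x := z * centralCoeff Φ x
  map_add' x y := by simp [mul_add]
  map_smul' a x := by simp; ring
  map_lie' := by
    intro x y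
    rw [LieRing.of_associative_ring_bracket, mul_comm (z * _), sub_self]
    exact mul_eq_zero_of_right _ (lie_nonneg Φ x y).2

/-- The central element `c` in the enveloping algebra `B`. -/
def centerB : (grading Φ).B :=
  UniversalEnvelopingAlgebra.ι ℂ ⟨center Φ, by
    refine Submodule.mem_iSup_of_mem (⟨0, show (0 : ℤ) ≤ 0 from le_rfl⟩ : {n : ℤ | 0 ≤ n}) ?_
    change center Φ ∈ piece Φ 0
    simpa using mem_piece Φ 0 0 1 (by simp)⟩

/-- The central element `c` in the enveloping algebra `U`. -/
def centerU : (grading Φ).U := UniversalEnvelopingAlgebra.ι ℂ (center Φ)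

/-! ### Weyl modules -/

section Weyl

variable (k : ℂ) (V : Type*) [AddCommGroup V] [Module ℂ V] [LieRingModule 𝔤 V] [LieModule ℂ 𝔤 V]

/-- A representation `V` of `𝔤`, regarded as a representation of the elements of nonnegative
degrees: `c` acts as the scalar `k` and the elements of positive degree act as `0`. -/
def AtLevel (_ : InvariantForm 𝔤) (_ : ℂ) (V : Type*) : Type _ := V

/-- The representation on `AtLevel Φ k V`. -/
def levelRep : (grading Φ).nonneg →ₗ⁅ℂ⁆ Module.End ℂ V where
  toFun x := LieModule.toEnd ℂ 𝔤 V (coeff Φ 0 x) + (k * centralCoeff Φ x) • 1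
  map_add' x y := by
    change LieModule.toEnd ℂ 𝔤 V (coeff Φ 0 ((x : Affine Φ) + y)) +
      (k * centralCoeff Φ ((x : Affine Φ) + y)) • (1 : Module.End ℂ V) = _
    simp only [map_add, mul_add, add_smul]
    abel
  map_smul' a x := by
    change LieModule.toEnd ℂ 𝔤 V (coeff Φ 0 (a • (x : Affine Φ))) +
      (k * centralCoeff Φ (a • (x : Affine Φ))) • (1 : Module.End ℂ V) = _
    simp only [map_smul, smul_eq_mul, RingHom.id_apply, smul_add, smul_smul]
    rw [mul_left_comm]
  map_lie' := by
    intro x y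
    have h := lie_nonneg Φ x y
    rw [LieSubalgebra.coe_bracket, h.1, h.2, LieHom.map_lie]
    simp only [LieRing.of_associative_ring_bracket, mul_add, add_mul, smul_mul_assoc,
      mul_smul_comm, one_mul, mul_one, mul_zero, zero_smul, add_zero, smul_add, smul_smul]
    rw [mul_comm (k * centralCoeff Φ y) (k * centralCoeff Φ x)]
    abel

instance : AddCommGroup (AtLevel Φ k V) := inferInstanceAs (AddCommGroup V)
instance : Module ℂ (AtLevel Φ k V) := inferInstanceAs (Module ℂ V)
instance : Module (grading Φ).B (AtLevel Φ k V) :=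
  Module.compHom V (UniversalEnvelopingAlgebra.lift ℂ (levelRep Φ k V)).toRingHom
instance : IsScalarTower ℂ (grading Φ).B (AtLevel Φ k V) where
  smul_assoc c b v := LinearMap.congr_fun
    (map_smul (UniversalEnvelopingAlgebra.lift ℂ (levelRep Φ k V)) c b) (show V from v)

/-- `V` is placed in degree `0`. -/
def atLevelDeg (n : ℤ) : Submodule ℂ (AtLevel Φ k V) := if n = 0 then ⊤ else ⊥

/-- The Weyl module of level `k` induced from the representation `V` of `𝔤`. -/
abbrev Weyl : Type _ := (grading Φ).Ind (AtLevel Φ k V)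

/-- The grading of the Weyl module. -/
abbrev weylDeg : ℤ → Submodule ℂ (Weyl Φ k V) := (grading Φ).indDeg (atLevelDeg Φ k V)

/-- The graded dual of the Weyl module. -/
abbrev WeylDual : Type _ :=
  GradedDual (𝒢 := grading Φ) (ℳ := weylDeg Φ k V) (isGradedAction_ind _)

/-- The grading of the graded dual of the Weyl module. -/
abbrev weylDualDeg : ℤ → Submodule ℂ (WeylDual Φ k V) := gradedDualDeg (isGradedAction_ind _)

end Weyl

end Affine

end Affine

/-! ### The normalized form, the dual Coxeter number, highest weights -/

section Root

open LieAlgebra LieAlgebra.IsKilling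

variable {𝔤 : Type*} [LieRing 𝔤] [LieAlgebra ℂ 𝔤] [FiniteDimensional ℂ 𝔤] [IsSimple ℂ 𝔤]
  {H : LieSubalgebra ℂ 𝔤} [H.IsCartanSubalgebra]

/-- `θ` is the highest root: every root is `θ` minus a sum of simple roots. -/
def IsHighestRoot (b : (rootSystem H).Base) (θ : H.root) : Prop :=
  ∀ α : H.root, (rootSystem H).root θ - (rootSystem H).root α ∈
    AddSubmonoid.closure ((rootSystem H).root '' b.support)

/-- The normalized Killing form: the multiple of the Killing form for which `(θ^∨, θ^∨) = 2`;
equivalently `(θ, θ) = 2`. Here `θ` is the highest root and `θ^∨` its coroot. -/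
def normalizedForm (θ : H.root) : InvariantForm 𝔤 where
  form := (2 / killingForm ℂ 𝔤 ((rootSystem H).coroot θ) ((rootSystem H).coroot θ)) •
    killingForm ℂ 𝔤
  invariant x y z := by
    simp only [LinearMap.smul_apply]
    rw [LieModule.traceForm_lieInvariant ℂ 𝔤 𝔤 x y z, smul_neg]
  symm := ⟨fun x y => by
    simp only [LinearMap.smul_apply]
    rw [LieModule.traceForm_comm ℂ 𝔤 𝔤 x y]⟩

open Classical in
/-- The dual Coxeter number `h^∨ = 1 + ⟨ρ, θ^∨⟩`, where `ρ` is half the sum of the positive roots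
and `θ` is the highest root. -/
def dualCoxeter (b : (rootSystem H).Base) (θ : H.root) : ℂ :=
  1 + (1 / 2) * ∑ α : H.root with b.IsPos α, (rootSystem H).pairing α θ

/-- The affine Lie algebra of `𝔤` for the normalized Killing form, with its grading. -/
abbrev affineGrading (θ : H.root) : LieGrading (Affine (normalizedForm θ)) :=
  Affine.grading (normalizedForm θ)

/-- The semi-infinite character `γ`, which vanishes on `𝔤` and has `γ(c) = 2 h^∨`. -/
abbrev criticalCharacter (b : (rootSystem H).Base) (θ : H.root) :
    LieCharacter ℂ (affineGrading θ).nonneg :=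
  Affine.levelCharacter (normalizedForm θ) (2 * dualCoxeter b θ)

/-- The character `-γ`. -/
abbrev negCriticalCharacter (b : (rootSystem H).Base) (θ : H.root) :
    LieCharacter ℂ (affineGrading θ).nonneg :=
  Affine.levelCharacter (normalizedForm θ) (-(2 * dualCoxeter b θ))

/-- The dual level `-2 h^∨ - k` of the level `k`. -/
def dualLevel (b : (rootSystem H).Base) (θ : H.root) (k : ℂ) : ℂ := -2 * dualCoxeter b θ - k

/-- The representation `V` of `𝔤` has a highest weight vector of weight `lam`. -/
def HasHighestWeight (b : (rootSystem H).Base) (lam : Module.Dual ℂ H) (V : Type*) [AddCommGroup V]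
    [Module ℂ V] [LieRingModule 𝔤 V] : Prop :=
  ∃ v : V, v ≠ 0 ∧ (∀ h : H, ⁅(h : 𝔤), v⁆ = lam h • v) ∧
    ∀ α : H.root, b.IsPos α → ∀ x ∈ rootSpace H α.1, ⁅x, v⁆ = 0

/-- `V` is a model of `V_λ`: a finite-dimensional irreducible representation with highest
weight `lam`. -/
structure IsHighestWeightModule (b : (rootSystem H).Base) (lam : Module.Dual ℂ H) (V : Type*)
    [AddCommGroup V] [Module ℂ V] [LieRingModule 𝔤 V] : Prop where
  finite : FiniteDimensional ℂ V
  irreducible : LieModule.IsIrreducible ℂ 𝔤 V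
  highest : HasHighestWeight b lam V

end Root

end

end SemiInf

end

open SemiInf

open scoped TensorProduct

noncomputable section

namespace SemiInf

section

attribute [local instance 100] LieRing.ofAssociativeRing

open UniversalEnvelopingAlgebra

attribute [-simp] ι_apply lift_ι_apply'

/-! ### Induction principles for enveloping algebras -/

section Induction

variable {L : Type*} [LieRing L] [LieAlgebra ℂ L] {P : Env L → Prop}

/-! The triangular decomposition U = B ⊗ N = N ⊗ B identifies B-linear maps on U with maps on N, and
N^⊛ ⊗_N U with N^⊛ ⊗ B. The two models therefore force both actions on N^⊛ ⊗ B, which gives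
uniqueness; the content of (0) is that the two actions commute. The decomposition is obtained
without a PBW basis: U(L) is made to act on Hom(U(K), U(K')) by the formulas of a coinduced module,
and this action separates the products b n (`coindLie_lie`, `triangularMul_injective`).

Commutation: right multiplication by B commutes with the left action at once, and N is generated in
degree -1 because 𝔤 = [𝔤, 𝔤]. It remains to compare x((f ⊗ 1)Y) with (x(f ⊗ 1))Y for Y of degree -1.
Evaluated at n in N, after moving x to the left in n x, the two sides agree up to f(n) times the
difference between γ([X, Y]_{≥0}) and the trace of Z ↦ [[Z, Y]_{<0}, X]_{≥0}, where X is the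
nonnegative part of the first tensor factor (`botPart_mulN`). For Y = y(-1) and X with t-coefficient
X₁ the trace is tr(ad X₁ ad y), and the character gives 2h^∨ (X₁, y). So everything rests on the
identity that the Killing form is 2h^∨ times the normalized form (`IsHighestRoot.killingForm_eq`).
It is checked on θ^∨, where the Killing form is the sum of ⟨α, θ^∨⟩² over all roots and ⟨α, θ^∨⟩ is
0 or 1 for every positive α ≠ θ.

For (1), S_γ ⊗_U (U ⊗_B E) is N^⊛ ⊗ E, and this is the whole coinduced module because the N_i are
finite-dimensional and a grading bounded below confines a homogeneous map N → E to finitely many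
degrees. For (2), a map from S_γ to a coinduced module is determined by the values at 1 of the
images of f ⊗ 1, because N^⊛ ⊗ 1 generates S_γ also as a left B-module (`eq_top_of_left_closed`); by
duality in finite dimensions these data form N ⊗ E. The twist by ±γ shifts the level by ±2h^∨. For
(3), the module coinduced from V is the graded dual of the module induced from V^*, and V_{λ*} ≅
V_λ^* because highest weights determine irreducible representations. -/

lemma env_induction_left (one : P 1) (mul : ∀ x u, P u → P (ι ℂ x * u))
    (add : ∀ u v, P u → P v → P (u + v)) (smul : ∀ (c : ℂ) u, P u → P (c • u)) (u : Env L) :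
    P u := by
  -- The elements whose left multiplication preserves P form a subalgebra containing the Lie
  -- algebra, so it is everything; it is then applied to 1.
  let A : Subalgebra ℂ (Env L) :=
    { carrier := {u | ∀ v, P v → P (u * v)}
      mul_mem' := fun {a b} ha hb v hv => by rw [mul_assoc]; exact ha _ (hb _ hv)
      add_mem' := fun {a b} ha hb v hv => by rw [add_mul]; exact add _ _ (ha _ hv) (hb _ hv)
      algebraMap_mem' := fun c v hv => by rw [← Algebra.smul_def]; exact smul _ _ hv }
  simpa using mem_of_ι_mem A (fun x v hv => mul x v hv) u 1 one

lemma env_induction_right (one : P 1) (mul : ∀ x u, P u → P (u * ι ℂ x))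
    (add : ∀ u v, P u → P v → P (u + v)) (smul : ∀ (c : ℂ) u, P u → P (c • u)) (u : Env L) :
    P u := by
  let A : Subalgebra ℂ (Env L) :=
    { carrier := {u | ∀ v, P v → P (v * u)}
      mul_mem' := fun {a b} ha hb v hv => by rw [← mul_assoc]; exact hb _ (ha _ hv)
      add_mem' := fun {a b} ha hb v hv => by rw [mul_add]; exact add _ _ (ha _ hv) (hb _ hv)
      algebraMap_mem' := fun c v hv => by
        rw [← Algebra.commutes, ← Algebra.smul_def]; exact smul _ _ hv }
  simpa using mem_of_ι_mem A (fun x v hv => mul x v hv) u 1 one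

/-- Two algebra homomorphisms on an enveloping algebra agree if they agree on the Lie algebra. -/
lemma env_hom_ext {A : Type*} [Ring A] [Algebra ℂ A] {f g : Env L →ₐ[ℂ] A}
    (h : ∀ x : L, f (ι ℂ x) = g (ι ℂ x)) : f = g :=
  UniversalEnvelopingAlgebra.hom_ext ℂ (LieHom.ext h)

end Induction

/-- Contracting against a separating set of functionals detects tensors. -/
lemma tensor_eq_zero_of_forall {M V : Type*} [AddCommGroup M] [Module ℂ M] [AddCommGroup V]
    [Module ℂ V] (S : Set (Module.Dual ℂ V)) (hS : ∀ v, (∀ f ∈ S, f v = 0) → v = 0)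
    (t : M ⊗[ℂ] V) (h : ∀ f ∈ S, TensorProduct.rid ℂ M (f.lTensor M t) = 0) : t = 0 := by
  classical
  let b := Module.Basis.ofVectorSpace ℂ M
  -- A basis of M turns the tensor into a finite family of vectors of V, and contraction with f
  -- applies f to each of them.
  let e := TensorProduct.equivFinsuppOfBasisLeft (N := V) b
  apply e.injective
  rw [map_zero]
  ext i
  apply hS
  intro f hf
  have key : ∀ t : M ⊗[ℂ] V, f (e t i) = b.repr (TensorProduct.rid ℂ M (f.lTensor M t)) i := by
    intro t
    induction t with
    | zero => simp
    | add x y hx hy => simp only [map_add, Finsupp.add_apply, hx, hy]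
    | tmul m v => simp [e, mul_comm]
  rw [key, h f hf]
  simp

/-! ### The triangular decomposition of an enveloping algebra -/

section PBW

variable {L : Type*} [LieRing L] [LieAlgebra ℂ L] (K K' : LieSubalgebra ℂ L)

/-- The homomorphism of enveloping algebras given by a subalgebra. -/
def envIncl : Env K →ₐ[ℂ] Env L := lift ℂ ((ι ℂ).comp K.incl)

@[simp] lemma envIncl_ι (x : K) : envIncl K (ι ℂ x) = ι ℂ (x : L) := lift_ι_apply ℂ _ x

/-- The action of `K` on `L ⊗ U(K)` by the adjoint action and left multiplication. -/
def adTensor : Env K →ₐ[ℂ] Module.End ℂ (L ⊗[ℂ] Env K) :=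
  lift ℂ
    { toFun := fun z => (LieAlgebra.ad ℂ L (z : L)).rTensor (Env K) +
        (LinearMap.mulLeft ℂ (ι ℂ z)).lTensor L
      map_add' := fun x y => by
        ext a u; simp [add_mul, TensorProduct.tmul_add]; abel
      map_smul' := fun c x => by
        ext a u; simp [TensorProduct.smul_tmul']
      map_lie' := fun {x y} => by
        refine TensorProduct.ext' fun a u => ?_
        simp only [LieSubalgebra.coe_bracket, LieHom.map_lie, LieRing.of_associative_ring_bracket,
          Module.End.mul_apply, LinearMap.add_apply, LinearMap.sub_apply, map_add,
          LinearMap.rTensor_tmul, LinearMap.lTensor_tmul, LieAlgebra.ad_apply,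
          LinearMap.mulLeft_apply, sub_mul, mul_assoc, TensorProduct.tmul_sub,
          TensorProduct.sub_tmul]
        abel }

@[simp] lemma adTensor_ι_tmul (z : K) (x : L) (u : Env K) :
    adTensor K (ι ℂ z) (x ⊗ₜ u) = ⁅(z : L), x⁆ ⊗ₜ u + x ⊗ₜ (ι ℂ z * u) := by
  rw [adTensor, lift_ι_apply]; rfl

/-- The multiplication map `L ⊗ U(K) → U(L)`. -/
def mulTensor : L ⊗[ℂ] Env K →ₗ[ℂ] Env L :=
  TensorProduct.lift ((LinearMap.mul ℂ (Env L)).compl₁₂ (ι ℂ : L →ₗ⁅ℂ⁆ Env L).toLinearMap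
    (envIncl K).toLinearMap)

@[simp] lemma mulTensor_tmul (x : L) (u : Env K) :
    mulTensor K (x ⊗ₜ u) = ι ℂ x * envIncl K u := rfl

/-- On generators this is z x v = [z, x] v + x z v. -/
lemma mulTensor_adTensor (n : Env K) (t : L ⊗[ℂ] Env K) :
    mulTensor K (adTensor K n t) = envIncl K n * mulTensor K t := by
  induction n using env_induction_left generalizing t with
  | one => simp
  | mul z u ih =>
    rw [map_mul, map_mul, mul_assoc, ← ih, Module.End.mul_apply]
    generalize adTensor K u t = t
    induction t with
    | zero => simp
    | add x y hx hy => simp only [map_add, hx, hy, mul_add]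
    | tmul x v =>
      rw [adTensor_ι_tmul, map_add, mulTensor_tmul, mulTensor_tmul, mulTensor_tmul, map_mul,
        envIncl_ι, LieHom.map_lie, LieRing.of_associative_ring_bracket]
      noncomm_ring
  | add u v hu hv => simp only [map_add, LinearMap.add_apply, hu, hv, add_mul]
  | smul c u hu => simp only [map_smul, LinearMap.smul_apply, hu, smul_mul_assoc]

/-- This rewrites n x with the factor from L on the left, where it can be split along K ⊕ K'. -/
lemma envIncl_mul_ι (n : Env K) (x : L) :
    envIncl K n * ι ℂ x = mulTensor K (adTensor K n (x ⊗ₜ 1)) := by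
  simp [mulTensor_adTensor]

/-- The action uses only left multiplication on the second factor. -/
lemma adTensor_mulRight (n m : Env K) (t : L ⊗[ℂ] Env K) :
    adTensor K n ((LinearMap.mulRight ℂ m).lTensor L t) =
      (LinearMap.mulRight ℂ m).lTensor L (adTensor K n t) := by
  induction n using env_induction_left generalizing t with
  | one => simp
  | mul z u ih =>
    rw [map_mul, Module.End.mul_apply, ih, Module.End.mul_apply]
    generalize adTensor K u t = t
    induction t with
    | zero => simp
    | add x y hx hy => simp only [map_add, hx, hy]
    | tmul x v => simp [mul_assoc]
  | add u v hu hv => simp only [map_add, LinearMap.add_apply, hu, hv]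
  | smul c u hu => simp only [map_smul, LinearMap.smul_apply, hu]

/-- The multiplication map `K ⊗ U(K) → U(K)`. -/
def mulSelf : K ⊗[ℂ] Env K →ₗ[ℂ] Env K :=
  TensorProduct.lift ((LinearMap.mul ℂ (Env K)).comp (ι ℂ : K →ₗ⁅ℂ⁆ Env K).toLinearMap)

@[simp] lemma mulSelf_tmul (x : K) (u : Env K) : mulSelf K (x ⊗ₜ u) = ι ℂ x * u := rfl

/-- If the first factor lies in K it stays in K, and the result can be multiplied out inside U(K).
This avoids any appeal to injectivity of U(K) → U(L), which is not yet available. -/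
lemma exists_adTensor_self (n : Env K) (t : K ⊗[ℂ] Env K) :
    ∃ t' : K ⊗[ℂ] Env K, adTensor K n (K.toSubmodule.subtype.rTensor (Env K) t) =
      K.toSubmodule.subtype.rTensor (Env K) t' ∧ mulSelf K t' = n * mulSelf K t := by
  induction n using env_induction_left generalizing t with
  | one => exact ⟨t, by simp, by simp⟩
  | mul z u ih =>
    obtain ⟨t', h1, h2⟩ := ih t
    rw [map_mul, Module.End.mul_apply, mul_assoc, ← h2, h1]
    clear h1 h2
    induction t' with
    | zero => exact ⟨0, by simp, by simp⟩
    | add x y hx hy =>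
      obtain ⟨a, ha, ha'⟩ := hx
      obtain ⟨b, hb, hb'⟩ := hy
      exact ⟨a + b, by simp only [map_add, ha, hb], by simp only [map_add, ha', hb', mul_add]⟩
    | tmul x v =>
      refine ⟨⁅z, x⁆ ⊗ₜ v + x ⊗ₜ (ι ℂ z * v), ?_, ?_⟩
      · rw [map_add, LinearMap.rTensor_tmul, LinearMap.rTensor_tmul, LinearMap.rTensor_tmul]
        exact adTensor_ι_tmul K z x v
      · rw [map_add, mulSelf_tmul, mulSelf_tmul, mulSelf_tmul, LieHom.map_lie,
          LieRing.of_associative_ring_bracket]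
        noncomm_ring
  | add u v hu hv =>
    obtain ⟨a, ha, ha'⟩ := hu t
    obtain ⟨b, hb, hb'⟩ := hv t
    exact ⟨a + b, by simp only [map_add, LinearMap.add_apply, ha, hb],
      by simp only [map_add, ha', hb', add_mul]⟩
  | smul c u hu =>
    obtain ⟨a, ha, ha'⟩ := hu t
    exact ⟨c • a, by simp only [map_smul, LinearMap.smul_apply, ha],
      by simp only [map_smul, ha', smul_mul_assoc]⟩

variable {K K'} (hK : IsCompl K.toSubmodule K'.toSubmodule)

/-- The projection to a subalgebra along a complementary subalgebra. -/
def proj (hK : IsCompl K.toSubmodule K'.toSubmodule) : L →ₗ[ℂ] K :=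
  Submodule.projectionOnto K.toSubmodule K'.toSubmodule hK

@[simp] lemma proj_left (x : K) : proj hK (x : L) = x :=
  Submodule.projectionOnto_apply_left hK x

@[simp] lemma proj_right (x : K') : proj hK (x : L) = 0 :=
  Submodule.projectionOnto_apply_right hK x

lemma proj_add_proj (x : L) : (proj hK x : L) + (proj hK.symm x : L) = x :=
  Submodule.projection_add_projection_eq_self hK x

/-- For `φ : U(K) → U(K')`, the map `x ⊗ n ↦ φ (x₁ n) + x₂ φ(n)` where `x = x₁ + x₂` is the
decomposition in `K ⊕ K'`. -/
def coindEval : (Env K →ₗ[ℂ] Env K') →ₗ[ℂ] L ⊗[ℂ] Env K →ₗ[ℂ] Env K' :=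
  (TensorProduct.lift.equiv (RingHom.id ℂ) L (Env K) (Env K')).toLinearMap ∘ₗ
    LinearMap.mk₂ ℂ (fun φ x => φ ∘ₗ LinearMap.mulLeft ℂ (ι ℂ (proj hK x)) +
      LinearMap.mulLeft ℂ (ι ℂ (proj hK.symm x)) ∘ₗ φ)
      (fun φ ψ x => by ext; simp [mul_add]; abel)
      (fun c φ x => by ext; simp)
      (fun φ x y => by ext; simp [add_mul]; abel)
      (fun c φ x => by ext; simp)

@[simp] lemma coindEval_tmul (φ : Env K →ₗ[ℂ] Env K') (x : L) (n : Env K) :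
    coindEval hK φ (x ⊗ₜ n) = φ (ι ℂ (proj hK x) * n) + ι ℂ (proj hK.symm x) * φ n := rfl

/-- The action of `L` on the maps `U(K) → U(K')`. -/
def coindLie : L →ₗ[ℂ] (Env K →ₗ[ℂ] Env K') →ₗ[ℂ] (Env K →ₗ[ℂ] Env K') :=
  LinearMap.mk₂ ℂ (fun x φ => coindEval hK φ ∘ₗ
      (LinearMap.applyₗ (x ⊗ₜ (1 : Env K))) ∘ₗ (adTensor K).toLinearMap)
    (fun x y φ => by ext; simp [TensorProduct.add_tmul])
    (fun c x φ => by ext; simp [← TensorProduct.smul_tmul'])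
    (fun x φ ψ => by ext; simp)
    (fun c x φ => by ext; simp)

/-- The right side is what the value at n x would be if φ were extended to a U(K')-linear map on
U(L): n x is expanded in L · U(K), the K-part of the first factor is absorbed in the argument and
the K'-part is pulled out. -/
lemma coindLie_apply (x : L) (φ : Env K →ₗ[ℂ] Env K') (n : Env K) :
    coindLie hK x φ n = coindEval hK φ (adTensor K n (x ⊗ₜ 1)) := rfl

lemma coindLie_apply_one (x : L) (φ : Env K →ₗ[ℂ] Env K') :
    coindLie hK x φ 1 = φ (ι ℂ (proj hK x)) + ι ℂ (proj hK.symm x) * φ 1 := by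
  simp [coindLie_apply]

/-- For z in K, the expansion of n z stays in K ⊗ U(K) and multiplies out to n z itself, by
`exists_adTensor_self`. -/
lemma coindLie_left (z : K) (φ : Env K →ₗ[ℂ] Env K') (n : Env K) :
    coindLie hK z φ n = φ (n * ι ℂ z) := by
  obtain ⟨t, h1, h2⟩ := exists_adTensor_self K n (z ⊗ₜ 1)
  rw [LinearMap.rTensor_tmul] at h1
  rw [mulSelf_tmul, mul_one] at h2
  rw [coindLie_apply, ← h2]
  change coindEval hK φ (adTensor K n (K.toSubmodule.subtype z ⊗ₜ[ℂ] 1)) = _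
  rw [h1]
  clear h1 h2
  induction t with
  | zero => simp
  | add x y hx hy => simp only [map_add, hx, hy]
  | tmul x v =>
    have h2 : proj hK.symm (x : L) = 0 := proj_right hK.symm x
    rw [LinearMap.rTensor_tmul]
    change coindEval hK φ ((x : L) ⊗ₜ v) = _
    simp [h2]

lemma coindEval_mulRight (z : K) (φ : Env K →ₗ[ℂ] Env K') (t : L ⊗[ℂ] Env K) :
    coindEval hK φ ((LinearMap.mulRight ℂ (ι ℂ z)).lTensor L t) =
      coindEval hK (coindLie hK z φ) t := by
  induction t with
  | zero => simp
  | add x y hx hy => simp only [map_add, hx, hy]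
  | tmul x v => simp [coindLie_left, mul_assoc]

/-- At n the left side is the value of x φ at n z. There n z x is expanded by first applying z to x
⊗ 1, which gives [z, x] ⊗ 1 + x ⊗ z, and the factor z on the right is absorbed in z φ. -/
lemma coindLie_comm (z : K) (x : L) (φ : Env K →ₗ[ℂ] Env K') :
    coindLie hK z (coindLie hK x φ) =
      coindLie hK ⁅(z : L), x⁆ φ + coindLie hK x (coindLie hK z φ) := by
  ext n
  rw [LinearMap.add_apply, coindLie_left, coindLie_apply, coindLie_apply,
    coindLie_apply hK x, ← coindEval_mulRight, ← adTensor_mulRight, ← map_add, ← map_add]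
  simp

/-- Induction on n from the right. The value at n z is the value at n after acting by z, and
`coindLie_comm` with the Jacobi identity carries z through both sides, so the claim for n (for all
x, y, φ) gives it for n z. At n = 1, split x and y: a pair with a member in K is covered by
`coindLie_comm`, and K' acts on values at 1 by left multiplication. -/
lemma coindLie_lie (x y : L) (φ : Env K →ₗ[ℂ] Env K') :
    coindLie hK ⁅x, y⁆ φ = coindLie hK x (coindLie hK y φ) - coindLie hK y (coindLie hK x φ) := by
  ext n
  induction n using env_induction_right generalizing x y φ with
  | one =>
    have hl : ∀ (z : K) (x : L), coindLie hK ⁅(z : L), x⁆ φ =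
        coindLie hK z (coindLie hK x φ) - coindLie hK x (coindLie hK z φ) := fun z x => by
      rw [coindLie_comm]; abel
    have hr : ∀ (z : K) (x : L), coindLie hK ⁅x, (z : L)⁆ φ =
        coindLie hK x (coindLie hK z φ) - coindLie hK z (coindLie hK x φ) := fun z x => by
      rw [← lie_skew, map_neg, LinearMap.neg_apply, hl]; abel
    have h2 : ∀ a b : K', coindLie hK ⁅(a : L), (b : L)⁆ φ 1 =
        coindLie hK a (coindLie hK b φ) 1 - coindLie hK b (coindLie hK a φ) 1 := fun a b => by
      have h : ∀ (a : K') (ψ : Env K →ₗ[ℂ] Env K'), coindLie hK a ψ 1 = ι ℂ a * ψ 1 := by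
        intro a ψ
        have := proj_left hK.symm a
        rw [coindLie_apply_one, proj_right, this, map_zero, map_zero, zero_add]
      rw [h, h, h, h, ← LieSubalgebra.coe_bracket, h, LieHom.map_lie,
        LieRing.of_associative_ring_bracket]
      noncomm_ring
    rw [← proj_add_proj hK x, ← proj_add_proj hK y]
    simp only [add_lie, lie_add, map_add, LinearMap.add_apply, LinearMap.sub_apply, h2, hl, hr]
    abel
  | mul z n ih =>
    have key : ∀ ψ : Env K →ₗ[ℂ] Env K', ψ (n * ι ℂ z) = coindLie hK z ψ n := fun ψ =>
      (coindLie_left hK z ψ n).symm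
    rw [LinearMap.sub_apply, key, key, key, coindLie_comm, coindLie_comm, coindLie_comm hK z y,
      coindLie_comm, map_add, coindLie_comm, map_add, leibniz_lie, map_add]
    simp only [LinearMap.add_apply, ih, LinearMap.sub_apply]
    abel
  | add u v hu hv => rw [map_add, map_add, hu, hv]
  | smul c u hu => rw [map_smul, map_smul, hu]

/-- The action of `U(L)` on the maps `U(K) → U(K')`. -/
def coindEnv : Env L →ₐ[ℂ] Module.End ℂ (Env K →ₗ[ℂ] Env K') :=
  lift ℂ
    { coindLie hK with
      map_lie' := fun {x y} => by
        ext1 φ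
        exact coindLie_lie hK x y φ }

lemma coindEnv_ι (x : L) : coindEnv hK (ι ℂ x) = coindLie hK x := lift_ι_apply ℂ _ x

lemma coindEnv_left (n m : Env K) (φ : Env K →ₗ[ℂ] Env K') :
    coindEnv hK (envIncl K n) φ m = φ (m * n) := by
  induction n using env_induction_left generalizing m with
  | one => simp
  | mul z n ih =>
    rw [map_mul, map_mul, Module.End.mul_apply, envIncl_ι, coindEnv_ι, coindLie_left, ih, mul_assoc]
  | add u v hu hv => simp only [map_add, LinearMap.add_apply, hu, hv, mul_add]
  | smul c u hu => simp only [map_smul, LinearMap.smul_apply, hu, mul_smul_comm]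

lemma coindEnv_right (b : Env K') (φ : Env K →ₗ[ℂ] Env K') :
    coindEnv hK (envIncl K' b) φ 1 = b * φ 1 := by
  induction b using env_induction_left with
  | one => simp
  | mul z b ih =>
    have := proj_left hK.symm z
    rw [map_mul, map_mul, Module.End.mul_apply, envIncl_ι, coindEnv_ι, coindLie_apply_one, ih,
      proj_right, this, map_zero, map_zero, zero_add, mul_assoc]
  | add u v hu hv => simp only [map_add, LinearMap.add_apply, hu, hv, add_mul]
  | smul c u hu => simp only [map_smul, LinearMap.smul_apply, hu, smul_mul_assoc]

variable (K K') in
/-- The multiplication map `U(K') ⊗ U(K) → U(L)`. -/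
def triangularMul : Env K' ⊗[ℂ] Env K →ₗ[ℂ] Env L :=
  TensorProduct.lift ((LinearMap.mul ℂ (Env L)).compl₁₂ (envIncl K').toLinearMap
    (envIncl K).toLinearMap)

@[simp] lemma triangularMul_tmul (b : Env K') (n : Env K) :
    triangularMul K K' (b ⊗ₜ n) = envIncl K' b * envIncl K n := rfl

-- For φ = f(·) 1, the product b n acts on φ so that its value at 1 is f(n) b. Thus the product in
-- U(L) determines the contraction of the tensor with every functional f on U(K).
include hK in
lemma triangularMul_injective : Function.Injective (triangularMul K K') := by
  rw [injective_iff_map_eq_zero]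
  intro t ht
  refine tensor_eq_zero_of_forall Set.univ
    (fun v hv => (Module.forall_dual_apply_eq_zero_iff ℂ v).1 fun f => hv f trivial) t ?_
  intro f _
  let φ : Env K →ₗ[ℂ] Env K' := f.smulRight 1
  have key : ∀ t, coindEnv hK (triangularMul K K' t) φ 1 =
      TensorProduct.rid ℂ _ (f.lTensor (Env K') t) := by
    intro t
    induction t with
    | zero => simp
    | add x y hx hy => simp only [map_add, LinearMap.add_apply, hx, hy]
    | tmul b n =>
      rw [triangularMul_tmul, map_mul, Module.End.mul_apply, coindEnv_right, coindEnv_left]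
      simp [φ]
  rw [← key, ht]
  simp

-- The image is stable under right multiplication by x in L: in b n x the factor x is moved to the
-- left of n, which gives a sum of terms b x' n', and each x' is split along K ⊕ K'.
include hK in
lemma triangularMul_surjective : Function.Surjective (triangularMul K K') := by
  have h1 : ∀ t : L ⊗[ℂ] Env K, ∃ s, mulTensor K t = triangularMul K K' s := by
    intro t
    induction t with
    | zero => exact ⟨0, by simp⟩
    | add x y hx hy =>
      obtain ⟨a, ha⟩ := hx
      obtain ⟨b, hb⟩ := hy
      exact ⟨a + b, by simp only [map_add, ha, hb]⟩
    | tmul x v =>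
      refine ⟨1 ⊗ₜ (ι ℂ (proj hK x) * v) + ι ℂ (proj hK.symm x) ⊗ₜ v, ?_⟩
      conv_lhs => rw [← proj_add_proj hK x]
      simp [add_mul]
  intro u
  induction u using env_induction_right with
  | one => exact ⟨1 ⊗ₜ 1, by simp⟩
  | mul x u ih =>
    obtain ⟨t, rfl⟩ := ih
    induction t with
    | zero => exact ⟨0, by simp⟩
    | add x y hx hy =>
      obtain ⟨a, ha⟩ := hx
      obtain ⟨b, hb⟩ := hy
      exact ⟨a + b, by simp only [map_add, ha, hb, add_mul]⟩
    | tmul b n =>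
      obtain ⟨s, hs⟩ := h1 (adTensor K n (x ⊗ₜ 1))
      rw [← envIncl_mul_ι] at hs
      rw [triangularMul_tmul, mul_assoc, hs]
      refine ⟨(LinearMap.mulLeft ℂ b).rTensor _ s, ?_⟩
      clear hs
      induction s with
      | zero => simp
      | add x y hx hy => simp only [map_add, hx, hy, mul_add]
      | tmul b n => simp [mul_assoc]
  | add u v hu hv =>
    obtain ⟨a, rfl⟩ := hu
    obtain ⟨b, rfl⟩ := hv
    exact ⟨a + b, by simp⟩
  | smul c u hu =>
    obtain ⟨a, rfl⟩ := hu
    exact ⟨c • a, by simp⟩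

/-- The triangular decomposition `U(K') ⊗ U(K) ≃ U(L)` for `L = K ⊕ K'`. -/
def triangularEquiv : Env K' ⊗[ℂ] Env K ≃ₗ[ℂ] Env L :=
  LinearEquiv.ofBijective (triangularMul K K')
    ⟨triangularMul_injective hK, triangularMul_surjective hK⟩

end PBW

/-! ### Gradings -/

section Gradings

variable {M M' A : Type*} [AddCommGroup M] [Module ℂ M] [AddCommGroup M'] [Module ℂ M']
  [AddCommGroup A] [Module ℂ A]

lemma iSupIndep_of_injective {𝒱 : ℤ → Submodule ℂ M} {𝒲 : ℤ → Submodule ℂ M'}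
    (h𝒲 : iSupIndep 𝒲) (f : M →ₗ[ℂ] M') (hf : Function.Injective f)
    (h : ∀ n, ∀ x ∈ 𝒱 n, f x ∈ 𝒲 n) : iSupIndep 𝒱 := by
  intro n
  rw [Submodule.disjoint_def]
  intro x hx hx'
  apply hf
  rw [map_zero]
  refine Submodule.disjoint_def.1 (h𝒲 n) _ (h n x hx) ?_
  have : (⨆ j, ⨆ (_ : j ≠ n), 𝒱 j) ≤ (⨆ j, ⨆ (_ : j ≠ n), 𝒲 j).comap f :=
    iSup₂_le fun j hj y hy => Submodule.mem_iSup_of_mem j (Submodule.mem_iSup_of_mem hj (h j y hy))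
  exact this hx'

/-- Split an element of the larger space into its part in degree n and the rest; the rest lies in
degree n and in the sum of the other degrees, so it vanishes. This makes one-sided homogeneity of an
isomorphism two-sided. -/
lemma eq_of_le_of_iSupIndep {𝒱 𝒲 : ℤ → Submodule ℂ M} (h𝒱 : ⨆ n, 𝒱 n = ⊤)
    (h𝒲 : iSupIndep 𝒲) (h : ∀ n, 𝒱 n ≤ 𝒲 n) (n : ℤ) : 𝒱 n = 𝒲 n := by
  refine le_antisymm (h n) fun x hx => ?_
  have hle : (⊤ : Submodule ℂ M) ≤ 𝒱 n ⊔ ⨆ j, ⨆ (_ : j ≠ n), 𝒱 j := by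
    rw [← h𝒱]
    refine iSup_le fun j => ?_
    by_cases hj : j = n
    · subst hj; exact le_sup_left
    · exact le_sup_of_le_right (le_iSup₂_of_le j hj le_rfl)
  obtain ⟨a, ha, b, hb, rfl⟩ := Submodule.mem_sup.1 (hle (Submodule.mem_top (x := x)))
  have hb' : b ∈ 𝒲 n := by simpa using sub_mem hx (h n ha)
  have hb0 : b = 0 := Submodule.disjoint_def.1 (h𝒲 n) b hb'
    ((iSup₂_mono fun j _ => h j) hb)
  simpa [hb0] using ha

lemma linearMap_ext_of_iSup {𝒱 : ℤ → Submodule ℂ M} (h𝒱 : ⨆ n, 𝒱 n = ⊤) {f g : M →ₗ[ℂ] M'}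
    (h : ∀ n, ∀ x ∈ 𝒱 n, f x = g x) : f = g := by
  ext x
  have hx : x ∈ ⨆ n, 𝒱 n := h𝒱 ▸ Submodule.mem_top
  induction hx using Submodule.iSup_induction' with
  | mem i x hx => exact h i x hx
  | zero => simp
  | add a b _ _ ha hb => rw [map_add, map_add, ha, hb]

lemma gradedIso_of_le {R : Type*} [Ring R] [Module R M] [Module R M'] [Algebra ℂ R]
    [IsScalarTower ℂ R M] [IsScalarTower ℂ R M'] {ℳ : ℤ → Submodule ℂ M}
    {ℳ' : ℤ → Submodule ℂ M'} (hℳ : ⨆ n, ℳ n = ⊤) (hℳ' : iSupIndep ℳ') (e : M ≃ₗ[R] M')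
    (he : ∀ n, ∀ x ∈ ℳ n, e x ∈ ℳ' n) : GradedIso R ℳ ℳ' := by
  refine ⟨e, fun n x => ⟨he n x, fun hx => ?_⟩⟩
  have h := eq_of_le_of_iSupIndep (𝒱 := ℳ)
    (𝒲 := fun n => (ℳ' n).comap (e.toLinearMap.restrictScalars ℂ)) hℳ
    (iSupIndep_of_injective hℳ' (e.toLinearMap.restrictScalars ℂ) e.injective fun _ _ h => h)
    (fun n x hx => he n x hx) n
  rw [h]
  exact hx

/-- At a homogeneous element, maps of different degrees take values in different degrees. -/
lemma iSupIndep_hom {𝒜 : ℤ → Submodule ℂ A} (h𝒜 : ⨆ n, 𝒜 n = ⊤) {ℰ : ℤ → Submodule ℂ M}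
    (hℰ : iSupIndep ℰ) {𝒯 : ℤ → Submodule ℂ (A →ₗ[ℂ] M)}
    (h : ∀ j, ∀ φ ∈ 𝒯 j, ∀ i, ∀ a ∈ 𝒜 i, φ a ∈ ℰ (i + j)) : iSupIndep 𝒯 := by
  intro j
  rw [Submodule.disjoint_def]
  intro φ hφ hφ'
  refine linearMap_ext_of_iSup h𝒜 fun i a ha => ?_
  rw [LinearMap.zero_apply]
  refine Submodule.disjoint_def.1 (hℰ (i + j)) _ (h j φ hφ i a ha) ?_
  have : (⨆ m, ⨆ (_ : m ≠ j), 𝒯 m) ≤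
      (⨆ m, ⨆ (_ : m ≠ i + j), ℰ m).comap (LinearMap.applyₗ a) :=
    iSup₂_le fun m hm ψ hψ => Submodule.mem_iSup_of_mem (i + m)
      (Submodule.mem_iSup_of_mem (by omega) (h m ψ hψ i a ha))
  exact this hφ'

lemma iSupIndep_subtype {𝒯 : ℤ → Submodule ℂ M} (h : iSupIndep 𝒯) (P : Submodule ℂ M) :
    iSupIndep fun n => (𝒯 n).comap P.subtype :=
  iSupIndep_of_injective h P.subtype P.injective_subtype fun _ _ h => h

lemma iSup_subtype (𝒯 : ℤ → Submodule ℂ M) :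
    ⨆ n, (𝒯 n).comap (⨆ j, 𝒯 j).subtype = ⊤ := by
  apply Submodule.map_injective_of_injective (⨆ j, 𝒯 j).injective_subtype
  rw [Submodule.map_iSup, Submodule.map_top, Submodule.range_subtype]
  refine iSup_congr fun n => ?_
  rw [Submodule.map_comap_subtype]
  exact inf_eq_right.2 (le_iSup 𝒯 n)

lemma iSupIndep_single : iSupIndep fun n : ℤ => if n = 0 then (⊤ : Submodule ℂ M) else ⊥ := by
  intro n
  by_cases hn : n = 0
  · subst hn
    have : (⨆ j : ℤ, ⨆ (_ : j ≠ 0), if j = 0 then (⊤ : Submodule ℂ M) else ⊥) = ⊥ := by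
      simp +contextual
    rw [this]
    exact disjoint_bot_right
  · simp [hn]

lemma iSup_single : ⨆ n : ℤ, (if n = 0 then (⊤ : Submodule ℂ M) else ⊥) = ⊤ :=
  eq_top_iff.2 (le_iSup_of_le 0 (by simp))

lemma iSupIndep_dualDeg {ℳ : ℤ → Submodule ℂ M} (hℳ : ⨆ n, ℳ n = ⊤) :
    iSupIndep (dualDeg ℳ) := by
  refine iSupIndep_hom hℳ (iSupIndep_single (M := ℂ)) fun j φ hφ i a ha => ?_
  by_cases h : i + j = 0
  · simp [h]
  · simp [h, hφ i (by omega) a ha]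

lemma tmul_mem_tensorDeg {ℳ : ℤ → Submodule ℂ M} {ℳ' : ℤ → Submodule ℂ M'} {i j : ℤ} {x : M}
    {y : M'} (hx : x ∈ ℳ i) (hy : y ∈ ℳ' j) : x ⊗ₜ[ℂ] y ∈ tensorDeg ℳ ℳ' (i + j) :=
  Submodule.subset_span ⟨i, j, rfl, x, hx, y, hy, rfl⟩

lemma iSup_tensorDeg {ℳ : ℤ → Submodule ℂ M} {ℳ' : ℤ → Submodule ℂ M'}
    (h : ⨆ n, ℳ n = ⊤) (h' : ⨆ n, ℳ' n = ⊤) : ⨆ n, tensorDeg ℳ ℳ' n = ⊤ := by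
  refine (Submodule.eq_top_iff').2 fun t => ?_
  induction t with
  | zero => simp
  | add a b ha hb => exact add_mem ha hb
  | tmul x y =>
    have hx : x ∈ ⨆ n, ℳ n := h ▸ Submodule.mem_top
    have hy : y ∈ ⨆ n, ℳ' n := h' ▸ Submodule.mem_top
    induction hx using Submodule.iSup_induction' with
    | mem i x hx =>
      induction hy using Submodule.iSup_induction' with
      | mem j y hy => exact Submodule.mem_iSup_of_mem _ (tmul_mem_tensorDeg hx hy)
      | zero => simp
      | add a b _ _ ha hb => rw [TensorProduct.tmul_add]; exact add_mem ha hb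
    | zero => simp
    | add a b _ _ ha hb => rw [TensorProduct.add_tmul]; exact add_mem ha hb

/-- A linear map is homogeneous on `M ⊗ M'` if it is so on pure tensors. -/
lemma map_mem_of_tensorDeg {ℳ : ℤ → Submodule ℂ M} {ℳ' : ℤ → Submodule ℂ M'}
    {f : M ⊗[ℂ] M' →ₗ[ℂ] A} {n : ℤ} {P : Submodule ℂ A}
    (h : ∀ i j, i + j = n → ∀ x ∈ ℳ i, ∀ y ∈ ℳ' j, f (x ⊗ₜ y) ∈ P)
    {t : M ⊗[ℂ] M'} (ht : t ∈ tensorDeg ℳ ℳ' n) : f t ∈ P := by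
  have : tensorDeg ℳ ℳ' n ≤ P.comap f := by
    refine Submodule.span_le.2 ?_
    rintro _ ⟨i, j, hij, x, hx, y, hy, rfl⟩
    exact h i j hij x hx y hy
  exact this ht

lemma iSup_map_of_surjective {ℳ : ℤ → Submodule ℂ M} (h : ⨆ n, ℳ n = ⊤) (f : M →ₗ[ℂ] M')
    (hf : Function.Surjective f) : ⨆ n, (ℳ n).map f = ⊤ := by
  rw [← Submodule.map_iSup, h, Submodule.map_top, LinearMap.range_eq_top.2 hf]

lemma exists_homogeneous_proj {ℳ : ℤ → Submodule ℂ M} (h : DirectSum.IsInternal ℳ) (i : ℤ) :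
    ∃ p : M →ₗ[ℂ] M, (∀ x, p x ∈ ℳ i) ∧ (∀ x ∈ ℳ i, p x = x) ∧
      ∀ j, j ≠ i → ∀ x ∈ ℳ j, p x = 0 := by
  classical
  let e := LinearEquiv.ofBijective (DirectSum.coeLinearMap ℳ) h
  refine ⟨(ℳ i).subtype ∘ₗ DirectSum.component ℂ ℤ (fun j => ℳ j) i ∘ₗ e.symm.toLinearMap,
    fun x => Submodule.coe_mem _, fun x hx => ?_, fun j hj x hx => ?_⟩
  · have : e.symm x = DirectSum.lof ℂ ℤ (fun j => ℳ j) i ⟨x, hx⟩ := by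
      rw [LinearEquiv.symm_apply_eq]; exact (DirectSum.coeLinearMap_lof ℳ _ ⟨x, hx⟩).symm
    simp [this]
  · have : e.symm x = DirectSum.lof ℂ ℤ (fun j => ℳ j) j ⟨x, hx⟩ := by
      rw [LinearEquiv.symm_apply_eq]; exact (DirectSum.coeLinearMap_lof ℳ _ ⟨x, hx⟩).symm
    simp [this, DirectSum.component.of, hj]

/-- A family of linear maps on the homogeneous parts, given by restriction. -/
lemma exists_linearMap_of_internal {ℳ : ℤ → Submodule ℂ M} (h : DirectSum.IsInternal ℳ)
    (f : ℤ → M →ₗ[ℂ] M') : ∃ g : M →ₗ[ℂ] M', ∀ i, ∀ x ∈ ℳ i, g x = f i x := by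
  classical
  let e := LinearEquiv.ofBijective (DirectSum.coeLinearMap ℳ) h
  refine ⟨DirectSum.toModule ℂ ℤ M' (fun i => f i ∘ₗ (ℳ i).subtype) ∘ₗ e.symm.toLinearMap,
    fun i x hx => ?_⟩
  have : e.symm x = DirectSum.lof ℂ ℤ (fun j => ℳ j) i ⟨x, hx⟩ := by
    rw [LinearEquiv.symm_apply_eq]; exact (DirectSum.coeLinearMap_lof ℳ _ ⟨x, hx⟩).symm
  simp [this]

end Gradings

/-! ### The grading of an enveloping algebra -/

section EnvDeg

variable {L : Type*} [LieRing L] [LieAlgebra ℂ L] {ℒ : ℤ → Submodule ℂ L}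

/-- Scaling degree i by 2^i is an endomorphism of the graded Lie algebra. Its extension to the
enveloping algebra multiplies the part of degree n by 2^n, and eigenspaces for distinct eigenvalues
are independent. -/
lemma iSupIndep_envDeg (h : DirectSum.IsInternal ℒ)
    (hlie : ∀ ⦃i j : ℤ⦄ ⦃x y : L⦄, x ∈ ℒ i → y ∈ ℒ j → ⁅x, y⁆ ∈ ℒ (i + j)) :
    iSupIndep (envDeg ℒ) := by
  obtain ⟨g, hg⟩ := exists_linearMap_of_internal h
    (fun i => (2 : ℂ) ^ i • (ι ℂ : L →ₗ⁅ℂ⁆ Env L).toLinearMap)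
  have hg' : ∀ i, ∀ x ∈ ℒ i, g x = (2 : ℂ) ^ i • ι ℂ x := hg
  have htop : ∀ x : L, x ∈ ⨆ n, ℒ n := fun x => h.submodule_iSup_eq_top ▸ Submodule.mem_top
  let G : L →ₗ⁅ℂ⁆ Env L :=
    { g with
      map_lie' := by
        intro x y
        change g ⁅x, y⁆ = ⁅g x, g y⁆
        induction htop x using Submodule.iSup_induction' with
        | mem i x hx =>
          induction htop y using Submodule.iSup_induction' with
          | mem j y hy =>
            rw [hg' _ _ (hlie hx hy), hg' _ _ hx, hg' _ _ hy, LieHom.map_lie, smul_lie, lie_smul,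
              smul_smul, zpow_add₀ two_ne_zero]
          | zero => simp
          | add a b _ _ ha hb => rw [lie_add, map_add, map_add, lie_add, ha, hb]
        | zero => simp
        | add a b _ _ ha hb => rw [add_lie, map_add, map_add, add_lie, ha, hb] }
  have hinj : Function.Injective fun n : ℤ => (2 : ℂ) ^ n := by
    intro m n hmn
    have h2 : ((2 : ℝ) ^ m : ℝ) = 2 ^ n := by
      have := congrArg (‖·‖) hmn
      simpa [norm_zpow] using this
    exact zpow_right_injective₀ (by norm_num) (by norm_num) h2
  have hE := (Module.End.eigenspaces_iSupIndep (lift ℂ G).toLinearMap).comp hinj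
  refine hE.mono fun n => Submodule.span_le.2 ?_
  rintro _ ⟨l, hl, rfl, rfl⟩
  rw [SetLike.mem_coe, Function.comp_apply, Module.End.mem_eigenspace_iff, AlgHom.toLinearMap_apply]
  induction l with
  | nil => simp
  | cons p l ih =>
    have h1 := ih fun q hq => hl q (List.mem_cons_of_mem _ hq)
    have h2 : lift ℂ G (ι ℂ p.2) = (2 : ℂ) ^ p.1 • ι ℂ p.2 := by
      rw [lift_ι_apply]; exact hg' _ _ (hl p List.mem_cons_self)
    rw [List.map_cons, List.prod_cons, map_mul, h1, h2, List.map_cons, List.sum_cons,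
      zpow_add₀ two_ne_zero, smul_mul_smul_comm]

lemma isInternal_envDeg (h : DirectSum.IsInternal ℒ)
    (hlie : ∀ ⦃i j : ℤ⦄ ⦃x y : L⦄, x ∈ ℒ i → y ∈ ℒ j → ⁅x, y⁆ ∈ ℒ (i + j)) :
    DirectSum.IsInternal (envDeg ℒ) :=
  (DirectSum.isInternal_submodule_iff_iSupIndep_and_iSup_eq_top _).2
    ⟨iSupIndep_envDeg h hlie, iSup_envDeg _ h.submodule_iSup_eq_top⟩

lemma envDeg_eq_bot_of_neg (h : ∀ n < 0, ℒ n = ⊥) {n : ℤ} (hn : n < 0) : envDeg ℒ n = ⊥ := by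
  rw [envDeg, Submodule.span_eq_bot]
  rintro _ ⟨l, hl, rfl, rfl⟩
  induction l with
  | nil => simp at hn
  | cons p l ih =>
    rw [List.map_cons, List.prod_cons]
    by_cases hp : p.1 < 0
    · have := hl p List.mem_cons_self
      rw [h _ hp, Submodule.mem_bot] at this
      rw [this, map_zero, zero_mul]
    · rw [List.map_cons, List.sum_cons] at hn
      rw [ih (fun q hq => hl q (List.mem_cons_of_mem _ hq)) (by omega), mul_zero]

lemma envDeg_eq_bot_of_pos (h : ∀ n, 0 ≤ n → ℒ n = ⊥) {n : ℤ} (hn : 0 < n) :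
    envDeg ℒ n = ⊥ := by
  rw [envDeg, Submodule.span_eq_bot]
  rintro _ ⟨l, hl, rfl, rfl⟩
  induction l with
  | nil => simp at hn
  | cons p l ih =>
    rw [List.map_cons, List.prod_cons]
    by_cases hp : 0 ≤ p.1
    · have := hl p List.mem_cons_self
      rw [h _ hp, Submodule.mem_bot] at this
      rw [this, map_zero, zero_mul]
    · rw [List.map_cons, List.sum_cons] at hn
      rw [ih (fun q hq => hl q (List.mem_cons_of_mem _ hq)) (by omega), mul_zero]

/-- Strong induction on m for the degree -m. A nonempty word begins with a letter of some degree
-k-1 with k < m, and the remaining word has degree -(m-k-1), since words of positive degree vanish.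
So the part of degree -m lies in the span of 1 and finitely many products of finite-dimensional
spaces. -/
lemma fg_envDeg (h : ∀ n, 0 ≤ n → ℒ n = ⊥) (hfin : ∀ n, (ℒ n).FG) (n : ℤ) :
    (envDeg ℒ n).FG := by
  by_cases hn : 0 < n
  · rw [envDeg_eq_bot_of_pos h hn]; exact Submodule.fg_bot
  obtain ⟨m, rfl⟩ : ∃ m : ℕ, n = -(m : ℤ) := ⟨n.natAbs, by omega⟩
  clear hn
  induction m using Nat.strong_induction_on with
  | _ m ih =>
  let W : Submodule ℂ (Env L) := Submodule.span ℂ {1} ⊔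
    ⨆ k : Fin m, (ℒ (-(k : ℤ) - 1)).map (ι ℂ : L →ₗ⁅ℂ⁆ Env L).toLinearMap *
      envDeg ℒ (-((m - k - 1 : ℕ) : ℤ))
  have hW : W.FG := by
    refine (Submodule.fg_span_singleton _).sup (Submodule.fg_iSup _ fun k => ?_)
    exact ((hfin _).map _).mul (ih _ (by omega))
  have hle : envDeg ℒ (-(m : ℤ)) ≤ W := by
    refine Submodule.span_le.2 ?_
    rintro _ ⟨l, hl, hln, rfl⟩
    cases l with
    | nil => exact Submodule.mem_sup_left (Submodule.mem_span_singleton_self _)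
    | cons p l =>
      rw [List.map_cons, List.prod_cons]
      have hp2 := hl p List.mem_cons_self
      have hl' : ((l.map fun p => ι ℂ p.2).prod : Env L) ∈ envDeg ℒ (l.map Prod.fst).sum :=
        Submodule.subset_span ⟨l, fun q hq => hl q (List.mem_cons_of_mem _ hq), rfl, rfl⟩
      rw [List.map_cons, List.sum_cons] at hln
      by_cases hp : 0 ≤ p.1
      · rw [h _ hp, Submodule.mem_bot] at hp2
        simp [hp2]
      by_cases hs : 0 < (l.map Prod.fst).sum
      · rw [envDeg_eq_bot_of_pos h hs, Submodule.mem_bot] at hl'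
        simp [hl']
      refine Submodule.mem_sup_right (Submodule.mem_iSup_of_mem
        (⟨(-p.1 - 1).toNat, by omega⟩ : Fin m) (Submodule.mul_mem_mul ⟨p.2, ?_, rfl⟩ ?_))
      · rw [show -((⟨(-p.1 - 1).toNat, by omega⟩ : Fin m) : ℕ) - 1 = p.1 by simp; omega]
        exact hp2
      · rw [show -((m - (⟨(-p.1 - 1).toNat, by omega⟩ : Fin m) - 1 : ℕ) : ℤ) =
          (l.map Prod.fst).sum by simp; omega]
        exact hl'
  exact Submodule.FG.of_le hW hle

end EnvDeg

namespace LieGrading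

variable {L : Type*} [LieRing L] [LieAlgebra ℂ L] (𝒢 : LieGrading L)

/-! ### The subalgebras of negative and of nonnegative degrees -/

lemma isInternal_partPiece (s : Set ℤ) (hs : ∀ i ∈ s, ∀ j ∈ s, i + j ∈ s) :
    DirectSum.IsInternal (𝒢.partPiece (𝒢.part s hs)) :=
  (DirectSum.isInternal_submodule_iff_iSupIndep_and_iSup_eq_top _).2
    ⟨iSupIndep_of_injective 𝒢.internal.submodule_iSupIndep (𝒢.part s hs).toSubmodule.subtype
      (Submodule.injective_subtype _) fun _ _ h => h, 𝒢.iSup_partPiece s hs⟩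

lemma lie_mem_partPiece (K : LieSubalgebra ℂ L) ⦃i j : ℤ⦄ ⦃x y : K⦄ (hx : x ∈ 𝒢.partPiece K i)
    (hy : y ∈ 𝒢.partPiece K j) : ⁅x, y⁆ ∈ 𝒢.partPiece K (i + j) :=
  𝒢.lie_mem hx hy

lemma partPiece_eq_bot (s : Set ℤ) (hs : ∀ i ∈ s, ∀ j ∈ s, i + j ∈ s) {n : ℤ} (hn : n ∉ s) :
    𝒢.partPiece (𝒢.part s hs) n = ⊥ := by
  rw [eq_bot_iff]
  rintro ⟨x, hx⟩ hxn
  change x ∈ 𝒢.piece n at hxn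
  change x ∈ ⨆ n : s, 𝒢.piece n at hx
  have : (⨆ n : s, 𝒢.piece n) ≤ ⨆ j, ⨆ (_ : j ≠ n), 𝒢.piece j :=
    iSup_le fun j => le_iSup₂_of_le (j : ℤ) (fun h => hn (h ▸ j.2)) le_rfl
  have := Submodule.disjoint_def.1 (𝒢.internal.submodule_iSupIndep n) x hxn (this hx)
  exact Subtype.ext this

lemma mem_part {s : Set ℤ} {hs : ∀ i ∈ s, ∀ j ∈ s, i + j ∈ s} {n : ℤ} (hn : n ∈ s) {x : L}
    (hx : x ∈ 𝒢.piece n) : x ∈ 𝒢.part s hs :=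
  Submodule.mem_iSup_of_mem (⟨n, hn⟩ : s) hx

lemma mem_neg {n : ℤ} (hn : n < 0) {x : L} (hx : x ∈ 𝒢.piece n) : x ∈ 𝒢.neg :=
  𝒢.mem_part (s := {n | n < 0}) hn hx

lemma mem_nonneg {n : ℤ} (hn : 0 ≤ n) {x : L} (hx : x ∈ 𝒢.piece n) : x ∈ 𝒢.nonneg :=
  𝒢.mem_part (s := {n | 0 ≤ n}) hn hx

lemma isCompl_neg_nonneg : IsCompl 𝒢.neg.toSubmodule 𝒢.nonneg.toSubmodule := by
  have h1 : 𝒢.neg.toSubmodule = ⨆ n ∈ {n : ℤ | n < 0}, 𝒢.piece n := by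
    rw [iSup_subtype']; rfl
  have h2 : 𝒢.nonneg.toSubmodule = ⨆ n ∈ {n : ℤ | 0 ≤ n}, 𝒢.piece n := by
    rw [iSup_subtype']; rfl
  refine ⟨?_, ?_⟩
  · rw [h1, h2]
    refine 𝒢.internal.submodule_iSupIndep.disjoint_biSup_biSup ?_
    rw [Set.disjoint_left]
    intro a ha hb
    exact absurd (show a < 0 from ha) (not_lt.2 hb)
  · rw [codisjoint_iff, eq_top_iff, ← 𝒢.iSup_piece]
    refine iSup_le fun n => ?_
    rcases lt_or_ge n 0 with hn | hn
    · exact le_sup_of_le_left fun x hx => 𝒢.mem_neg hn hx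
    · exact le_sup_of_le_right fun x hx => 𝒢.mem_nonneg hn hx

lemma isInternal_degU : DirectSum.IsInternal 𝒢.degU :=
  isInternal_envDeg 𝒢.internal 𝒢.lie_mem

lemma isInternal_degN : DirectSum.IsInternal 𝒢.degN :=
  isInternal_envDeg (𝒢.isInternal_partPiece _ _) (𝒢.lie_mem_partPiece _)

lemma isInternal_degB : DirectSum.IsInternal 𝒢.degB :=
  isInternal_envDeg (𝒢.isInternal_partPiece _ _) (𝒢.lie_mem_partPiece _)

lemma iSup_degB : ⨆ n, 𝒢.degB n = ⊤ := iSup_envDeg _ (𝒢.iSup_partPiece _ _)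

lemma degB_eq_bot {n : ℤ} (hn : n < 0) : 𝒢.degB n = ⊥ :=
  envDeg_eq_bot_of_neg (fun n hn => 𝒢.partPiece_eq_bot _ _ (by simpa using hn)) hn

lemma degN_eq_bot {n : ℤ} (hn : 0 < n) : 𝒢.degN n = ⊥ :=
  envDeg_eq_bot_of_pos (fun n hn => 𝒢.partPiece_eq_bot _ _ (by simpa using hn)) hn

lemma fg_degN (hfin : ∀ n, (𝒢.piece n).FG) (n : ℤ) : (𝒢.degN n).FG := by
  refine fg_envDeg (fun n hn => 𝒢.partPiece_eq_bot _ _ (by simpa using hn)) (fun n => ?_) n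
  refine Submodule.fg_of_fg_map_injective _ 𝒢.neg.toSubmodule.injective_subtype ?_
  exact Submodule.FG.of_le (hfin n) (Submodule.map_comap_le _ _)

lemma envIncl_mem_degU (K : LieSubalgebra ℂ L) {n : ℤ} {u : Env K}
    (hu : u ∈ envDeg (𝒢.partPiece K) n) : envIncl K u ∈ 𝒢.degU n := by
  have : envDeg (𝒢.partPiece K) n ≤ (𝒢.degU n).comap (envIncl K).toLinearMap := by
    refine Submodule.span_le.2 ?_
    rintro _ ⟨l, hl, hn, rfl⟩
    refine Submodule.subset_span ⟨l.map fun p => (p.1, (p.2 : L)), ?_, ?_, ?_⟩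
    · intro p hp
      obtain ⟨q, hq, rfl⟩ := List.mem_map.1 hp
      exact hl q hq
    · rw [List.map_map]; exact hn
    · rw [List.map_map, AlgHom.toLinearMap_apply, map_list_prod, List.map_map]
      congr 2
      ext p
      simp
  exact this hu

lemma ιB_mem_degU {n : ℤ} {b : 𝒢.B} (hb : b ∈ 𝒢.degB n) : 𝒢.ιB b ∈ 𝒢.degU n :=
  𝒢.envIncl_mem_degU 𝒢.nonneg hb

lemma ιN_mem_degU {n : ℤ} {b : 𝒢.N} (hb : b ∈ 𝒢.degN n) : 𝒢.ιN b ∈ 𝒢.degU n :=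
  𝒢.envIncl_mem_degU 𝒢.neg hb

lemma ιB_ι (x : 𝒢.nonneg) : 𝒢.ιB (ι ℂ x) = ι ℂ (x : L) := envIncl_ι _ x

lemma ιN_ι (x : 𝒢.neg) : 𝒢.ιN (ι ℂ x) = ι ℂ (x : L) := envIncl_ι _ x

/-- The isomorphism `B ⊗ N ≃ U`. -/
def equivBN : 𝒢.B ⊗[ℂ] 𝒢.N ≃ₗ[ℂ] 𝒢.U := triangularEquiv 𝒢.isCompl_neg_nonneg

/-- The isomorphism `N ⊗ B ≃ U`. -/
def equivNB : 𝒢.N ⊗[ℂ] 𝒢.B ≃ₗ[ℂ] 𝒢.U := triangularEquiv 𝒢.isCompl_neg_nonneg.symm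

@[simp] lemma equivBN_tmul (b : 𝒢.B) (n : 𝒢.N) : 𝒢.equivBN (b ⊗ₜ n) = 𝒢.ιB b * 𝒢.ιN n := rfl

@[simp] lemma equivNB_tmul (n : 𝒢.N) (b : 𝒢.B) : 𝒢.equivNB (n ⊗ₜ b) = 𝒢.ιN n * 𝒢.ιB b := rfl

lemma equivBN_symm_mul (b : 𝒢.B) (n : 𝒢.N) : 𝒢.equivBN.symm (𝒢.ιB b * 𝒢.ιN n) = b ⊗ₜ n := by
  rw [← equivBN_tmul, LinearEquiv.symm_apply_apply]

lemma equivNB_symm_mul (n : 𝒢.N) (b : 𝒢.B) : 𝒢.equivNB.symm (𝒢.ιN n * 𝒢.ιB b) = n ⊗ₜ b := by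
  rw [← equivNB_tmul, LinearEquiv.symm_apply_apply]

lemma map_equivBN (n : ℤ) :
    (tensorDeg 𝒢.degB 𝒢.degN n).map 𝒢.equivBN.toLinearMap = 𝒢.degU n := by
  refine eq_of_le_of_iSupIndep (iSup_map_of_surjective (iSup_tensorDeg 𝒢.iSup_degB 𝒢.iSup_degN) _
    𝒢.equivBN.surjective) 𝒢.isInternal_degU.submodule_iSupIndep (fun n => ?_) n
  rintro _ ⟨t, ht, rfl⟩
  refine map_mem_of_tensorDeg (f := 𝒢.equivBN.toLinearMap) (fun i j hij x hx y hy => ?_) ht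
  exact hij ▸ mul_mem_envDeg _ (𝒢.ιB_mem_degU hx) (𝒢.ιN_mem_degU hy)

lemma map_equivNB (n : ℤ) :
    (tensorDeg 𝒢.degN 𝒢.degB n).map 𝒢.equivNB.toLinearMap = 𝒢.degU n := by
  refine eq_of_le_of_iSupIndep (iSup_map_of_surjective (iSup_tensorDeg 𝒢.iSup_degN 𝒢.iSup_degB) _
    𝒢.equivNB.surjective) 𝒢.isInternal_degU.submodule_iSupIndep (fun n => ?_) n
  rintro _ ⟨t, ht, rfl⟩
  refine map_mem_of_tensorDeg (f := 𝒢.equivNB.toLinearMap) (fun i j hij x hx y hy => ?_) ht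
  exact hij ▸ mul_mem_envDeg _ (𝒢.ιN_mem_degU hx) (𝒢.ιB_mem_degU hy)

/-- To check that a linear map on `U` is homogeneous, it suffices to look at the products `b n`. -/
lemma map_mem_of_BN {X : Type*} [AddCommGroup X] [Module ℂ X] {f : 𝒢.U →ₗ[ℂ] X} {n : ℤ}
    {P : Submodule ℂ X} (h : ∀ i j, i + j = n → ∀ b ∈ 𝒢.degB i, ∀ m ∈ 𝒢.degN j,
      f (𝒢.ιB b * 𝒢.ιN m) ∈ P) {u : 𝒢.U} (hu : u ∈ 𝒢.degU n) : f u ∈ P := by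
  rw [← map_equivBN] at hu
  obtain ⟨t, ht, rfl⟩ := hu
  exact map_mem_of_tensorDeg (f := f ∘ₗ 𝒢.equivBN.toLinearMap) h ht

lemma map_mem_of_NB {X : Type*} [AddCommGroup X] [Module ℂ X] {f : 𝒢.U →ₗ[ℂ] X} {n : ℤ}
    {P : Submodule ℂ X} (h : ∀ i j, i + j = n → ∀ m ∈ 𝒢.degN i, ∀ b ∈ 𝒢.degB j,
      f (𝒢.ιN m * 𝒢.ιB b) ∈ P) {u : 𝒢.U} (hu : u ∈ 𝒢.degU n) : f u ∈ P := by
  rw [← map_equivNB] at hu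
  obtain ⟨t, ht, rfl⟩ := hu
  exact map_mem_of_tensorDeg (f := f ∘ₗ 𝒢.equivNB.toLinearMap) h ht

/-- Linear maps on `U` that agree on the products `b n` are equal. -/
lemma hom_ext_BN {X : Type*} [AddCommGroup X] [Module ℂ X] {f g : 𝒢.U →ₗ[ℂ] X}
    (h : ∀ (b : 𝒢.B) (m : 𝒢.N), f (𝒢.ιB b * 𝒢.ιN m) = g (𝒢.ιB b * 𝒢.ιN m)) : f = g := by
  have : f ∘ₗ 𝒢.equivBN.toLinearMap = g ∘ₗ 𝒢.equivBN.toLinearMap := TensorProduct.ext' h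
  ext u
  simpa using LinearMap.congr_fun this (𝒢.equivBN.symm u)

lemma induction_NB {P : 𝒢.U → Prop} (mul : ∀ (m : 𝒢.N) (b : 𝒢.B), P (𝒢.ιN m * 𝒢.ιB b))
    (add : ∀ u v, P u → P v → P (u + v)) (u : 𝒢.U) : P u := by
  obtain ⟨t, rfl⟩ := 𝒢.equivNB.surjective u
  induction t with
  | zero => simpa using mul 0 0
  | add x y hx hy => rw [map_add]; exact add _ _ hx hy
  | tmul m b => exact mul m b

/-! ### The graded dual of `N` -/

lemma iSup_degNdual : ⨆ n, 𝒢.degNdual n = ⊤ := iSup_subtype _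

variable {𝒢} in
/-- A functional that lives on one homogeneous part of `N`, as an element of `N^⊛`. -/
def Ndual.mk {n : ℤ} (f : Module.Dual ℂ 𝒢.N) (hf : f ∈ dualDeg 𝒢.degN n) : 𝒢.Ndual :=
  ⟨f, Submodule.mem_iSup_of_mem n hf⟩

/-- The inclusion of `N^⊛` in the dual space. -/
def dualIncl : 𝒢.Ndual →ₗ[ℂ] Module.Dual ℂ 𝒢.N := Submodule.subtype _

@[simp] lemma dualIncl_apply (f : 𝒢.Ndual) : 𝒢.dualIncl f = f.toDual := rfl

variable {𝒢} in
lemma Ndual.ext {f g : 𝒢.Ndual} (h : ∀ n, f.toDual n = g.toDual n) : f = g :=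
  Subtype.ext (LinearMap.ext h)

variable {𝒢} in
lemma toDual_eq_zero {f : 𝒢.Ndual} {n i : ℤ} (hf : f ∈ 𝒢.degNdual n) (hi : i ≠ -n) {x : 𝒢.N}
    (hx : x ∈ 𝒢.degN i) : f.toDual x = 0 :=
  hf i hi x hx

lemma degNdual_eq_bot {n : ℤ} (hn : n < 0) : 𝒢.degNdual n = ⊥ := by
  rw [eq_bot_iff]
  intro f hf
  refine Ndual.ext fun m => ?_
  refine LinearMap.congr_fun (linearMap_ext_of_iSup (g := 0) 𝒢.iSup_degN fun i x hx => ?_) m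
  by_cases hi : i = -n
  · rw [hi, 𝒢.degN_eq_bot (by omega), Submodule.mem_bot] at hx
    simp [hx]
  · exact hf i hi x hx

/-- Dual bases of the homogeneous parts of `N` and `N^⊛`. -/
lemma exists_dualBasis (hfin : ∀ n, (𝒢.piece n).FG) (i : ℤ) :
    ∃ (d : ℕ) (e : Fin d → 𝒢.N) (f : Fin d → 𝒢.Ndual), (∀ k, e k ∈ 𝒢.degN i) ∧
      (∀ k, f k ∈ 𝒢.degNdual (-i)) ∧ (∀ n ∈ 𝒢.degN i, ∑ k, (f k).toDual n • e k = n) ∧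
      ∀ g ∈ 𝒢.degNdual (-i), ∑ k, g.toDual (e k) • f k = g := by
  obtain ⟨p, h1, h2, h3⟩ := exists_homogeneous_proj 𝒢.isInternal_degN i
  have : Module.Finite ℂ (𝒢.degN i) := Module.Finite.iff_fg.2 (𝒢.fg_degN hfin i)
  let b := Module.finBasis ℂ (𝒢.degN i)
  let f : Fin (Module.finrank ℂ (𝒢.degN i)) → Module.Dual ℂ 𝒢.N := fun k =>
    b.coord k ∘ₗ p.codRestrict _ h1
  have hf : ∀ k, f k ∈ dualDeg 𝒢.degN (-i) := by
    intro k j hj x hx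
    have : p.codRestrict _ h1 x = 0 := Subtype.ext (h3 j (by omega) x hx)
    simp only [f, LinearMap.comp_apply, this, map_zero]
  have hsum : ∀ n ∈ 𝒢.degN i, ∑ k, (f k) n • (b k : 𝒢.N) = n := by
    intro n hn
    have : p.codRestrict _ h1 n = ⟨n, hn⟩ := Subtype.ext (h2 n hn)
    have h := congrArg Subtype.val (b.sum_repr ⟨n, hn⟩)
    rw [AddSubmonoidClass.coe_finsetSum] at h
    simpa only [f, this, LinearMap.comp_apply, Submodule.coe_smul, Module.Basis.coord_apply] using h
  refine ⟨_, fun k => b k, fun k => Ndual.mk (f k) (hf k), fun k => (b k).2, hf, hsum, ?_⟩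
  intro g hg
  refine Ndual.ext fun m => ?_
  refine LinearMap.congr_fun (f := 𝒢.dualIncl _) (linearMap_ext_of_iSup 𝒢.iSup_degN
    fun j x hx => ?_) m
  by_cases hj : j = i
  · subst hj
    simp only [map_sum, map_smul, dualIncl_apply, LinearMap.sum_apply, LinearMap.smul_apply]
    conv_rhs => rw [← hsum x hx, map_sum]
    refine Finset.sum_congr rfl fun k _ => ?_
    rw [map_smul, smul_eq_mul, smul_eq_mul, mul_comm]
    rfl
  · simp only [map_sum, map_smul, dualIncl_apply, LinearMap.sum_apply, LinearMap.smul_apply]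
    rw [toDual_eq_zero hg (by omega) hx]
    refine Finset.sum_eq_zero fun k _ => ?_
    exact smul_eq_zero_of_right _ (hf k j (by omega) x hx)

section DualHom

variable (E : Type*) [AddCommGroup E] [Module ℂ E]

/-- The map `N^⊛ ⊗ E → Hom(N, E)`. -/
def dualHom : 𝒢.Ndual ⊗[ℂ] E →ₗ[ℂ] 𝒢.N →ₗ[ℂ] E :=
  TensorProduct.lift ((LinearMap.smulRightₗ (R := ℂ) (M₂ := 𝒢.N) (M := E)).comp 𝒢.dualIncl)

variable {E}

@[simp] lemma dualHom_tmul (f : 𝒢.Ndual) (e : E) (n : 𝒢.N) :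
    𝒢.dualHom E (f ⊗ₜ e) n = f.toDual n • e := rfl

/-- Evaluations at elements of N separate the points of N^⊛. -/
lemma dualHom_injective : Function.Injective (𝒢.dualHom E) := by
  rw [injective_iff_map_eq_zero]
  intro t ht
  rw [← (TensorProduct.comm ℂ 𝒢.Ndual E).map_eq_zero_iff]
  refine tensor_eq_zero_of_forall (Set.range fun n : 𝒢.N => (LinearMap.applyₗ n) ∘ₗ 𝒢.dualIncl)
    (fun f hf => Ndual.ext fun n => hf _ ⟨n, rfl⟩) _ ?_
  rintro _ ⟨n, rfl⟩
  have key : ∀ t : 𝒢.Ndual ⊗[ℂ] E, TensorProduct.rid ℂ E (((LinearMap.applyₗ n) ∘ₗ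
      𝒢.dualIncl).lTensor E (TensorProduct.comm ℂ 𝒢.Ndual E t)) = 𝒢.dualHom E t n := by
    intro t
    induction t with
    | zero => simp
    | add x y hx hy => simp only [map_add, hx, hy, LinearMap.add_apply]
    | tmul f e => simp
  rw [key, ht, LinearMap.zero_apply]

/-- A map that lives on finitely many degrees is the finite sum of f ⊗ φ(e) over dual bases of those
degrees. -/
lemma exists_dualHom_eq (hfin : ∀ n, (𝒢.piece n).FG) (s : Finset ℤ) (φ : 𝒢.N →ₗ[ℂ] E)
    (hφ : ∀ i ∉ s, ∀ n ∈ 𝒢.degN i, φ n = 0) : ∃ t, 𝒢.dualHom E t = φ := by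
  choose d e f he hf hef _ using 𝒢.exists_dualBasis hfin
  refine ⟨∑ i ∈ s, ∑ k, f i k ⊗ₜ φ (e i k), linearMap_ext_of_iSup 𝒢.iSup_degN fun j n hn => ?_⟩
  simp only [map_sum, LinearMap.sum_apply, dualHom_tmul]
  have h0 : ∀ i, i ≠ j → ∑ k, (f i k).toDual n • φ (e i k) = 0 := fun i hij =>
    Finset.sum_eq_zero fun k _ => by rw [toDual_eq_zero (hf i k) (by omega) hn, zero_smul]
  by_cases hj : j ∈ s
  · rw [Finset.sum_eq_single j (fun i _ hij => h0 i hij) (fun h => absurd hj h)]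
    conv_rhs => rw [← hef j n hn, map_sum]
    simp
  · rw [hφ j hj n hn]
    exact Finset.sum_eq_zero fun i hi => h0 i fun h => hj (h ▸ hi)

/-- The counterpart of `exists_dualHom_eq` with N and N^⊛ interchanged; degree i of N^⊛ is paired
with degree -i of N. -/
lemma exists_linear_on_dual (hfin : ∀ n, (𝒢.piece n).FG) (s : Finset ℤ) (g : 𝒢.Ndual →ₗ[ℂ] E)
    (hg : ∀ i ∉ s, ∀ f ∈ 𝒢.degNdual i, g f = 0) :
    ∃ t : 𝒢.N ⊗[ℂ] E, ∀ f, TensorProduct.lid ℂ E (f.toDual.rTensor E t) = g f := by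
  choose d e f he hf _ hef using 𝒢.exists_dualBasis hfin
  refine ⟨∑ i ∈ s, ∑ k, e (-i) k ⊗ₜ g (f (-i) k), fun h => ?_⟩
  let T : 𝒢.N ⊗[ℂ] E →ₗ[ℂ] 𝒢.Ndual →ₗ[ℂ] E := TensorProduct.lift
    (LinearMap.mk₂ ℂ (fun n x => (𝒢.dualIncl.flip n).smulRight x)
      (fun a b x => by ext; simp [add_smul]) (fun c a x => by ext; simp [mul_smul])
      (fun a x y => by ext; simp) (fun c a x => by ext; simp [smul_comm _ c]))
  have hT : ∀ t, T t h = TensorProduct.lid ℂ E (h.toDual.rTensor E t) := by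
    intro t
    induction t with
    | zero => simp
    | add x y hx hy => simp only [map_add, hx, hy, LinearMap.add_apply]
    | tmul n e => simp [T]
  rw [← hT]
  refine LinearMap.congr_fun (linearMap_ext_of_iSup 𝒢.iSup_degNdual fun j h hh => ?_) h
  simp only [map_sum, LinearMap.sum_apply]
  have hT' : ∀ i k, T (e (-i) k ⊗ₜ g (f (-i) k)) h = h.toDual (e (-i) k) • g (f (-i) k) :=
    fun i k => rfl
  simp only [hT']
  have h0 : ∀ i, i ≠ j → ∑ k, h.toDual (e (-i) k) • g (f (-i) k) = 0 := fun i hij =>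
    Finset.sum_eq_zero fun k _ => by rw [toDual_eq_zero hh (by omega) (he _ _), zero_smul]
  by_cases hj : j ∈ s
  · rw [Finset.sum_eq_single j (fun i _ hij => h0 i hij) (fun h => absurd hj h)]
    have := hef (-j) h (by rwa [neg_neg])
    conv_rhs => rw [← this, map_sum]
    simp
  · rw [hg j hj h hh]
    exact Finset.sum_eq_zero fun i hi => h0 i fun h => hj (h ▸ hi)

/-- N^⊛ separates N although it is smaller than the full dual: functionals composed with a
homogeneous projection belong to it, so every homogeneous component of a vector killed by N^⊛
vanishes. -/
lemma eq_zero_of_forall_dual (t : 𝒢.N ⊗[ℂ] E)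
    (h : ∀ f : 𝒢.Ndual, TensorProduct.lid ℂ E (f.toDual.rTensor E t) = 0) : t = 0 := by
  rw [← (TensorProduct.comm ℂ 𝒢.N E).map_eq_zero_iff]
  refine tensor_eq_zero_of_forall (Set.range fun f : 𝒢.Ndual => f.toDual) (fun n hn => ?_) _ ?_
  · choose p h1 h2 h3 using exists_homogeneous_proj 𝒢.isInternal_degN
    have hp : ∀ i, p i n = 0 := fun i => by
      rw [← Module.forall_dual_apply_eq_zero_iff ℂ]
      intro f
      refine hn _ ⟨Ndual.mk (n := -i) (f ∘ₗ p i) fun j hj x hx => ?_, rfl⟩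
      rw [LinearMap.comp_apply, h3 i j (by omega) x hx, map_zero]
    obtain ⟨s, hs⟩ : ∃ s : Finset ℤ, n = ∑ i ∈ s, p i n := by
      have hn : n ∈ ⨆ i, 𝒢.degN i := 𝒢.iSup_degN ▸ Submodule.mem_top
      clear * - h1 h2 h3 hn
      -- Quantifying over all finite sets that contain s lets the index sets of two summands be
      -- merged.
      have : ∀ n ∈ ⨆ i, 𝒢.degN i, ∃ s : Finset ℤ, ∀ s', s ⊆ s' → n = ∑ i ∈ s', p i n := by
        intro n hn
        induction hn using Submodule.iSup_induction' with
        | mem j x hx =>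
          refine ⟨{j}, fun s' hs' => ?_⟩
          rw [Finset.sum_eq_single j (fun i _ hij => h3 i j hij.symm x hx)
            (fun h => absurd (hs' (Finset.mem_singleton_self j)) h), h2 j x hx]
        | zero => exact ⟨∅, by simp⟩
        | add a b _ _ ha hb =>
          classical
          obtain ⟨s, hs⟩ := ha
          obtain ⟨s', hs'⟩ := hb
          refine ⟨s ∪ s', fun r hr => ?_⟩
          simp only [map_add, Finset.sum_add_distrib]
          rw [← hs r (Finset.union_subset_left hr), ← hs' r (Finset.union_subset_right hr)]
      obtain ⟨s, hs⟩ := this n hn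
      exact ⟨s, hs s subset_rfl⟩
    rw [hs]
    exact Finset.sum_eq_zero fun i _ => hp i
  · rintro _ ⟨f, rfl⟩
    have key : ∀ t : 𝒢.N ⊗[ℂ] E, TensorProduct.rid ℂ E (f.toDual.lTensor E
        (TensorProduct.comm ℂ 𝒢.N E t)) = TensorProduct.lid ℂ E (f.toDual.rTensor E t) := by
      intro t
      induction t with
      | zero => simp
      | add x y hx hy => simp only [map_add, hx, hy]
      | tmul n e => simp
    rw [key, h]

end DualHom

end LieGrading

namespace LieGrading

variable {L : Type*} [LieRing L] [LieAlgebra ℂ L] (𝒢 : LieGrading L)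

/-! ### Coinduced modules as spaces of maps on `N` -/

section Coind

variable (E : Type*) [AddCommGroup E] [Module ℂ E] [Module 𝒢.B E] [IsScalarTower ℂ 𝒢.B E]

/-- The action of `B` on `E` as a bilinear map. -/
def actB : 𝒢.B →ₗ[ℂ] E →ₗ[ℂ] E := (Algebra.lsmul ℂ ℂ E).toLinearMap

/-- The extension of a map `N → E` to a `B`-linear map `U → E`. -/
def extHom : (𝒢.N →ₗ[ℂ] E) →ₗ[ℂ] 𝒢.U →ₗ[ℂ] E :=
  LinearMap.lcomp ℂ E 𝒢.equivBN.symm.toLinearMap ∘ₗ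
    (TensorProduct.lift.equiv (RingHom.id ℂ) 𝒢.B 𝒢.N E).toLinearMap ∘ₗ
    LinearMap.mk₂ ℂ (fun φ b => 𝒢.actB E b ∘ₗ φ)
      (fun φ ψ b => by ext; simp) (fun c φ b => by ext; simp)
      (fun φ b b' => by ext; simp) (fun c φ b => by ext; simp)

variable {E}

@[simp] lemma extHom_mul (φ : 𝒢.N →ₗ[ℂ] E) (b : 𝒢.B) (n : 𝒢.N) :
    𝒢.extHom E φ (𝒢.ιB b * 𝒢.ιN n) = b • φ n := by
  change TensorProduct.lift _ (𝒢.equivBN.symm (𝒢.ιB b * 𝒢.ιN n)) = _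
  rw [equivBN_symm_mul]
  rfl

lemma extHom_B_mul (φ : 𝒢.N →ₗ[ℂ] E) (b : 𝒢.B) (u : 𝒢.U) :
    𝒢.extHom E φ (𝒢.ιB b * u) = b • 𝒢.extHom E φ u := by
  refine LinearMap.congr_fun (f := 𝒢.extHom E φ ∘ₗ LinearMap.mulLeft ℂ (𝒢.ιB b))
    (g := 𝒢.actB E b ∘ₗ 𝒢.extHom E φ) (𝒢.hom_ext_BN fun b' m => ?_) u
  change 𝒢.extHom E φ (𝒢.ιB b * (𝒢.ιB b' * 𝒢.ιN m)) = b • 𝒢.extHom E φ (𝒢.ιB b' * 𝒢.ιN m)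
  rw [← mul_assoc, ← map_mul, extHom_mul, extHom_mul, mul_smul]

variable {𝒢} in
lemma Coind.toHom_B_mul {ℰ : ℤ → Submodule ℂ E} (φ : Coind 𝒢 ℰ) (b : 𝒢.B) (u : 𝒢.U) :
    φ.toHom (𝒢.ιB b * u) = b • φ.toHom u := by
  obtain ⟨φ, hφ⟩ := φ
  change φ (𝒢.ιB b * u) = b • φ u
  induction hφ using Submodule.iSup_induction' with
  | mem i x hx => exact hx.1 b u
  | zero => simp
  | add x y _ _ hx hy => rw [LinearMap.add_apply, LinearMap.add_apply, hx, hy, smul_add]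

variable {𝒢} in
lemma Coind.ext {ℰ : ℤ → Submodule ℂ E} {φ ψ : Coind 𝒢 ℰ}
    (h : ∀ n, φ.toHom (𝒢.ιN n) = ψ.toHom (𝒢.ιN n)) : φ = ψ := by
  refine Subtype.ext (𝒢.hom_ext_BN fun b m => ?_)
  change φ.toHom _ = ψ.toHom _
  rw [Coind.toHom_B_mul, Coind.toHom_B_mul, h]

variable {ℰ : ℤ → Submodule ℂ E}

lemma extHom_dualHom_mem (hact : IsGradedAction 𝒢.degB ℰ) {n : ℤ} {t : 𝒢.Ndual ⊗[ℂ] E}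
    (ht : t ∈ tensorDeg 𝒢.degNdual ℰ n) :
    𝒢.extHom E (𝒢.dualHom E t) ∈ coindHom 𝒢 ℰ n := by
  refine map_mem_of_tensorDeg (f := 𝒢.extHom E ∘ₗ 𝒢.dualHom E) (fun i j hij f hf e he => ?_) ht
  refine ⟨𝒢.extHom_B_mul _, fun k u hu => 𝒢.map_mem_of_BN (fun p q hpq b hb m hm => ?_) hu⟩
  change 𝒢.extHom E (𝒢.dualHom E (f ⊗ₜ e)) (𝒢.ιB b * 𝒢.ιN m) ∈ _
  rw [extHom_mul, dualHom_tmul]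
  by_cases hq : q = -i
  · rw [smul_comm, show k + n = p + j by omega]
    exact Submodule.smul_mem _ _ (hact hb he)
  · rw [toDual_eq_zero hf hq hm, zero_smul, smul_zero]
    exact zero_mem _

lemma extHom_dualHom_mem_iSup (hact : IsGradedAction 𝒢.degB ℰ) (hsup : ⨆ n, ℰ n = ⊤)
    (t : 𝒢.Ndual ⊗[ℂ] E) : 𝒢.extHom E (𝒢.dualHom E t) ∈ ⨆ n, coindHom 𝒢 ℰ n := by
  have ht : t ∈ ⨆ n, tensorDeg 𝒢.degNdual ℰ n :=
    iSup_tensorDeg 𝒢.iSup_degNdual hsup ▸ Submodule.mem_top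
  induction ht using Submodule.iSup_induction' with
  | mem i x hx => exact Submodule.mem_iSup_of_mem i (𝒢.extHom_dualHom_mem hact hx)
  | zero => simp
  | add x y _ _ hx hy => rw [map_add, map_add]; exact add_mem hx hy

/-- The map `N^⊛ ⊗ E → 𝓗om_B(U, E)`. -/
def toCoind (hact : IsGradedAction 𝒢.degB ℰ) (hsup : ⨆ n, ℰ n = ⊤) :
    𝒢.Ndual ⊗[ℂ] E →ₗ[ℂ] Coind 𝒢 ℰ :=
  (𝒢.extHom E ∘ₗ 𝒢.dualHom E).codRestrict _ (𝒢.extHom_dualHom_mem_iSup hact hsup)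

lemma toCoind_toHom (hact : IsGradedAction 𝒢.degB ℰ) (hsup : ⨆ n, ℰ n = ⊤)
    (t : 𝒢.Ndual ⊗[ℂ] E) (b : 𝒢.B) (n : 𝒢.N) :
    (𝒢.toCoind hact hsup t).toHom (𝒢.ιB b * 𝒢.ιN n) = b • 𝒢.dualHom E t n :=
  𝒢.extHom_mul _ b n

lemma toCoind_toHom_N (hact : IsGradedAction 𝒢.degB ℰ) (hsup : ⨆ n, ℰ n = ⊤)
    (t : 𝒢.Ndual ⊗[ℂ] E) (n : 𝒢.N) :
    (𝒢.toCoind hact hsup t).toHom (𝒢.ιN n) = 𝒢.dualHom E t n := by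
  have := 𝒢.toCoind_toHom hact hsup t 1 n
  rwa [map_one, one_mul, one_smul] at this

lemma toCoind_mem (hact : IsGradedAction 𝒢.degB ℰ) (hsup : ⨆ n, ℰ n = ⊤) {n : ℤ}
    {t : 𝒢.Ndual ⊗[ℂ] E} (ht : t ∈ tensorDeg 𝒢.degNdual ℰ n) :
    𝒢.toCoind hact hsup t ∈ coindDeg 𝒢 ℰ n :=
  𝒢.extHom_dualHom_mem hact ht

lemma toCoind_injective (hact : IsGradedAction 𝒢.degB ℰ) (hsup : ⨆ n, ℰ n = ⊤) :
    Function.Injective (𝒢.toCoind hact hsup) := fun s t h =>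
  𝒢.dualHom_injective <| LinearMap.ext fun n => by
    rw [← 𝒢.toCoind_toHom_N hact hsup, h, 𝒢.toCoind_toHom_N]

/-- A homogeneous map φ of degree j sends N_i to degree i + j, which is zero for i < m - j, while
N_i = 0 for i > 0. So φ restricted to N lives on the finitely many degrees in [m - j, 0], and
`exists_dualHom_eq` applies. -/
lemma toCoind_surjective (hact : IsGradedAction 𝒢.degB ℰ) (hsup : ⨆ n, ℰ n = ⊤)
    (hfin : ∀ n, (𝒢.piece n).FG) (hbdd : ∃ m : ℤ, ∀ n < m, ℰ n = ⊥) :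
    Function.Surjective (𝒢.toCoind hact hsup) := by
  obtain ⟨m, hm⟩ := hbdd
  rintro ⟨φ, hφ⟩
  induction hφ using Submodule.iSup_induction' with
  | mem j φ hφ =>
    obtain ⟨t, ht⟩ := 𝒢.exists_dualHom_eq hfin (Finset.Icc (m - j) 0)
      (φ ∘ₗ 𝒢.ιN.toLinearMap) (fun i hi n hn => by
        rw [Finset.mem_Icc] at hi
        by_cases h0 : 0 < i
        · rw [𝒢.degN_eq_bot h0, Submodule.mem_bot] at hn
          rw [hn, map_zero]
        · have := hφ.2 i _ (𝒢.ιN_mem_degU hn)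
          rw [hm _ (by omega), Submodule.mem_bot] at this
          exact this)
    refine ⟨t, Coind.ext fun n => ?_⟩
    rw [toCoind_toHom_N, ht]
    rfl
  | zero => exact ⟨0, map_zero _⟩
  | add x y hx' hy' hx hy =>
    obtain ⟨a, ha⟩ := hx
    obtain ⟨b, hb⟩ := hy
    exact ⟨a + b, by rw [map_add, ha, hb]; rfl⟩

lemma iSupIndep_coindDeg (hind : iSupIndep ℰ) : iSupIndep (coindDeg 𝒢 ℰ) :=
  iSupIndep_subtype (𝒯 := coindHom 𝒢 ℰ) (iSupIndep_hom 𝒢.iSup_degU hind fun _ _ hφ => hφ.2) _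

lemma iSup_coindDeg : ⨆ n, coindDeg 𝒢 ℰ n = ⊤ := iSup_subtype _

omit [IsScalarTower ℂ 𝒢.B E] in
lemma iSup_indDeg (hsup : ⨆ n, ℰ n = ⊤) : ⨆ n, indDeg 𝒢 ℰ n = ⊤ := by
  have h := iSup_map_of_surjective (iSup_tensorDeg 𝒢.iSup_degU hsup)
    ((𝒢.indRel E).mkQ.restrictScalars ℂ) (𝒢.indRel E).mkQ_surjective
  exact h

lemma isGradedAction_coind : IsGradedAction 𝒢.degU (coindDeg 𝒢 ℰ) := by
  rintro i j u φ hu ⟨h1, h2⟩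
  refine ⟨fun b v => ?_, fun k v hv => ?_⟩
  · change φ.1 (𝒢.ιB b * v * u) = b • φ.1 (v * u)
    rw [mul_assoc]
    exact h1 b (v * u)
  · rw [← add_assoc]
    exact h2 _ _ (mul_mem_envDeg _ hv hu)

end Coind

/-! ### Twists -/

section Twist

variable {𝒢} (χ : LieAlgebra.LieCharacter ℂ 𝒢.nonneg)

lemma shift_ι (x : 𝒢.nonneg) : 𝒢.shift χ (ι ℂ x) = ι ℂ x + algebraMap ℂ 𝒢.B (χ x) :=
  lift_ι_apply ℂ _ x

lemma shift_neg_shift (b : 𝒢.B) {χ' : LieAlgebra.LieCharacter ℂ 𝒢.nonneg}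
    (h : ∀ x, χ' x = -χ x) : 𝒢.shift χ' (𝒢.shift χ b) = b := by
  have : (𝒢.shift χ').comp (𝒢.shift χ) = AlgHom.id ℂ _ := env_hom_ext fun x => by
    rw [AlgHom.comp_apply, shift_ι, map_add, shift_ι, AlgHom.commutes, h, map_neg]
    simp
  exact DFunLike.congr_fun this b

/-- A character that vanishes on the parts of nonzero degree. -/
def IsGradedCharacter : Prop := ∀ n : ℤ, n ≠ 0 → ∀ x ∈ 𝒢.partPiece 𝒢.nonneg n, χ x = 0

variable {χ}

lemma shift_mem (hχ : IsGradedCharacter χ) {n : ℤ} {b : 𝒢.B} (hb : b ∈ 𝒢.degB n) :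
    𝒢.shift χ b ∈ 𝒢.degB n := by
  have : 𝒢.degB n ≤ (𝒢.degB n).comap (𝒢.shift χ).toLinearMap := by
    refine Submodule.span_le.2 ?_
    clear hb
    rintro _ ⟨l, hl, rfl, rfl⟩
    rw [SetLike.mem_coe, Submodule.mem_comap, AlgHom.toLinearMap_apply]
    induction l with
    | nil =>
      simp only [List.map_nil, List.prod_nil, List.sum_nil, map_one]
      exact one_mem_envDeg _
    | cons p l ih =>
      have h1 := ih fun q hq => hl q (List.mem_cons_of_mem _ hq)
      rw [List.map_cons, List.sum_cons, List.map_cons, List.prod_cons, map_mul]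
      refine mul_mem_envDeg _ ?_ h1
      rw [shift_ι]
      have hp := hl p List.mem_cons_self
      refine add_mem (ι_mem_envDeg _ hp) ?_
      by_cases h0 : p.1 = 0
      · rw [h0, Algebra.algebraMap_eq_smul_one]
        exact Submodule.smul_mem _ _ (one_mem_envDeg _)
      · rw [hχ _ h0 _ hp, map_zero]
        exact zero_mem _
  exact this hb

variable {E : Type*} [AddCommGroup E] [Module ℂ E] [Module 𝒢.B E] [IsScalarTower ℂ 𝒢.B E]
  {ℰ : ℤ → Submodule ℂ E}

omit [IsScalarTower ℂ 𝒢.B E] in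
lemma isGradedAction_twist (hχ : IsGradedCharacter χ) (h : IsGradedAction 𝒢.degB ℰ) :
    IsGradedAction 𝒢.degB (twistDeg χ ℰ) := fun _ _ _ _ hb he =>
  h (shift_mem hχ hb) he

lemma isGradedAction_degB : IsGradedAction 𝒢.degB 𝒢.degB := fun _ _ _ _ ha hb =>
  mul_mem_envDeg _ ha hb

end Twist

end LieGrading

namespace LieGrading

variable {L : Type*} [LieRing L] [LieAlgebra ℂ L] (𝒢 : LieGrading L)

/-! ### Semi-infinite characters -/

/-- The component of negative degrees. -/
def pN : L →ₗ[ℂ] 𝒢.neg := proj 𝒢.isCompl_neg_nonneg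

/-- The component of nonnegative degrees. -/
def pB : L →ₗ[ℂ] 𝒢.nonneg := proj 𝒢.isCompl_neg_nonneg.symm

@[simp] lemma pN_neg (x : 𝒢.neg) : 𝒢.pN (x : L) = x := proj_left _ x
@[simp] lemma pN_nonneg (x : 𝒢.nonneg) : 𝒢.pN (x : L) = 0 := proj_right _ x
@[simp] lemma pB_neg (x : 𝒢.neg) : 𝒢.pB (x : L) = 0 := proj_right _ x
@[simp] lemma pB_nonneg (x : 𝒢.nonneg) : 𝒢.pB (x : L) = x := proj_left _ x

lemma pN_add_pB (x : L) : (𝒢.pN x : L) + (𝒢.pB x : L) = x := proj_add_proj _ x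

/-- A character of `L_{≥0}` is semi-infinite if it vanishes on nonzero degrees and
`γ([X, Y]_{≥0}) = tr (Z ↦ [[Z, Y]_{<0}, X]_{≥0})` for all `X` in `L_{≥0}` and all `Y` of degree `-1`;
the trace is expressed by a finite family of elements and coordinates. Moreover the parts of `L`
are finite-dimensional and `N` is generated in degree `-1`. -/
structure IsSemiInfinite (γ : LieAlgebra.LieCharacter ℂ 𝒢.nonneg) : Prop where
  fg : ∀ n, (𝒢.piece n).FG
  gen : Algebra.adjoin ℂ ((ι ℂ : 𝒢.neg →ₗ⁅ℂ⁆ 𝒢.N) '' {Y | Y ∈ 𝒢.partPiece 𝒢.neg (-1)}) = ⊤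
  graded : IsGradedCharacter γ
  trace : ∀ Y ∈ 𝒢.partPiece 𝒢.neg (-1), ∃ (d : ℕ) (X : Fin d → 𝒢.nonneg)
    (π : Fin d → Module.Dual ℂ 𝒢.nonneg),
    (∀ Z : 𝒢.nonneg, ∑ i, π i Z • 𝒢.pN ⁅(X i : L), (Y : L)⁆ = 𝒢.pN ⁅(Z : L), (Y : L)⁆) ∧
    ∀ Z : 𝒢.nonneg, ∑ i, π i (𝒢.pB ⁅(𝒢.pN ⁅(X i : L), (Y : L)⁆ : L), (Z : L)⁆) =
      γ (𝒢.pB ⁅(Z : L), (Y : L)⁆)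

/-! ### The two actions on `N^⊛ ⊗ B` -/

section Actions

variable {𝒢} (γ : LieAlgebra.LieCharacter ℂ 𝒢.nonneg)

/-- The map `U → B` attached to an element of `N^⊛ ⊗ B`. -/
def ev : 𝒢.Ndual ⊗[ℂ] 𝒢.B →ₗ[ℂ] 𝒢.U →ₗ[ℂ] 𝒢.B :=
  𝒢.extHom (𝒢.Twist γ 𝒢.B) ∘ₗ 𝒢.dualHom (𝒢.Twist γ 𝒢.B)

lemma ev_mul (s : 𝒢.Ndual ⊗[ℂ] 𝒢.B) (b : 𝒢.B) (n : 𝒢.N) :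
    ev γ s (𝒢.ιB b * 𝒢.ιN n) = 𝒢.shift γ b * 𝒢.dualHom 𝒢.B s n :=
  𝒢.extHom_mul (E := 𝒢.Twist γ 𝒢.B) _ b n

lemma ev_ιN (s : 𝒢.Ndual ⊗[ℂ] 𝒢.B) (n : 𝒢.N) : ev γ s (𝒢.ιN n) = 𝒢.dualHom 𝒢.B s n := by
  have := ev_mul γ s 1 n
  rwa [map_one, one_mul, map_one, one_mul] at this

lemma ev_B_mul (s : 𝒢.Ndual ⊗[ℂ] 𝒢.B) (b : 𝒢.B) (u : 𝒢.U) :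
    ev γ s (𝒢.ιB b * u) = 𝒢.shift γ b * ev γ s u :=
  𝒢.extHom_B_mul (E := 𝒢.Twist γ 𝒢.B) _ b u

lemma ev_injective : Function.Injective (ev γ) := fun s t h =>
  𝒢.dualHom_injective <| LinearMap.ext fun n => by rw [← ev_ιN γ, h, ev_ιN]

/-- Right multiplication by `B` on `N^⊛ ⊗ B`. -/
def mulB (b : 𝒢.B) : 𝒢.Ndual ⊗[ℂ] 𝒢.B →ₗ[ℂ] 𝒢.Ndual ⊗[ℂ] 𝒢.B :=
  (LinearMap.mulRight ℂ b).lTensor 𝒢.Ndual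

@[simp] lemma mulB_tmul (f : 𝒢.Ndual) (b c : 𝒢.B) : mulB b (f ⊗ₜ c) = f ⊗ₜ (c * b) := rfl

lemma ev_mulB (s : 𝒢.Ndual ⊗[ℂ] 𝒢.B) (b : 𝒢.B) (u : 𝒢.U) :
    ev γ (mulB b s) u = ev γ s u * b := by
  refine LinearMap.congr_fun (f := ev γ (mulB b s)) (g := LinearMap.mulRight ℂ b ∘ₗ ev γ s)
    (𝒢.hom_ext_BN fun c n => ?_) u
  rw [LinearMap.comp_apply, LinearMap.mulRight_apply, ev_mul, ev_mul, mul_assoc]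
  congr 1
  induction s with
  | zero => simp
  | add x y hx hy => simp only [map_add, LinearMap.add_apply, hx, hy, add_mul]
  | tmul f c => simp

variable {γ} (h : 𝒢.IsSemiInfinite γ)

/-- The isomorphism `N^⊛ ⊗ B ≃ 𝓗om_B(U, ℂ_γ ⊗ B)`. -/
def alpha : 𝒢.Ndual ⊗[ℂ] 𝒢.B ≃ₗ[ℂ] Coind 𝒢 (twistDeg γ 𝒢.degB) :=
  LinearEquiv.ofBijective
    (𝒢.toCoind (E := 𝒢.Twist γ 𝒢.B) (isGradedAction_twist h.graded isGradedAction_degB)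
      𝒢.iSup_degB)
    ⟨𝒢.toCoind_injective _ _, 𝒢.toCoind_surjective _ _ h.fg ⟨0, fun _ hn => 𝒢.degB_eq_bot hn⟩⟩

lemma alpha_toHom (s : 𝒢.Ndual ⊗[ℂ] 𝒢.B) (u : 𝒢.U) : (alpha h s).toHom u = ev γ s u := rfl

lemma alpha_mem {n : ℤ} {s : 𝒢.Ndual ⊗[ℂ] 𝒢.B} (hs : s ∈ tensorDeg 𝒢.degNdual 𝒢.degB n) :
    alpha h s ∈ coindDeg 𝒢 (twistDeg γ 𝒢.degB) n :=
  𝒢.toCoind_mem (E := 𝒢.Twist γ 𝒢.B) (isGradedAction_twist h.graded isGradedAction_degB)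
    𝒢.iSup_degB hs

include h in
lemma ev_mem {n i : ℤ} {s : 𝒢.Ndual ⊗[ℂ] 𝒢.B} (hs : s ∈ tensorDeg 𝒢.degNdual 𝒢.degB n) {u : 𝒢.U}
    (hu : u ∈ 𝒢.degU i) : ev γ s u ∈ 𝒢.degB (i + n) :=
  (alpha_mem h hs).2 i u hu

/-- The parts of the source exhaust it and map into the independent parts of the target, so
`eq_of_le_of_iSupIndep` makes the inclusions equalities. -/
lemma alpha_symm_mem {n : ℤ} {φ : Coind 𝒢 (twistDeg γ 𝒢.degB)}
    (hφ : φ ∈ coindDeg 𝒢 (twistDeg γ 𝒢.degB) n) :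
    (alpha h).symm φ ∈ tensorDeg 𝒢.degNdual 𝒢.degB n := by
  have key := eq_of_le_of_iSupIndep (𝒱 := tensorDeg 𝒢.degNdual 𝒢.degB)
    (𝒲 := fun n => (coindDeg 𝒢 (twistDeg γ 𝒢.degB) n).comap (alpha h).toLinearMap)
    (iSup_tensorDeg 𝒢.iSup_degNdual 𝒢.iSup_degB)
    (iSupIndep_of_injective (𝒢.iSupIndep_coindDeg (E := 𝒢.Twist γ 𝒢.B)
      (ℰ := twistDeg γ 𝒢.degB) 𝒢.isInternal_degB.submodule_iSupIndep) (alpha h).toLinearMap (alpha h).injective fun _ _ h => h) (fun n s hs => alpha_mem h hs) n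
  rw [key]
  simpa using hφ

/-- The left action. -/
def leftAct : 𝒢.U →ₐ[ℂ] Module.End ℂ (𝒢.Ndual ⊗[ℂ] 𝒢.B) :=
  ((alpha h).symm.conjAlgEquiv ℂ).toAlgHom.comp
    (Algebra.lsmul ℂ ℂ (Coind 𝒢 (twistDeg γ 𝒢.degB)))

lemma alpha_leftAct (u : 𝒢.U) (s : 𝒢.Ndual ⊗[ℂ] 𝒢.B) :
    alpha h (leftAct h u s) = u • alpha h s :=
  (alpha h).apply_symm_apply _

lemma ev_leftAct (u v : 𝒢.U) (s : 𝒢.Ndual ⊗[ℂ] 𝒢.B) :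
    ev γ (leftAct h u s) v = ev γ s (v * u) := by
  rw [← alpha_toHom h, alpha_leftAct, Coind.smul_toHom, alpha_toHom]

/-- On maps U → B the left action multiplies the argument, and B on the right multiplies the value.
-/
lemma leftAct_mulB (u : 𝒢.U) (b : 𝒢.B) (s : 𝒢.Ndual ⊗[ℂ] 𝒢.B) :
    leftAct h u (mulB b s) = mulB b (leftAct h u s) := by
  apply ev_injective γ
  ext v
  rw [ev_leftAct, ev_mulB, ev_mulB, ev_leftAct]

/-- The right action of `N` on `N^⊛` as a bilinear map. -/
def mulN : 𝒢.Ndual →ₗ[ℂ] 𝒢.N →ₗ[ℂ] 𝒢.Ndual :=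
  LinearMap.mk₂ ℂ Ndual.mulRight (fun f g n => rfl) (fun c f n => rfl)
    (fun f n m => Ndual.ext fun k => by
      change f.toDual ((n + m) * k) = f.toDual (n * k) + f.toDual (m * k)
      rw [add_mul, map_add])
    (fun c f n => Ndual.ext fun k => by
      change f.toDual ((c • n) * k) = c • f.toDual (n * k)
      rw [smul_mul_assoc, map_smul])

@[simp] lemma mulN_toDual (f : 𝒢.Ndual) (n m : 𝒢.N) :
    (mulN f n).toDual m = f.toDual (n * m) := rfl

lemma mulN_mul (f : 𝒢.Ndual) (n m : 𝒢.N) : mulN f (n * m) = mulN (mulN f n) m :=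
  Ndual.ext fun k => by simp [mul_assoc]

lemma mulN_mem {f : 𝒢.Ndual} {n : 𝒢.N} {i j : ℤ} (hf : f ∈ 𝒢.degNdual i) (hn : n ∈ 𝒢.degN j) :
    mulN f n ∈ 𝒢.degNdual (i + j) := fun k hk m hm =>
  toDual_eq_zero hf (show j + k ≠ -i by omega) (mul_mem_envDeg _ hn hm)

/-- The map `N^⊛ ⊗ U → N^⊛ ⊗ B` with `f ⊗ n b ↦ f n ⊗ b`. -/
def collapse : 𝒢.Ndual ⊗[ℂ] 𝒢.U →ₗ[ℂ] 𝒢.Ndual ⊗[ℂ] 𝒢.B :=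
  (TensorProduct.lift mulN).rTensor 𝒢.B ∘ₗ (TensorProduct.assoc ℂ 𝒢.Ndual 𝒢.N 𝒢.B).symm.toLinearMap
    ∘ₗ 𝒢.equivNB.symm.toLinearMap.lTensor 𝒢.Ndual

lemma collapse_tmul (f : 𝒢.Ndual) (n : 𝒢.N) (b : 𝒢.B) :
    collapse (f ⊗ₜ (𝒢.ιN n * 𝒢.ιB b)) = mulN f n ⊗ₜ b := by
  simp [collapse, equivNB_symm_mul]

lemma collapse_B (f : 𝒢.Ndual) (b : 𝒢.B) : collapse (f ⊗ₜ 𝒢.ιB b) = f ⊗ₜ[ℂ] b := by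
  have := collapse_tmul f 1 b
  rw [map_one, one_mul] at this
  rw [this]
  congr 1
  exact Ndual.ext fun k => by simp

lemma collapse_N_mul (f : 𝒢.Ndual) (n : 𝒢.N) (u : 𝒢.U) :
    collapse (f ⊗ₜ (𝒢.ιN n * u)) = collapse (mulN f n ⊗ₜ u) := by
  induction u using 𝒢.induction_NB with
  | mul m b => rw [← mul_assoc, ← map_mul, collapse_tmul, collapse_tmul, mulN_mul]
  | add u v hu hv => rw [mul_add, TensorProduct.tmul_add, TensorProduct.tmul_add, map_add, map_add,
      hu, hv]

lemma collapse_mem {f : 𝒢.Ndual} {u : 𝒢.U} {i j : ℤ} (hf : f ∈ 𝒢.degNdual i)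
    (hu : u ∈ 𝒢.degU j) : collapse (f ⊗ₜ u) ∈ tensorDeg 𝒢.degNdual 𝒢.degB (i + j) := by
  refine 𝒢.map_mem_of_NB (f := collapse ∘ₗ TensorProduct.mk ℂ _ _ f) (fun p q hpq m hm b hb => ?_) hu
  change collapse (f ⊗ₜ (𝒢.ιN m * 𝒢.ιB b)) ∈ _
  rw [collapse_tmul, ← hpq, ← add_assoc]
  exact tmul_mem_tensorDeg (mulN_mem hf hm) hb

variable (𝒢) in
/-- The map `N^⊛ ⊗ B → N^⊛ ⊗_N U`. -/
def toRightModel : 𝒢.Ndual ⊗[ℂ] 𝒢.B →ₗ[ℂ] 𝒢.RightModel :=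
  𝒢.rightRel.mkQ ∘ₗ 𝒢.ιB.toLinearMap.lTensor 𝒢.Ndual

variable (𝒢) in
/-- The map `N^⊛ ⊗_N U → N^⊛ ⊗ B`. -/
def ofRightModel : 𝒢.RightModel →ₗ[ℂ] 𝒢.Ndual ⊗[ℂ] 𝒢.B :=
  𝒢.rightRel.liftQ collapse <| by
    refine Submodule.span_le.2 ?_
    rintro _ ⟨f, n, u, rfl⟩
    rw [SetLike.mem_coe, LinearMap.mem_ker, map_sub, collapse_N_mul]
    exact sub_self _

lemma mk_N_mul (f : 𝒢.Ndual) (n : 𝒢.N) (u : 𝒢.U) :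
    (Submodule.Quotient.mk (f ⊗ₜ (𝒢.ιN n * u)) : 𝒢.RightModel) =
      Submodule.Quotient.mk (mulN f n ⊗ₜ u) := by
  refine ((Submodule.Quotient.eq 𝒢.rightRel).2 ?_).symm
  exact Submodule.subset_span ⟨f, n, u, rfl⟩

variable (𝒢) in
/-- The isomorphism `N^⊛ ⊗ B ≃ N^⊛ ⊗_N U`. -/
def beta : 𝒢.Ndual ⊗[ℂ] 𝒢.B ≃ₗ[ℂ] 𝒢.RightModel :=
  LinearEquiv.ofLinearMap 𝒢.toRightModel 𝒢.ofRightModel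
    (by
      refine Submodule.linearMap_qext _ (TensorProduct.ext' fun f u => ?_)
      change 𝒢.toRightModel (collapse (f ⊗ₜ u)) = Submodule.Quotient.mk (f ⊗ₜ u)
      induction u using 𝒢.induction_NB with
      | mul m b => rw [collapse_tmul, mk_N_mul]; rfl
      | add u v hu hv => rw [TensorProduct.tmul_add, map_add, map_add, hu, hv]; rfl)
    (by
      refine TensorProduct.ext' fun f b => ?_
      exact collapse_B f b)

variable (𝒢) in
/-- The right action of `U` on `N^⊛ ⊗_N U`. -/
def rightModelAct : 𝒢.Uᵐᵒᵖ →ₐ[ℂ] Module.End ℂ 𝒢.RightModel :=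
  AlgHom.ofLinearMap
    { toFun := fun u => Submodule.mapQ 𝒢.rightRel 𝒢.rightRel
        ((LinearMap.mulRight ℂ u.unop).lTensor 𝒢.Ndual) <| by
          refine Submodule.span_le.2 ?_
          rintro _ ⟨f, n, v, rfl⟩
          exact Submodule.subset_span ⟨f, n, v * u.unop, by simp [mul_assoc]⟩
      map_add' := fun u v => Submodule.linearMap_qext _ (TensorProduct.ext' fun f w => by
        change (Submodule.Quotient.mk (f ⊗ₜ (w * (u.unop + v.unop))) : 𝒢.RightModel) =
          Submodule.Quotient.mk (f ⊗ₜ (w * u.unop)) + Submodule.Quotient.mk (f ⊗ₜ (w * v.unop))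
        rw [mul_add, TensorProduct.tmul_add, Submodule.Quotient.mk_add])
      map_smul' := fun c u => Submodule.linearMap_qext _ (TensorProduct.ext' fun f w => by
        change (Submodule.Quotient.mk (f ⊗ₜ (w * (c • u.unop))) : 𝒢.RightModel) =
          c • Submodule.Quotient.mk (f ⊗ₜ (w * u.unop))
        rw [mul_smul_comm, TensorProduct.tmul_smul, Submodule.Quotient.mk_smul]) }
    (Submodule.linearMap_qext _ (TensorProduct.ext' fun f w => by
      change (Submodule.Quotient.mk (f ⊗ₜ (w * 1)) : 𝒢.RightModel) = Submodule.Quotient.mk (f ⊗ₜ w)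
      rw [mul_one]))
    (fun u v => Submodule.linearMap_qext _ (TensorProduct.ext' fun f w => by
      change (Submodule.Quotient.mk (f ⊗ₜ (w * (v.unop * u.unop))) : 𝒢.RightModel) =
        Submodule.Quotient.mk (f ⊗ₜ (w * v.unop * u.unop))
      rw [mul_assoc]))

variable (𝒢) in
/-- The right action. -/
def rightAct : 𝒢.Uᵐᵒᵖ →ₐ[ℂ] Module.End ℂ (𝒢.Ndual ⊗[ℂ] 𝒢.B) :=
  (𝒢.beta.symm.conjAlgEquiv ℂ).toAlgHom.comp 𝒢.rightModelAct

lemma rightAct_tmul (u : 𝒢.U) (f : 𝒢.Ndual) (b : 𝒢.B) :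
    𝒢.rightAct (MulOpposite.op u) (f ⊗ₜ b) = collapse (f ⊗ₜ (𝒢.ιB b * u)) := rfl

lemma rightAct_B (b : 𝒢.B) (s : 𝒢.Ndual ⊗[ℂ] 𝒢.B) :
    𝒢.rightAct (MulOpposite.op (𝒢.ιB b)) s = mulB b s := by
  induction s with
  | zero => simp
  | add x y hx hy => rw [map_add, map_add, hx, hy]
  | tmul f c => rw [rightAct_tmul, ← map_mul, collapse_B, mulB_tmul]

lemma rightAct_mul (u v : 𝒢.U) (s : 𝒢.Ndual ⊗[ℂ] 𝒢.B) :
    𝒢.rightAct (MulOpposite.op (u * v)) s =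
      𝒢.rightAct (MulOpposite.op v) (𝒢.rightAct (MulOpposite.op u) s) := by
  rw [MulOpposite.op_mul, map_mul, Module.End.mul_apply]

lemma rightAct_N (n : 𝒢.N) (f : 𝒢.Ndual) :
    𝒢.rightAct (MulOpposite.op (𝒢.ιN n)) (f ⊗ₜ 1) = mulN f n ⊗ₜ 1 := by
  have := collapse_tmul f n 1
  rw [map_one, mul_one] at this
  rw [rightAct_tmul, map_one, one_mul, this]

lemma rightAct_mem {i j : ℤ} {u : 𝒢.U} (hu : u ∈ 𝒢.degU i) {s : 𝒢.Ndual ⊗[ℂ] 𝒢.B}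
    (hs : s ∈ tensorDeg 𝒢.degNdual 𝒢.degB j) :
    𝒢.rightAct (MulOpposite.op u) s ∈ tensorDeg 𝒢.degNdual 𝒢.degB (i + j) := by
  refine map_mem_of_tensorDeg (f := 𝒢.rightAct (MulOpposite.op u)) (fun p q hpq f hf b hb => ?_) hs
  rw [rightAct_tmul]
  have := collapse_mem hf (mul_mem_envDeg _ (𝒢.ιB_mem_degU hb) hu)
  rwa [show p + (q + i) = i + j by omega] at this

lemma leftAct_mem {i j : ℤ} {u : 𝒢.U} (hu : u ∈ 𝒢.degU i) {s : 𝒢.Ndual ⊗[ℂ] 𝒢.B}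
    (hs : s ∈ tensorDeg 𝒢.degNdual 𝒢.degB j) :
    leftAct h u s ∈ tensorDeg 𝒢.degNdual 𝒢.degB (i + j) := by
  have : leftAct h u s = (alpha h).symm (u • alpha h s) := by
    rw [← alpha_leftAct, LinearEquiv.symm_apply_apply]
  rw [this]
  exact alpha_symm_mem h (𝒢.isGradedAction_coind hu (alpha_mem h hs))

end Actions

end LieGrading

namespace LieGrading

variable {L : Type*} [LieRing L] [LieAlgebra ℂ L] {𝒢 : LieGrading L}

/-! ### The two actions commute -/

section Comm

lemma pB_lie_neg (x y : 𝒢.neg) : 𝒢.pB ⁅(x : L), (y : L)⁆ = 0 := by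
  rw [← LieSubalgebra.coe_bracket, pB_neg]

lemma pN_lie_neg (x y : 𝒢.neg) : 𝒢.pN ⁅(x : L), (y : L)⁆ = ⁅x, y⁆ := by
  rw [← LieSubalgebra.coe_bracket, pN_neg]

lemma pB_mem {n : ℤ} {x : L} (hx : x ∈ 𝒢.piece n) : 𝒢.pB x ∈ 𝒢.partPiece 𝒢.nonneg n := by
  rcases lt_or_ge n 0 with hn | hn
  · rw [show 𝒢.pB x = 0 from 𝒢.pB_neg ⟨x, 𝒢.mem_neg hn hx⟩]
    exact zero_mem _
  · rw [show 𝒢.pB x = ⟨x, 𝒢.mem_nonneg hn hx⟩ from 𝒢.pB_nonneg ⟨x, 𝒢.mem_nonneg hn hx⟩]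
    exact hx

lemma pN_mem {n : ℤ} {x : L} (hx : x ∈ 𝒢.piece n) : 𝒢.pN x ∈ 𝒢.partPiece 𝒢.neg n := by
  rcases lt_or_ge n 0 with hn | hn
  · rw [show 𝒢.pN x = ⟨x, 𝒢.mem_neg hn hx⟩ from 𝒢.pN_neg ⟨x, 𝒢.mem_neg hn hx⟩]
    exact hx
  · rw [show 𝒢.pN x = 0 from 𝒢.pN_nonneg ⟨x, 𝒢.mem_nonneg hn hx⟩]
    exact zero_mem _

lemma coe_add_nonneg (x y : 𝒢.nonneg) : ((x + y : 𝒢.nonneg) : L) = x + y := rfl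

lemma coe_smul_nonneg (c : ℂ) (x : 𝒢.nonneg) : ((c • x : 𝒢.nonneg) : L) = c • (x : L) := rfl

variable (γ : LieAlgebra.LieCharacter ℂ 𝒢.nonneg)

/-- The map `x ⊗ n ↦ f(n) x₊`. -/
def topPart (f : 𝒢.Ndual) : L ⊗[ℂ] 𝒢.N →ₗ[ℂ] 𝒢.nonneg :=
  (TensorProduct.rid ℂ 𝒢.nonneg).toLinearMap ∘ₗ TensorProduct.map 𝒢.pB f.toDual

@[simp] lemma topPart_tmul (f : 𝒢.Ndual) (x : L) (n : 𝒢.N) :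
    topPart f (x ⊗ₜ n) = f.toDual n • 𝒢.pB x := by
  simp [topPart]

/-- The map `x ⊗ n ↦ f(x₋ n) + f(n) γ(x₊)`. -/
def botPart (f : 𝒢.Ndual) : L ⊗[ℂ] 𝒢.N →ₗ[ℂ] ℂ :=
  f.toDual ∘ₗ mulSelf 𝒢.neg ∘ₗ 𝒢.pN.rTensor 𝒢.N + γ.toLinearMap ∘ₗ topPart f

@[simp] lemma botPart_tmul (f : 𝒢.Ndual) (x : L) (n : 𝒢.N) :
    botPart γ f (x ⊗ₜ n) = f.toDual (ι ℂ (𝒢.pN x) * n) + f.toDual n * γ (𝒢.pB x) := by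
  simp [botPart]

lemma topPart_add (f g : 𝒢.Ndual) : topPart (f + g) = topPart f + topPart g :=
  TensorProduct.ext' fun x n => by
    rw [LinearMap.add_apply, topPart_tmul, topPart_tmul, topPart_tmul, ← add_smul]; rfl

lemma botPart_add (f g : 𝒢.Ndual) : botPart γ (f + g) = botPart γ f + botPart γ g :=
  TensorProduct.ext' fun x n => by
    rw [LinearMap.add_apply, botPart_tmul, botPart_tmul, botPart_tmul]
    change f.toDual _ + g.toDual _ + (f.toDual _ + g.toDual _) * _ = _
    ring

/-- Splitting x gives f(x₋ n) + (x₊ + γ(x₊)) f(n). So on f ⊗ 1 only an element of L_{≥0} and a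
scalar occur, and the comparison of the two actions reduces to these linear parts. -/
lemma ev_mulTensor (f : 𝒢.Ndual) (t : L ⊗[ℂ] 𝒢.N) :
    ev γ (f ⊗ₜ 1) (mulTensor 𝒢.neg t) =
      ι ℂ (topPart f t) + algebraMap ℂ 𝒢.B (botPart γ f t) := by
  induction t with
  | zero => simp
  | add x y hx hy =>
    simp only [map_add, hx, hy]
    abel
  | tmul x n =>
    have h1 : mulTensor 𝒢.neg (x ⊗ₜ n) =
        𝒢.ιN (ι ℂ (𝒢.pN x) * n) + 𝒢.ιB (ι ℂ (𝒢.pB x)) * 𝒢.ιN n := by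
      rw [mulTensor_tmul, map_mul, ιN_ι, ιB_ι, ← add_mul, ← map_add, pN_add_pB]
      rfl
    rw [h1, map_add, ev_ιN, ev_mul, dualHom_tmul, dualHom_tmul, shift_ι, topPart_tmul,
      botPart_tmul, map_smul]
    simp only [Algebra.algebraMap_eq_smul_one, mul_smul_comm, mul_one, smul_add, add_smul, mul_smul]
    abel

lemma adTensor_mem {i j : ℤ} {n : 𝒢.N} (hn : n ∈ 𝒢.degN i) {t : L ⊗[ℂ] 𝒢.N}
    (ht : t ∈ tensorDeg 𝒢.piece 𝒢.degN j) :
    adTensor 𝒢.neg n t ∈ tensorDeg 𝒢.piece 𝒢.degN (i + j) := by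
  have key : 𝒢.degN i ≤ (tensorDeg 𝒢.piece 𝒢.degN (i + j)).comap
      ((LinearMap.applyₗ t) ∘ₗ (adTensor 𝒢.neg).toLinearMap) := by
    refine Submodule.span_le.2 ?_
    clear hn
    rintro _ ⟨l, hl, rfl, rfl⟩
    change adTensor 𝒢.neg _ t ∈ tensorDeg 𝒢.piece 𝒢.degN _
    induction l with
    | nil => simpa using ht
    | cons p l ih =>
      have h1 := ih fun q hq => hl q (List.mem_cons_of_mem _ hq)
      have hp : (p.2 : L) ∈ 𝒢.piece p.1 := hl p List.mem_cons_self
      simp only [List.map_cons, List.prod_cons, List.sum_cons, map_mul, Module.End.mul_apply]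
      refine map_mem_of_tensorDeg (f := adTensor 𝒢.neg (ι ℂ p.2)) (fun a b hab x hx y hy => ?_) h1
      rw [adTensor_ι_tmul]
      refine add_mem ?_ ?_
      · have := tmul_mem_tensorDeg (𝒢.lie_mem hp hx) hy
        rwa [show p.1 + a + b = p.1 + (l.map Prod.fst).sum + j by omega] at this
      · have hz : ι ℂ p.2 * y ∈ 𝒢.degN (p.1 + b) :=
          mul_mem_envDeg _ (ι_mem_envDeg _ (hl p List.mem_cons_self)) hy
        have := tmul_mem_tensorDeg hx hz
        rwa [show a + (p.1 + b) = p.1 + (l.map Prod.fst).sum + j by omega] at this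
  exact key hn

lemma topPart_mem {p j : ℤ} {f : 𝒢.Ndual} (hf : f ∈ 𝒢.degNdual p) {t : L ⊗[ℂ] 𝒢.N}
    (ht : t ∈ tensorDeg 𝒢.piece 𝒢.degN j) :
    topPart f t ∈ 𝒢.partPiece 𝒢.nonneg (j + p) := by
  refine map_mem_of_tensorDeg (fun a b hab x hx y hy => ?_) ht
  rw [topPart_tmul]
  by_cases hb : b = -p
  · rw [show j + p = a by omega]
    exact Submodule.smul_mem _ _ (pB_mem hx)
  · rw [toDual_eq_zero hf hb hy, zero_smul]
    exact zero_mem _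

variable {γ}

lemma botPart_eq_zero (hγ : IsGradedCharacter γ) {p j : ℤ} {f : 𝒢.Ndual}
    (hf : f ∈ 𝒢.degNdual p) {t : L ⊗[ℂ] 𝒢.N} (ht : t ∈ tensorDeg 𝒢.piece 𝒢.degN j)
    (hj : j + p ≠ 0) : botPart γ f t = 0 := by
  have h1 : f.toDual (mulSelf 𝒢.neg (𝒢.pN.rTensor 𝒢.N t)) = 0 := by
    rw [← Submodule.mem_bot ℂ]
    refine map_mem_of_tensorDeg (f := f.toDual ∘ₗ mulSelf 𝒢.neg ∘ₗ 𝒢.pN.rTensor 𝒢.N)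
      (fun a b hab x hx y hy => ?_) ht
    exact toDual_eq_zero (n := p) hf (show j ≠ -p by omega)
      (hab ▸ mul_mem_envDeg _ (ι_mem_envDeg _ (pN_mem hx)) hy)
  rw [botPart, LinearMap.add_apply]
  change f.toDual (mulSelf 𝒢.neg (𝒢.pN.rTensor 𝒢.N t)) + γ (topPart f t) = 0
  rw [h1, hγ _ hj _ (topPart_mem hf ht), add_zero]

/-- For f of degree p, x of degree d and n of degree i, the first function takes values in degree i
+ d + p of L_{≥0}. It vanishes unless -d - p ≤ i ≤ 0, so `exists_dualHom_eq` applies. The second is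
a functional of degree p + d because γ lives in degree 0. -/
lemma exists_top_bot (hfin : ∀ n, (𝒢.piece n).FG) (hγ : IsGradedCharacter γ) (f : 𝒢.Ndual) (x : L) :
    ∃ (τ : 𝒢.Ndual ⊗[ℂ] 𝒢.nonneg) (g : 𝒢.Ndual), ∀ n,
      𝒢.dualHom _ τ n = topPart f (adTensor 𝒢.neg n (x ⊗ₜ 1)) ∧
      g.toDual n = botPart γ f (adTensor 𝒢.neg n (x ⊗ₜ 1)) := by
  have hf : f ∈ ⨆ n, 𝒢.degNdual n := 𝒢.iSup_degNdual ▸ Submodule.mem_top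
  have hx : x ∈ ⨆ n, 𝒢.piece n := 𝒢.iSup_piece ▸ Submodule.mem_top
  induction hf using Submodule.iSup_induction' with
  | mem p f hf =>
    induction hx using Submodule.iSup_induction' with
    | mem d x hx =>
      have hC : ∀ i, ∀ n ∈ 𝒢.degN i,
          adTensor 𝒢.neg n (x ⊗ₜ 1) ∈ tensorDeg 𝒢.piece 𝒢.degN (i + d) := fun i n hn => by
        have := adTensor_mem hn (tmul_mem_tensorDeg hx (one_mem_envDeg (𝒢.partPiece 𝒢.neg)))
        rwa [add_zero] at this
      obtain ⟨τ, hτ⟩ := 𝒢.exists_dualHom_eq hfin (Finset.Icc (-d - p) 0)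
        (topPart f ∘ₗ (LinearMap.applyₗ (x ⊗ₜ 1)) ∘ₗ (adTensor 𝒢.neg).toLinearMap)
        (fun i hi n hn => by
          rw [Finset.mem_Icc] at hi
          by_cases h0 : 0 < i
          · rw [𝒢.degN_eq_bot h0, Submodule.mem_bot] at hn
            rw [hn, map_zero]
          · have := topPart_mem hf (hC i n hn)
            rw [show 𝒢.partPiece 𝒢.nonneg (i + d + p) = ⊥ from
              𝒢.partPiece_eq_bot _ _ (fun h : 0 ≤ i + d + p => by omega), Submodule.mem_bot] at this
            exact this)
      refine ⟨τ, Ndual.mk (n := p + d)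
        (botPart γ f ∘ₗ (LinearMap.applyₗ (x ⊗ₜ 1)) ∘ₗ (adTensor 𝒢.neg).toLinearMap) ?_, fun n =>
          ⟨by rw [hτ]; rfl, rfl⟩⟩
      intro i hi n hn
      exact botPart_eq_zero hγ hf (hC i n hn) (by omega)
    | zero => exact ⟨0, 0, fun n => ⟨by simp, by simp; rfl⟩⟩
    | add a b _ _ ha hb =>
      obtain ⟨τ, g, h⟩ := ha
      obtain ⟨τ', g', h'⟩ := hb
      refine ⟨τ + τ', g + g', fun n => ⟨?_, ?_⟩⟩
      · rw [TensorProduct.add_tmul, map_add, map_add, map_add, LinearMap.add_apply, (h n).1,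
          (h' n).1]
      · rw [TensorProduct.add_tmul, map_add, map_add, ← (h n).2, ← (h' n).2]; rfl
  | zero =>
    have h1 : topPart (0 : 𝒢.Ndual) = 0 := TensorProduct.ext' fun x n => by
      rw [topPart_tmul]; exact zero_smul _ _
    have h2 : botPart γ (0 : 𝒢.Ndual) = 0 := TensorProduct.ext' fun x n => by
      rw [botPart_tmul]; change (0 : ℂ) + 0 * _ = 0; ring
    exact ⟨0, 0, fun n => ⟨by simp [h1], by simp [h2]; rfl⟩⟩
  | add f f' _ _ hf hf' =>
    obtain ⟨τ, g, h⟩ := hf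
    obtain ⟨τ', g', h'⟩ := hf'
    refine ⟨τ + τ', g + g', fun n => ⟨?_, ?_⟩⟩
    · rw [topPart_add, map_add, LinearMap.add_apply, LinearMap.add_apply, (h n).1, (h' n).1]
    · rw [botPart_add, LinearMap.add_apply, ← (h n).2, ← (h' n).2]; rfl

/-- The map `N^⊛ ⊗ L_{≥0} → N^⊛ ⊗ B`. -/
def ofTop : 𝒢.Ndual ⊗[ℂ] 𝒢.nonneg →ₗ[ℂ] 𝒢.Ndual ⊗[ℂ] 𝒢.B :=
  (ι ℂ : 𝒢.nonneg →ₗ⁅ℂ⁆ 𝒢.B).toLinearMap.lTensor 𝒢.Ndual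

@[simp] lemma ofTop_tmul (f : 𝒢.Ndual) (x : 𝒢.nonneg) : ofTop (f ⊗ₜ x) = f ⊗ₜ[ℂ] ι ℂ x := rfl

lemma dualHom_ofTop (τ : 𝒢.Ndual ⊗[ℂ] 𝒢.nonneg) (n : 𝒢.N) :
    𝒢.dualHom 𝒢.B (ofTop τ) n = ι ℂ (𝒢.dualHom _ τ n) := by
  induction τ with
  | zero => simp
  | add x y hx hy => simp only [map_add, LinearMap.add_apply, hx, hy]
  | tmul f x => rw [ofTop_tmul, dualHom_tmul, dualHom_tmul, map_smul]

variable (h : 𝒢.IsSemiInfinite γ)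

/-- The value of the left side at n is the value of f ⊗ 1 at n x, expanded by `envIncl_mul_ι` and
`ev_mulTensor`. -/
lemma leftAct_eq_of {f : 𝒢.Ndual} {x : L} {τ : 𝒢.Ndual ⊗[ℂ] 𝒢.nonneg} {g : 𝒢.Ndual}
    (hτ : ∀ n, 𝒢.dualHom _ τ n = topPart f (adTensor 𝒢.neg n (x ⊗ₜ 1)) ∧
      g.toDual n = botPart γ f (adTensor 𝒢.neg n (x ⊗ₜ 1))) :
    leftAct h (ι ℂ x) (f ⊗ₜ 1) = ofTop τ + g ⊗ₜ 1 := by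
  apply 𝒢.dualHom_injective
  ext n
  have h1 : 𝒢.ιN n * ι ℂ x = mulTensor 𝒢.neg (adTensor 𝒢.neg n (x ⊗ₜ 1)) :=
    envIncl_mul_ι 𝒢.neg n x
  rw [← ev_ιN γ, ev_leftAct, h1, ev_mulTensor, map_add, LinearMap.add_apply, dualHom_ofTop,
    (hτ n).1, dualHom_tmul, (hτ n).2, Algebra.algebraMap_eq_smul_one]

/-- From Z Y = Y Z + [Z, Y]₋ + [Z, Y]₊, the product (f ⊗ Z) Y equals f Y ⊗ Z + f [Z, Y]₋ ⊗ 1 + f ⊗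
[Z, Y]₊. Writing [Z, Y]₋ as the sum of π_i(Z) [X_i, Y]₋ expresses the middle term through values of
τ in N^⊛ ⊗ L_{≥0}. -/
lemma dualHom_rightAct_ofTop (Y : 𝒢.neg) {d : ℕ} (X : Fin d → 𝒢.nonneg)
    (π : Fin d → Module.Dual ℂ 𝒢.nonneg)
    (hX : ∀ Z : 𝒢.nonneg, ∑ i, π i Z • 𝒢.pN ⁅(X i : L), (Y : L)⁆ = 𝒢.pN ⁅(Z : L), (Y : L)⁆)
    (τ : 𝒢.Ndual ⊗[ℂ] 𝒢.nonneg) (n : 𝒢.N) :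
    𝒢.dualHom 𝒢.B (𝒢.rightAct (MulOpposite.op (𝒢.ιN (ι ℂ Y))) (ofTop τ)) n =
      ι ℂ (𝒢.dualHom _ τ (ι ℂ Y * n)) + ι ℂ (𝒢.pB ⁅(𝒢.dualHom _ τ n : L), (Y : L)⁆) +
        algebraMap ℂ 𝒢.B
          (∑ i, π i (𝒢.dualHom _ τ (ι ℂ (𝒢.pN ⁅(X i : L), (Y : L)⁆) * n))) := by
  induction τ with
  | zero => simp
  | add x y hx hy =>
    simp only [map_add, LinearMap.add_apply, hx, hy, Finset.sum_add_distrib, coe_add_nonneg,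
      add_lie]
    abel
  | tmul f Z =>
    have h1 : 𝒢.ιB (ι ℂ Z) * 𝒢.ιN (ι ℂ Y) = 𝒢.ιN (ι ℂ Y) * 𝒢.ιB (ι ℂ Z) +
        (𝒢.ιN (ι ℂ (𝒢.pN ⁅(Z : L), (Y : L)⁆)) * 𝒢.ιB 1 +
          𝒢.ιB (ι ℂ (𝒢.pB ⁅(Z : L), (Y : L)⁆))) := by
      rw [map_one, mul_one, ιB_ι, ιN_ι, ιN_ι, ιB_ι, ← map_add, pN_add_pB, LieHom.map_lie,
        LieRing.of_associative_ring_bracket]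
      abel
    rw [ofTop_tmul, rightAct_tmul, h1]
    simp only [TensorProduct.tmul_add, collapse_tmul, collapse_B, map_add, LinearMap.add_apply,
      mulN_toDual, dualHom_tmul, map_smul, coe_smul_nonneg,
      smul_lie, smul_eq_mul]
    rw [← hX Z]
    simp only [map_sum, map_smul, Finset.sum_mul, smul_mul_assoc, smul_eq_mul,
      Algebra.algebraMap_eq_smul_one, Finset.sum_smul]
    rw [Finset.sum_congr rfl fun i _ => by rw [mul_comm (π i Z)]]
    abel

/-- Since Y and x₋ have negative degrees, [Y, x]₊ = -[x₊, Y]₊; this is the correction to moving Y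
from f to the tensor. -/
lemma topPart_mulN (f : 𝒢.Ndual) (Y : 𝒢.neg) (t : L ⊗[ℂ] 𝒢.N) :
    topPart (mulN f (ι ℂ Y)) t = topPart f (adTensor 𝒢.neg (ι ℂ Y) t) +
      𝒢.pB ⁅(topPart f t : L), (Y : L)⁆ := by
  induction t with
  | zero => simp
  | add x y hx hy =>
    simp only [map_add, hx, hy, coe_add_nonneg, add_lie]
    abel
  | tmul x m =>
    have h1 : 𝒢.pB ⁅(Y : L), x⁆ = -𝒢.pB ⁅(𝒢.pB x : L), (Y : L)⁆ := by
      conv_lhs => rw [← 𝒢.pN_add_pB x]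
      rw [lie_add, map_add, pB_lie_neg, zero_add, ← lie_skew, map_neg]
    rw [adTensor_ι_tmul, map_add, topPart_tmul, topPart_tmul, topPart_tmul, topPart_tmul,
      coe_smul_nonneg, smul_lie, map_smul, h1, mulN_toDual, smul_neg]
    abel

/-- This is where the trace condition enters. On x ⊗ m, the sum over i contributes f([x₊, Y]₋ m) and
f(m) times the trace attached to x₊; the last term contributes -f([x₊, Y]₋ m) and -f(m) γ([x₊, Y]₊).
By `hπ` these cancel, and Y x₋ = [Y, x₋] + x₋ Y accounts for the rest. -/
lemma botPart_mulN (f : 𝒢.Ndual) (Y : 𝒢.neg) {d : ℕ} (X : Fin d → 𝒢.nonneg)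
    (π : Fin d → Module.Dual ℂ 𝒢.nonneg)
    (hX : ∀ Z : 𝒢.nonneg, ∑ i, π i Z • 𝒢.pN ⁅(X i : L), (Y : L)⁆ = 𝒢.pN ⁅(Z : L), (Y : L)⁆)
    (hπ : ∀ Z : 𝒢.nonneg, ∑ i, π i (𝒢.pB ⁅(𝒢.pN ⁅(X i : L), (Y : L)⁆ : L), (Z : L)⁆) =
      γ (𝒢.pB ⁅(Z : L), (Y : L)⁆))
    (t : L ⊗[ℂ] 𝒢.N) :
    botPart γ (mulN f (ι ℂ Y)) t =
      ∑ i, π i (topPart f (adTensor 𝒢.neg (ι ℂ (𝒢.pN ⁅(X i : L), (Y : L)⁆)) t)) +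
        botPart γ f (adTensor 𝒢.neg (ι ℂ Y) t) := by
  induction t with
  | zero => simp
  | add x y hx hy =>
    simp only [map_add, hx, hy, Finset.sum_add_distrib]
    abel
  | tmul x m =>
    have h1 : ∀ W : 𝒢.neg, 𝒢.pB ⁅(W : L), x⁆ = 𝒢.pB ⁅(W : L), (𝒢.pB x : L)⁆ := fun W => by
      conv_lhs => rw [← 𝒢.pN_add_pB x]
      rw [lie_add, map_add, pB_lie_neg, zero_add]
    have h2 : 𝒢.pN ⁅(Y : L), x⁆ = ⁅Y, 𝒢.pN x⁆ - 𝒢.pN ⁅(𝒢.pB x : L), (Y : L)⁆ := by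
      conv_lhs => rw [← 𝒢.pN_add_pB x]
      rw [lie_add, map_add, pN_lie_neg, ← lie_skew (Y : L), map_neg, sub_eq_add_neg]
    have h3 : γ (𝒢.pB ⁅(Y : L), (𝒢.pB x : L)⁆) = -γ (𝒢.pB ⁅(𝒢.pB x : L), (Y : L)⁆) := by
      rw [← lie_skew, map_neg, map_neg]
    simp only [adTensor_ι_tmul, map_add, topPart_tmul, botPart_tmul, mulN_toDual, h1, h2, h3,
      map_smul, smul_eq_mul, Finset.sum_add_distrib, ← Finset.mul_sum, hπ, map_sub, sub_mul]
    rw [← hX (𝒢.pB x)]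
    simp only [map_sum, map_smul, Finset.sum_mul, smul_mul_assoc, smul_eq_mul, LieHom.map_lie,
      LieRing.of_associative_ring_bracket, sub_mul, map_sub, mul_assoc]
    rw [Finset.sum_congr rfl fun i _ => mul_comm (f.toDual _) (π i (𝒢.pB x))]
    ring

/-- Both sides are evaluated at n. The terms in L_{≥0} match by `topPart_mulN` and the scalars by
`botPart_mulN`, each applied to the expansion of n x. -/
lemma leftAct_rightAct_generator (x : L) (f : 𝒢.Ndual) {Y : 𝒢.neg}
    (hY : Y ∈ 𝒢.partPiece 𝒢.neg (-1)) :
    leftAct h (ι ℂ x) (mulN f (ι ℂ Y) ⊗ₜ 1) =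
      𝒢.rightAct (MulOpposite.op (𝒢.ιN (ι ℂ Y))) (leftAct h (ι ℂ x) (f ⊗ₜ 1)) := by
  obtain ⟨τ, g, hτ⟩ := exists_top_bot h.fg h.graded f x
  obtain ⟨τ', g', hτ'⟩ := exists_top_bot h.fg h.graded (mulN f (ι ℂ Y)) x
  obtain ⟨d, X, π, hX, hπ⟩ := h.trace Y hY
  rw [leftAct_eq_of h hτ, leftAct_eq_of h hτ', map_add, rightAct_N]
  apply 𝒢.dualHom_injective
  ext n
  rw [map_add, map_add, LinearMap.add_apply, LinearMap.add_apply,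
    dualHom_rightAct_ofTop Y X π hX, dualHom_ofTop, (hτ' n).1, dualHom_tmul, dualHom_tmul,
    (hτ' n).2, mulN_toDual, (hτ _).1, (hτ _).1, (hτ _).2, topPart_mulN,
    botPart_mulN f Y X π hX hπ]
  simp only [(hτ _).1, map_mul, Module.End.mul_apply, map_add,
    ← Algebra.algebraMap_eq_smul_one]
  abel

/-- The elements n for which this holds for all f form a subalgebra, so generation in degree -1
suffices. -/
lemma leftAct_rightAct_N (x : L) (f : 𝒢.Ndual) (n : 𝒢.N) :
    leftAct h (ι ℂ x) (mulN f n ⊗ₜ 1) =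
      𝒢.rightAct (MulOpposite.op (𝒢.ιN n)) (leftAct h (ι ℂ x) (f ⊗ₜ 1)) := by
  have hn : n ∈ Algebra.adjoin ℂ ((ι ℂ : 𝒢.neg →ₗ⁅ℂ⁆ 𝒢.N) '' {Y | Y ∈ 𝒢.partPiece 𝒢.neg (-1)}) :=
    h.gen ▸ Algebra.mem_top
  induction hn using Algebra.adjoin_induction generalizing f with
  | mem n hn =>
    obtain ⟨Y, hY, rfl⟩ := hn
    exact leftAct_rightAct_generator h x f hY
  | algebraMap c =>
    have h1 : mulN f (1 : 𝒢.N) = f := Ndual.ext fun k => by simp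
    rw [Algebra.algebraMap_eq_smul_one, map_smul (mulN f), h1, map_smul 𝒢.ιN, map_one 𝒢.ιN,
      MulOpposite.op_smul, map_smul 𝒢.rightAct, MulOpposite.op_one, map_one,
      ← TensorProduct.smul_tmul', map_smul]
    rfl
  | add n m _ _ hn hm =>
    rw [map_add, TensorProduct.add_tmul, map_add, hn, hm, map_add, MulOpposite.op_add, map_add]
    rfl
  | mul n m _ _ hn hm =>
    rw [mulN_mul, hm, hn, ← rightAct_mul, map_mul]

/-- Every element of N^⊛ ⊗ B is a sum of terms (f ⊗ 1) b, and U is spanned by products n b. So it is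
enough to know commutation with N on f ⊗ 1 and with B everywhere. -/
lemma leftAct_rightAct_ι (x : L) (w : 𝒢.U) (s : 𝒢.Ndual ⊗[ℂ] 𝒢.B) :
    leftAct h (ι ℂ x) (𝒢.rightAct (MulOpposite.op w) s) =
      𝒢.rightAct (MulOpposite.op w) (leftAct h (ι ℂ x) s) := by
  have h1 : ∀ (f : 𝒢.Ndual) (w : 𝒢.U),
      leftAct h (ι ℂ x) (𝒢.rightAct (MulOpposite.op w) (f ⊗ₜ 1)) =
        𝒢.rightAct (MulOpposite.op w) (leftAct h (ι ℂ x) (f ⊗ₜ 1)) := by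
    intro f w
    induction w using 𝒢.induction_NB with
    | mul n b =>
      rw [rightAct_mul, rightAct_mul, rightAct_N, rightAct_B, rightAct_B, leftAct_mulB,
        leftAct_rightAct_N]
    | add u v hu hv =>
      simp only [MulOpposite.op_add, map_add, LinearMap.add_apply, hu, hv]
  induction s with
  | zero => simp
  | add a b ha hb => simp only [map_add, ha, hb]
  | tmul f b =>
    have : f ⊗ₜ[ℂ] b = 𝒢.rightAct (MulOpposite.op (𝒢.ιB b)) (f ⊗ₜ 1) := by
      rw [rightAct_B, mulB_tmul, one_mul]
    rw [this, ← rightAct_mul, h1, rightAct_mul, h1]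

lemma leftAct_rightAct (u w : 𝒢.U) (s : 𝒢.Ndual ⊗[ℂ] 𝒢.B) :
    leftAct h u (𝒢.rightAct (MulOpposite.op w) s) =
      𝒢.rightAct (MulOpposite.op w) (leftAct h u s) := by
  induction u using env_induction_left with
  | one => simp
  | mul x u ih =>
    rw [map_mul, Module.End.mul_apply, Module.End.mul_apply, ih, leftAct_rightAct_ι]
  | add u v hu hv => simp only [map_add, LinearMap.add_apply, hu, hv]
  | smul c u hu => simp only [map_smul, LinearMap.smul_apply, hu]

end Comm

/-! ### Existence and uniqueness of the semi-regular bimodule -/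

variable {γ : LieAlgebra.LieCharacter ℂ 𝒢.nonneg} (h : 𝒢.IsSemiInfinite γ)

/-- The semi-regular bimodule of a semi-infinite character. -/
def semiregular : SemiregularBimodule 𝒢 γ where
  left := leftAct h
  right := 𝒢.rightAct
  comm := leftAct_rightAct h
  left_model := ⟨alpha h, fun f b n => 𝒢.toCoind_toHom_N (E := 𝒢.Twist γ 𝒢.B)
    (isGradedAction_twist h.graded isGradedAction_degB) 𝒢.iSup_degB (f ⊗ₜ b) n, alpha_leftAct h⟩
  right_model := ⟨𝒢.beta, fun _ _ _ => 𝒢.beta.apply_symm_apply _⟩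
  left_mem _ _ _ hu _ hs := leftAct_mem h hu hs
  right_mem _ _ _ hu _ hs := rightAct_mem hu hs

/-- A B-linear map on U is determined on N, so α is the canonical isomorphism; the condition on β at
u = 1 makes it canonical too. Each action is then transported from its model. -/
lemma eq_semiregular (S : SemiregularBimodule 𝒢 γ) : S = semiregular h := by
  have hleft : S.left = leftAct h := by
    obtain ⟨α, h1, h2⟩ := S.left_model
    have hα : α = alpha h := by
      ext s
      induction s with
      | zero => simp
      | add a b ha hb => rw [map_add, map_add, ha, hb]
      | tmul f b =>
        refine Coind.ext fun n => ?_
        rw [h1, alpha_toHom, ev_ιN]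
        rfl
    refine AlgHom.ext fun u => LinearMap.ext fun s => α.injective ?_
    rw [h2, hα, alpha_leftAct]
  have hright : S.right = 𝒢.rightAct := by
    obtain ⟨β, hβ⟩ := S.right_model
    have h1 : ∀ f b, β (f ⊗ₜ b) = 𝒢.beta (f ⊗ₜ b) := fun f b => by
      have := hβ f b 1
      rw [MulOpposite.op_one, map_one, mul_one] at this
      exact this
    have h2 : β = 𝒢.beta := LinearEquiv.toLinearMap_injective (TensorProduct.ext' h1)
    ext1 u
    refine TensorProduct.ext' fun f b => ?_
    apply β.injective
    have := hβ f b u.unop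
    rw [MulOpposite.op_unop] at this
    rw [this, h2]
    exact (𝒢.beta.apply_symm_apply _).symm
  exact SemiregularBimodule.ext hleft hright

end LieGrading

namespace LieGrading

variable {L : Type*} [LieRing L] [LieAlgebra ℂ L] {𝒢 : LieGrading L}

/-! ### Generation of the semi-regular bimodule by `N^⊛` over `B` -/

section Generation

variable (𝒢) in
/-- The sum of the homogeneous parts of degree less than `d`. -/
def below (d : ℤ) : Submodule ℂ L := ⨆ j : {j : ℤ // j < d}, 𝒢.piece j

variable (𝒢) in
/-- The sum of the homogeneous parts of `L_{≥0}` of degree less than `d`. -/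
def belowB (d : ℤ) : Submodule ℂ 𝒢.nonneg := ⨆ j : {j : ℤ // j < d}, 𝒢.partPiece 𝒢.nonneg j

lemma pB_mem_belowB {d : ℤ} {x : L} (hx : x ∈ 𝒢.below d) : 𝒢.pB x ∈ 𝒢.belowB d := by
  have : 𝒢.below d ≤ (𝒢.belowB d).comap 𝒢.pB :=
    iSup_le fun j x hx => Submodule.mem_iSup_of_mem j (pB_mem hx)
  exact this hx

lemma lie_mem_below {d j : ℤ} (hj : j ≤ d) (z : 𝒢.neg) {x : L} (hx : x ∈ 𝒢.piece j) :
    ⁅(z : L), x⁆ ∈ 𝒢.below d := by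
  obtain ⟨z, hz⟩ := z
  change ⁅z, x⁆ ∈ 𝒢.below d
  change z ∈ ⨆ n : {n : ℤ | n < 0}, 𝒢.piece n at hz
  induction hz using Submodule.iSup_induction' with
  | mem i z hz =>
    obtain ⟨i, hi⟩ := i
    change i < 0 at hi
    exact Submodule.mem_iSup_of_mem (⟨i + j, by omega⟩ : {j : ℤ // j < d}) (𝒢.lie_mem hz hx)
  | zero => simp
  | add a b _ _ ha hb => rw [add_lie]; exact add_mem ha hb

lemma lie_below_mem_below {d : ℤ} (z : 𝒢.neg) {x : L} (hx : x ∈ 𝒢.below d) :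
    ⁅(z : L), x⁆ ∈ 𝒢.below d := by
  induction hx using Submodule.iSup_induction' with
  | mem j x hx => exact lie_mem_below j.2.le z hx
  | zero => simp
  | add a b _ _ ha hb => rw [lie_add]; exact add_mem ha hb

/-- Moving x to the left past elements of N creates only brackets with negative elements, which have
lower degree. -/
lemma adTensor_sub_mem {d : ℤ} {x : L} (hx : x ∈ 𝒢.piece d) (n : 𝒢.N) :
    adTensor 𝒢.neg n (x ⊗ₜ 1) - x ⊗ₜ n ∈
      Submodule.span ℂ {t : L ⊗[ℂ] 𝒢.N | ∃ y ∈ 𝒢.below d, ∃ m, y ⊗ₜ m = t} := by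
  induction n using env_induction_left with
  | one => simp
  | mul z u ih =>
    have h1 : adTensor 𝒢.neg (ι ℂ z * u) (x ⊗ₜ 1) - x ⊗ₜ (ι ℂ z * u) =
        adTensor 𝒢.neg (ι ℂ z) (adTensor 𝒢.neg u (x ⊗ₜ 1) - x ⊗ₜ u) + ⁅(z : L), x⁆ ⊗ₜ u := by
      rw [map_mul, Module.End.mul_apply, map_sub, adTensor_ι_tmul]
      abel
    rw [h1]
    refine add_mem ?_ (Submodule.subset_span ⟨_, lie_mem_below le_rfl z hx, u, rfl⟩)
    refine Submodule.span_induction (p := fun t _ => adTensor 𝒢.neg (ι ℂ z) t ∈ _) ?_ ?_ ?_ ?_ ih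
    · rintro _ ⟨y, hy, m, rfl⟩
      rw [adTensor_ι_tmul]
      exact add_mem (Submodule.subset_span ⟨_, lie_below_mem_below z hy, m, rfl⟩)
        (Submodule.subset_span ⟨y, hy, _, rfl⟩)
    · rw [map_zero]; exact zero_mem _
    · intro a b _ _ ha hb
      rw [map_add]; exact add_mem ha hb
    · intro c a _ ha
      rw [map_smul]; exact Submodule.smul_mem _ _ ha
  | add u v hu hv =>
    rw [map_add, LinearMap.add_apply, TensorProduct.tmul_add, add_sub_add_comm]
    exact add_mem hu hv
  | smul c u hu =>
    rw [map_smul, LinearMap.smul_apply, TensorProduct.tmul_smul, ← smul_sub]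
    exact Submodule.smul_mem _ _ hu

/-- The leading term of x (f ⊗ 1) is f ⊗ x; this drives the induction on degree in
`eq_top_of_left_closed`. -/
lemma topPart_sub_mem (f : 𝒢.Ndual) {d : ℤ} {x : 𝒢.nonneg} (hx : x ∈ 𝒢.partPiece 𝒢.nonneg d)
    (n : 𝒢.N) :
    topPart f (adTensor 𝒢.neg n ((x : L) ⊗ₜ 1)) - f.toDual n • x ∈ 𝒢.belowB d := by
  have h1 : topPart f (adTensor 𝒢.neg n ((x : L) ⊗ₜ 1)) - f.toDual n • x =
      topPart f (adTensor 𝒢.neg n ((x : L) ⊗ₜ 1) - (x : L) ⊗ₜ n) := by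
    rw [map_sub, topPart_tmul, pB_nonneg]
  rw [h1]
  have h2 := adTensor_sub_mem (𝒢 := 𝒢) hx n
  have h3 : Submodule.span ℂ {t : L ⊗[ℂ] 𝒢.N | ∃ y ∈ 𝒢.below d, ∃ m, y ⊗ₜ m = t} ≤
      (𝒢.belowB d).comap (topPart f) := by
    refine Submodule.span_le.2 ?_
    rintro _ ⟨y, hy, m, rfl⟩
    rw [SetLike.mem_coe, Submodule.mem_comap, topPart_tmul]
    exact Submodule.smul_mem _ _ (pB_mem_belowB hy)
  exact h3 h2

/-- The image in N^⊛ ⊗ E/W has zero values on N, so it is zero by `dualHom_injective`; then N^⊛ ⊗ -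
is right exact. -/
lemma mem_range_of_dualHom_mem {E : Type*} [AddCommGroup E] [Module ℂ E] (W : Submodule ℂ E)
    (t : 𝒢.Ndual ⊗[ℂ] E) (ht : ∀ n, 𝒢.dualHom E t n ∈ W) :
    t ∈ LinearMap.range (W.subtype.lTensor 𝒢.Ndual) := by
  have hex : Function.Exact (W.subtype.lTensor 𝒢.Ndual) (W.mkQ.lTensor 𝒢.Ndual) :=
    lTensor_exact 𝒢.Ndual (LinearMap.exact_subtype_mkQ W) W.mkQ_surjective
  refine (hex t).1 (𝒢.dualHom_injective (LinearMap.ext fun n => ?_))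
  have key : ∀ t, 𝒢.dualHom _ (W.mkQ.lTensor 𝒢.Ndual t) n = W.mkQ (𝒢.dualHom E t n) := by
    intro t
    induction t with
    | zero => simp
    | add a b ha hb => simp only [map_add, LinearMap.add_apply, ha, hb]
    | tmul f e => simp
  rw [key, map_zero, LinearMap.zero_apply, Submodule.mkQ_apply, Submodule.Quotient.mk_eq_zero]
  exact ht n

variable {γ : LieAlgebra.LieCharacter ℂ 𝒢.nonneg} (h : 𝒢.IsSemiInfinite γ)

/-- `N^⊛ ⊗ B` is generated by `N^⊛ ⊗ 1` as a left `B`-module. -/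
lemma eq_top_of_left_closed (P : Submodule ℂ (𝒢.Ndual ⊗[ℂ] 𝒢.B)) (h1 : ∀ f, f ⊗ₜ 1 ∈ P)
    (h2 : ∀ b, ∀ s ∈ P, leftAct h (𝒢.ιB b) s ∈ P) : P = ⊤ := by
  let Q : Submodule ℂ (𝒢.Ndual ⊗[ℂ] 𝒢.B) := Submodule.span ℂ
    {s | ∃ b f, leftAct h (𝒢.ιB b) (f ⊗ₜ 1) = s}
  have hQP : Q ≤ P := by
    refine Submodule.span_le.2 ?_
    rintro _ ⟨b, f, rfl⟩
    exact h2 _ _ (h1 f)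
  have hQ1 : ∀ f, f ⊗ₜ 1 ∈ Q := fun f => Submodule.subset_span ⟨1, f, by simp⟩
  have hQ2 : ∀ b, ∀ s ∈ Q, leftAct h (𝒢.ιB b) s ∈ Q := by
    intro b s hs
    induction hs using Submodule.span_induction with
    | mem s hs =>
      obtain ⟨c, f, rfl⟩ := hs
      exact Submodule.subset_span ⟨b * c, f, by rw [map_mul, map_mul, Module.End.mul_apply]⟩
    | zero => simp
    | add x y _ _ hx hy => rw [map_add]; exact add_mem hx hy
    | smul c x _ hx => rw [map_smul]; exact Submodule.smul_mem _ _ hx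
  -- Induction on a bound for the degree of x: f ⊗ x differs from x (f ⊗ 1) by some g ⊗ 1 and by
  -- tensors with an element of L_{≥0} of smaller degree. Negative degrees are empty, which starts
  -- the induction.
  have hdeg : ∀ (k : ℕ) (j : ℤ), j < k → ∀ x ∈ 𝒢.partPiece 𝒢.nonneg j, ∀ f : 𝒢.Ndual,
      f ⊗ₜ ι ℂ x ∈ Q := by
    intro k
    induction k with
    | zero =>
      intro j hj x hx f
      have : 𝒢.partPiece 𝒢.nonneg j = ⊥ := 𝒢.partPiece_eq_bot _ _ (fun h : 0 ≤ j => by omega)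
      rw [this, Submodule.mem_bot] at hx
      simp [hx]
    | succ k ih =>
      intro j hj x hx f
      obtain ⟨τ, g, hτ⟩ := exists_top_bot h.fg h.graded f (x : L)
      obtain ⟨t, ht⟩ := mem_range_of_dualHom_mem (𝒢.belowB j) (τ - f ⊗ₜ x) fun n => by
        rw [map_sub, LinearMap.sub_apply, (hτ n).1, dualHom_tmul]
        exact topPart_sub_mem f hx n
      have h3 : f ⊗ₜ[ℂ] ι ℂ x = leftAct h (𝒢.ιB (ι ℂ x)) (f ⊗ₜ 1) - g ⊗ₜ 1 -
          ofTop ((𝒢.belowB j).subtype.lTensor 𝒢.Ndual t) := by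
        rw [ιB_ι, leftAct_eq_of h hτ, ht, map_sub, ofTop_tmul]
        abel
      rw [h3]
      refine sub_mem (sub_mem (hQ2 _ _ (hQ1 f)) (hQ1 g)) ?_
      clear ht h3
      induction t with
      | zero => simp
      | add a b ha hb => rw [map_add, map_add]; exact add_mem ha hb
      | tmul f' y =>
        rw [LinearMap.lTensor_tmul, ofTop_tmul]
        obtain ⟨y, hy⟩ := y
        change f' ⊗ₜ ι ℂ y ∈ Q
        induction hy using Submodule.iSup_induction' with
        | mem i y hy => exact ih i (by have := i.2; omega) y hy f'
        | zero => simp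
        | add a b _ _ ha hb => rw [map_add, TensorProduct.tmul_add]; exact add_mem ha hb
  have hι : ∀ (x : 𝒢.nonneg) (f : 𝒢.Ndual), f ⊗ₜ ι ℂ x ∈ Q := by
    intro x f
    have hx : x ∈ ⨆ n, 𝒢.partPiece 𝒢.nonneg n := by
      rw [show ⨆ n, 𝒢.partPiece 𝒢.nonneg n = ⊤ from 𝒢.iSup_partPiece _ _]
      trivial
    induction hx using Submodule.iSup_induction' with
    | mem i y hy => exact hdeg (i.toNat + 1) i (by omega) y hy f
    | zero => simp
    | add a b _ _ ha hb => rw [map_add, TensorProduct.tmul_add]; exact add_mem ha hb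
  have hmul : ∀ (b : 𝒢.B) (f : 𝒢.Ndual), f ⊗ₜ b ∈ Q := by
    intro b
    induction b using env_induction_right with
    | one => exact hQ1
    | mul x u ih =>
      intro f
      -- Right multiplication by x commutes with the left action, so on the generators of Q it only
      -- replaces f ⊗ 1 by f ⊗ x, which is already in Q.
      have h4 : ∀ s ∈ Q, mulB (ι ℂ x) s ∈ Q := by
        intro s hs
        induction hs using Submodule.span_induction with
        | mem s hs =>
          obtain ⟨c, f, rfl⟩ := hs
          rw [← leftAct_mulB, mulB_tmul, one_mul]
          exact hQ2 _ _ (hι x f)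
        | zero => simp
        | add x y _ _ hx hy => rw [map_add]; exact add_mem hx hy
        | smul c x _ hx => rw [map_smul]; exact Submodule.smul_mem _ _ hx
      exact h4 _ (ih f)
    | add u v hu hv =>
      intro f
      rw [TensorProduct.tmul_add]; exact add_mem (hu f) (hv f)
    | smul c u hu =>
      intro f
      rw [TensorProduct.tmul_smul]; exact Submodule.smul_mem _ _ (hu f)
  refine eq_top_iff.2 fun s _ => hQP ?_
  induction s with
  | zero => exact zero_mem _
  | add a b ha hb => exact add_mem (ha trivial) (hb trivial)
  | tmul f b => exact hmul b f

end Generation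

/-! ### Maps on induced modules -/

section Ind

/-- This lets a merely ℂ-linear map be tested on the generating relations of a U-submodule. -/
lemma mem_span_complex_of_smul_closed {R M : Type*} [Ring R] [Algebra ℂ R] [AddCommGroup M]
    [Module ℂ M] [Module R M] [IsScalarTower ℂ R M] {s : Set M}
    (hs : ∀ (r : R), ∀ x ∈ s, r • x ∈ s) {x : M} (hx : x ∈ Submodule.span R s) :
    x ∈ Submodule.span ℂ s := by
  induction hx using Submodule.span_induction with
  | mem x hx => exact Submodule.subset_span hx
  | zero => exact zero_mem _
  | add x y _ _ hx hy => exact add_mem hx hy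
  | smul r x hx' hx =>
    clear hx'
    induction hx using Submodule.span_induction with
    | mem x hx => exact Submodule.subset_span (hs r x hx)
    | zero => rw [smul_zero]; exact zero_mem _
    | add x y _ _ hx hy => rw [smul_add]; exact add_mem hx hy
    | smul c x _ hx => rw [smul_algebra_smul_comm]; exact Submodule.smul_mem _ _ hx

variable {E X : Type*} [AddCommGroup E] [Module ℂ E] [Module 𝒢.B E]
  [AddCommGroup X] [Module ℂ X]

/-- The class of `u ⊗ e` in the induced module. -/
def indMk (u : 𝒢.U) (e : E) : 𝒢.Ind E := (𝒢.indRel E).mkQ (u ⊗ₜ e)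

lemma smul_indMk (u v : 𝒢.U) (e : E) : u • indMk v e = indMk (u * v) e := rfl

lemma indMk_mul_B (u : 𝒢.U) (b : 𝒢.B) (e : E) :
    indMk (u * 𝒢.ιB b) e = indMk u (b • e) := by
  refine (Submodule.Quotient.eq (𝒢.indRel E)).2 ?_
  exact Submodule.subset_span ⟨u, b, e, rfl⟩

lemma ind_induction {P : 𝒢.Ind E → Prop} (mk : ∀ u e, P (indMk u e))
    (add : ∀ x y, P x → P y → P (x + y)) (x : 𝒢.Ind E) : P x := by
  obtain ⟨t, rfl⟩ := (𝒢.indRel E).mkQ_surjective x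
  induction t with
  | zero => simpa [indMk] using mk 0 0
  | add a b ha hb => rw [map_add]; exact add _ _ ha hb
  | tmul u e => exact mk u e

lemma ind_hom_ext {f g : 𝒢.Ind E →ₗ[ℂ] X} (h : ∀ u e, f (indMk u e) = g (indMk u e)) : f = g := by
  refine LinearMap.ext fun x => ?_
  induction x using ind_induction with
  | mk u e => exact h u e
  | add x y hx hy => rw [map_add, map_add, hx, hy]

lemma indRel_le_ker (f : 𝒢.U ⊗[ℂ] E →ₗ[ℂ] X)
    (hf : ∀ u b e, f ((u * 𝒢.ιB b) ⊗ₜ e) = f (u ⊗ₜ (b • e))) :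
    (𝒢.indRel E).restrictScalars ℂ ≤ LinearMap.ker f := by
  intro t ht
  have h1 : t ∈ Submodule.span ℂ {t | ∃ (u : 𝒢.U) (b : 𝒢.B) (e : E),
      (u * 𝒢.ιB b) ⊗ₜ[ℂ] e - u ⊗ₜ[ℂ] (b • e) = t} := by
    refine mem_span_complex_of_smul_closed (R := 𝒢.U) ?_ ht
    rintro r _ ⟨u, b, e, rfl⟩
    exact ⟨r * u, b, e, by
      rw [smul_sub, TensorProduct.smul_tmul', TensorProduct.smul_tmul', smul_eq_mul, smul_eq_mul,
        mul_assoc]⟩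
  have h2 : Submodule.span ℂ {t | ∃ (u : 𝒢.U) (b : 𝒢.B) (e : E),
      (u * 𝒢.ιB b) ⊗ₜ[ℂ] e - u ⊗ₜ[ℂ] (b • e) = t} ≤ LinearMap.ker f := by
    refine Submodule.span_le.2 ?_
    rintro _ ⟨u, b, e, rfl⟩
    rw [SetLike.mem_coe, LinearMap.mem_ker, map_sub, hf, sub_self]
  exact h2 h1

/-- The linear map on the induced module given by a balanced map. -/
def indLift (f : 𝒢.U ⊗[ℂ] E →ₗ[ℂ] X)
    (hf : ∀ u b e, f ((u * 𝒢.ιB b) ⊗ₜ e) = f (u ⊗ₜ (b • e))) : 𝒢.Ind E →ₗ[ℂ] X :=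
  -- The relations form a U-submodule and f is only ℂ-linear, so the descent is made for additive
  -- groups and scalars are restored afterwards.
  let F : 𝒢.Ind E →+ X := QuotientAddGroup.lift (𝒢.indRel E).toAddSubgroup f.toAddMonoidHom
    (indRel_le_ker f hf)
  { toFun := F
    map_add' := F.map_add
    map_smul' := fun c x => by
      obtain ⟨t, rfl⟩ := (𝒢.indRel E).mkQ_surjective x
      exact LinearMap.map_smul f c t }

lemma indMk_mem {ℰ : ℤ → Submodule ℂ E} {i j : ℤ} {u : 𝒢.U} {e : E} (hu : u ∈ 𝒢.degU i)
    (he : e ∈ ℰ j) : indMk u e ∈ indDeg 𝒢 ℰ (i + j) :=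
  ⟨u ⊗ₜ e, tmul_mem_tensorDeg hu he, rfl⟩

lemma map_mem_of_indDeg {ℰ : ℤ → Submodule ℂ E} {f : 𝒢.Ind E →ₗ[ℂ] X} {n : ℤ}
    {P : Submodule ℂ X}
    (h : ∀ i j, i + j = n → ∀ u ∈ 𝒢.degU i, ∀ e ∈ ℰ j, f (indMk u e) ∈ P) {x : 𝒢.Ind E}
    (hx : x ∈ indDeg 𝒢 ℰ n) : f x ∈ P := by
  obtain ⟨t, ht, rfl⟩ := hx
  exact map_mem_of_tensorDeg (f := f ∘ₗ (𝒢.indRel E).mkQ.restrictScalars ℂ) h ht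

end Ind

end LieGrading

namespace LieGrading

variable {L : Type*} [LieRing L] [LieAlgebra ℂ L] {𝒢 : LieGrading L}
  {γ : LieAlgebra.LieCharacter ℂ 𝒢.nonneg}

/-! ### The functor `S_γ ⊗_U -` on induced modules -/

section Theta

variable (γ) (E : Type*) [AddCommGroup E] [Module ℂ E] [Module 𝒢.B E] [IsScalarTower ℂ 𝒢.B E]

/-- The identification of the spaces `E` and `ℂ_γ ⊗ E`. -/
def twist : E ≃ₗ[ℂ] 𝒢.Twist γ E := LinearEquiv.refl ℂ E

variable {E} in
lemma smul_twist (b : 𝒢.B) (e : E) : b • twist γ E e = twist γ E (𝒢.shift γ b • e) := rfl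

/-- The map `U → ℂ_γ ⊗ E`, `v ↦ s(v) e`, for an element `s` of the semi-regular bimodule, regarded
as a map `U → B`. -/
def theta : 𝒢.Ndual ⊗[ℂ] 𝒢.B →ₗ[ℂ] E →ₗ[ℂ] 𝒢.U →ₗ[ℂ] 𝒢.Twist γ E :=
  LinearMap.mk₂ ℂ (fun s e => (twist γ E).toLinearMap ∘ₗ (𝒢.actB E).flip e ∘ₗ ev γ s)
    (fun s t e => by rw [map_add, LinearMap.comp_add, LinearMap.comp_add])
    (fun c s e => by rw [map_smul, LinearMap.comp_smul, LinearMap.comp_smul])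
    (fun s e e' => by rw [map_add, LinearMap.add_comp, LinearMap.comp_add])
    (fun c s e => by rw [map_smul, LinearMap.smul_comp, LinearMap.comp_smul])

variable {E}

lemma theta_apply (s : 𝒢.Ndual ⊗[ℂ] 𝒢.B) (e : E) (v : 𝒢.U) :
    theta γ E s e v = twist γ E (ev γ s v • e) := rfl

lemma theta_mulB (b : 𝒢.B) (s : 𝒢.Ndual ⊗[ℂ] 𝒢.B) (e : E) :
    theta γ E (mulB b s) e = theta γ E s (b • e) := LinearMap.ext fun v => by
  rw [theta_apply, theta_apply, ev_mulB, mul_smul]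

lemma theta_B_mul (s : 𝒢.Ndual ⊗[ℂ] 𝒢.B) (e : E) (b : 𝒢.B) (v : 𝒢.U) :
    theta γ E s e (𝒢.ιB b * v) = b • theta γ E s e v := by
  rw [theta_apply, theta_apply, ev_B_mul, mul_smul, smul_twist]

lemma theta_N (f : 𝒢.Ndual) (e : E) (n : 𝒢.N) :
    theta γ E (f ⊗ₜ 1) e (𝒢.ιN n) = twist γ E (f.toDual n • e) := by
  rw [theta_apply, ev_ιN, dualHom_tmul, smul_assoc, one_smul]

variable {γ} (h : 𝒢.IsSemiInfinite γ) {ℰ : ℤ → Submodule ℂ E}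

lemma theta_leftAct (u : 𝒢.U) (s : 𝒢.Ndual ⊗[ℂ] 𝒢.B) (e : E) (v : 𝒢.U) :
    theta γ E (leftAct h u s) e v = theta γ E s e (v * u) := by
  rw [theta_apply, theta_apply, ev_leftAct]

include h in
lemma theta_mem (hact : IsGradedAction 𝒢.degB ℰ) {i j : ℤ} {s : 𝒢.Ndual ⊗[ℂ] 𝒢.B}
    (hs : s ∈ tensorDeg 𝒢.degNdual 𝒢.degB i) {e : E} (he : e ∈ ℰ j) :
    theta γ E s e ∈ coindHom 𝒢 (twistDeg γ ℰ) (i + j) := by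
  refine ⟨theta_B_mul γ s e, fun k u hu => ?_⟩
  rw [theta_apply, ← add_assoc]
  exact hact (ev_mem h hs hu) he

include h in
lemma theta_mem_iSup (hact : IsGradedAction 𝒢.degB ℰ) (hsup : ⨆ n, ℰ n = ⊤)
    (t : (𝒢.Ndual ⊗[ℂ] 𝒢.B) ⊗[ℂ] E) :
    TensorProduct.lift (theta γ E) t ∈ ⨆ n, coindHom 𝒢 (twistDeg γ ℰ) n := by
  have ht : t ∈ ⨆ n, tensorDeg (tensorDeg 𝒢.degNdual 𝒢.degB) ℰ n :=
    iSup_tensorDeg (iSup_tensorDeg 𝒢.iSup_degNdual 𝒢.iSup_degB) hsup ▸ Submodule.mem_top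
  induction ht using Submodule.iSup_induction' with
  | mem i x hx =>
    exact Submodule.mem_iSup_of_mem i (map_mem_of_tensorDeg (f := TensorProduct.lift (theta γ E))
      (fun p q hpq s hs e he => hpq ▸ theta_mem h hact hs he) hx)
  | zero => rw [map_zero]; exact zero_mem _
  | add a b _ _ ha hb => rw [map_add]; exact add_mem ha hb

/-- The map `theta` with values in the coinduced module. -/
def thetaCoind (hact : IsGradedAction 𝒢.degB ℰ) (hsup : ⨆ n, ℰ n = ⊤) :
    (𝒢.Ndual ⊗[ℂ] 𝒢.B) ⊗[ℂ] E →ₗ[ℂ] Coind 𝒢 (twistDeg γ ℰ) :=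
  (TensorProduct.lift (theta γ E)).codRestrict _ (theta_mem_iSup h hact hsup)

lemma Coind.ext_toHom {ℰ : ℤ → Submodule ℂ E} {φ ψ : Coind 𝒢 ℰ}
    (h : φ.toHom = ψ.toHom) : φ = ψ := Subtype.ext h

end Theta

end LieGrading

namespace SemiregularBimodule

open LieGrading

variable {L : Type*} [LieRing L] [LieAlgebra ℂ L] {𝒢 : LieGrading L}
  {γ : LieAlgebra.LieCharacter ℂ 𝒢.nonneg}

section Basic

variable (S : SemiregularBimodule 𝒢 γ)

/-- The identification of `S_γ` with `N^⊛ ⊗ B`. -/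
def carrier : 𝒢.Ndual ⊗[ℂ] 𝒢.B ≃ₗ[ℂ] S.Carrier := LinearEquiv.refl ℂ _

variable {M : Type*} [AddCommGroup M] [Module ℂ M] [Module 𝒢.U M]

/-- The class of `s ⊗ m` in `S_γ ⊗_U M`. -/
def tensorMk : S.Carrier →ₗ[ℂ] M →ₗ[ℂ] S.Tensor M :=
  (TensorProduct.mk ℂ S.Carrier M).compr₂ ((S.tensorRel M).mkQ.restrictScalars ℂ)

lemma tensorMk_mulRight (s : S.Carrier) (u : 𝒢.U) (m : M) :
    S.tensorMk (S.mulRight u s) m = S.tensorMk s (u • m) :=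
  (Submodule.Quotient.eq (S.tensorRel M)).2 (Submodule.subset_span ⟨s, u, m, rfl⟩)

lemma tensor_induction {P : S.Tensor M → Prop} (mk : ∀ s m, P (S.tensorMk s m))
    (add : ∀ x y, P x → P y → P (x + y)) (x : S.Tensor M) : P x := by
  obtain ⟨t, rfl⟩ := (S.tensorRel M).mkQ_surjective x
  induction t with
  | zero => simpa [tensorMk] using mk 0 0
  | add a b ha hb => rw [map_add]; exact add _ _ ha hb
  | tmul s m => exact mk s m

lemma iSup_tensorGrading {ℳ : ℤ → Submodule ℂ M} (hℳ : ⨆ n, ℳ n = ⊤) :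
    ⨆ n, S.tensorGrading ℳ n = ⊤ :=
  iSup_map_of_surjective (iSup_tensorDeg (ℳ := S.deg)
    (iSup_tensorDeg 𝒢.iSup_degNdual 𝒢.iSup_degB) hℳ)
    ((S.tensorRel M).mkQ.restrictScalars ℂ) (S.tensorRel M).mkQ_surjective

end Basic

variable (h : 𝒢.IsSemiInfinite γ)

lemma carrier_mulB (b : 𝒢.B) (s : 𝒢.Ndual ⊗[ℂ] 𝒢.B) :
    (semiregular h).carrier (mulB b s) =
      (semiregular h).mulRight (𝒢.ιB b) ((semiregular h).carrier s) :=
  congrArg (semiregular h).carrier (rightAct_B b s).symm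

variable {E : Type*} [AddCommGroup E] [Module ℂ E] [Module 𝒢.B E]
  [IsScalarTower ℂ 𝒢.B E] {ℰ : ℤ → Submodule ℂ E}

/-- For `s` in `S_γ`, the map `U ⊗_B E → 𝓗om_B(U, ℂ_γ ⊗ E)` with `u ⊗ e ↦ (v ↦ (s u)(v) e)`. -/
def indToCoind (hact : IsGradedAction 𝒢.degB ℰ) (hsup : ⨆ n, ℰ n = ⊤)
    (s : 𝒢.Ndual ⊗[ℂ] 𝒢.B) : 𝒢.Ind E →ₗ[ℂ] Coind 𝒢 (twistDeg γ ℰ) :=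
  indLift (thetaCoind h hact hsup ∘ₗ
      (𝒢.rightAct.toLinearMap.flip s ∘ₗ (MulOpposite.opLinearEquiv ℂ).toLinearMap).rTensor E)
    fun u b e => Coind.ext_toHom (by
      change theta γ E (𝒢.rightAct (MulOpposite.op (u * 𝒢.ιB b)) s) e =
        theta γ E (𝒢.rightAct (MulOpposite.op u) s) (b • e)
      rw [rightAct_mul, rightAct_B, theta_mulB])

lemma indToCoind_mk_toHom (hact : IsGradedAction 𝒢.degB ℰ) (hsup : ⨆ n, ℰ n = ⊤)
    (s : 𝒢.Ndual ⊗[ℂ] 𝒢.B) (u : 𝒢.U) (e : E) :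
    (indToCoind h hact hsup s (indMk u e)).toHom =
      theta γ E (𝒢.rightAct (MulOpposite.op u) s) e := rfl

/-- This uses (u s) v = u (s v), the commutation of the two actions on S_γ. -/
lemma indToCoind_leftAct (hact : IsGradedAction 𝒢.degB ℰ) (hsup : ⨆ n, ℰ n = ⊤) (u : 𝒢.U)
    (s : 𝒢.Ndual ⊗[ℂ] 𝒢.B) (x : 𝒢.Ind E) :
    indToCoind h hact hsup (leftAct h u s) x = u • indToCoind h hact hsup s x := by
  induction x using ind_induction with
  | add x y hx hy => rw [map_add, map_add, hx, hy, smul_add]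
  | mk v e =>
    refine Coind.ext_toHom (LinearMap.ext fun w => ?_)
    rw [Coind.smul_toHom, indToCoind_mk_toHom, indToCoind_mk_toHom, ← leftAct_rightAct,
      theta_leftAct]

lemma indToCoind_rightAct (hact : IsGradedAction 𝒢.degB ℰ) (hsup : ⨆ n, ℰ n = ⊤) (u : 𝒢.U)
    (s : 𝒢.Ndual ⊗[ℂ] 𝒢.B) (x : 𝒢.Ind E) :
    indToCoind h hact hsup (𝒢.rightAct (MulOpposite.op u) s) x =
      indToCoind h hact hsup s (u • x) := by
  induction x using ind_induction with
  | add x y hx hy => rw [smul_add, map_add, map_add, hx, hy]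
  | mk v e =>
    refine Coind.ext_toHom ?_
    rw [smul_indMk, indToCoind_mk_toHom, indToCoind_mk_toHom, rightAct_mul]

/-- The maps `indToCoind` depend linearly on `s`. -/
def indToCoindLin (hact : IsGradedAction 𝒢.degB ℰ) (hsup : ⨆ n, ℰ n = ⊤) :
    𝒢.Ndual ⊗[ℂ] 𝒢.B →ₗ[ℂ] 𝒢.Ind E →ₗ[ℂ] Coind 𝒢 (twistDeg γ ℰ) where
  toFun := indToCoind h hact hsup
  map_add' s t := ind_hom_ext fun u e => Coind.ext_toHom (by
    change theta γ E (𝒢.rightAct (MulOpposite.op u) (s + t)) e =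
      theta γ E (𝒢.rightAct (MulOpposite.op u) s) e +
      theta γ E (𝒢.rightAct (MulOpposite.op u) t) e
    rw [map_add, map_add, LinearMap.add_apply])
  map_smul' c s := ind_hom_ext fun u e => Coind.ext_toHom (by
    change theta γ E (𝒢.rightAct (MulOpposite.op u) (c • s)) e =
      c • theta γ E (𝒢.rightAct (MulOpposite.op u) s) e
    rw [map_smul, map_smul, LinearMap.smul_apply])

/-- The map `S_γ ⊗ (U ⊗_B E) → 𝓗om_B(U, ℂ_γ ⊗ E)`. -/
def preTensorToCoind (hact : IsGradedAction 𝒢.degB ℰ) (hsup : ⨆ n, ℰ n = ⊤) :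
    (semiregular h).Carrier ⊗[ℂ] 𝒢.Ind E →ₗ[𝒢.U] Coind 𝒢 (twistDeg γ ℰ) where
  toFun := TensorProduct.lift
    (indToCoindLin h hact hsup ∘ₗ (semiregular h).carrier.symm.toLinearMap)
  map_add' := map_add _
  map_smul' u t := by
    rw [RingHom.id_apply]
    induction t with
    | zero => rw [smul_zero, map_zero, smul_zero]
    | add a b ha hb => rw [smul_add, map_add, map_add, ha, hb, smul_add]
    | tmul s x => exact indToCoind_leftAct h hact hsup u _ x

/-- The map `S_γ ⊗_U (U ⊗_B E) → 𝓗om_B(U, ℂ_γ ⊗ E)`. -/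
def tensorToCoind (hact : IsGradedAction 𝒢.degB ℰ) (hsup : ⨆ n, ℰ n = ⊤) :
    (semiregular h).Tensor (𝒢.Ind E) →ₗ[𝒢.U] Coind 𝒢 (twistDeg γ ℰ) :=
  ((semiregular h).tensorRel (𝒢.Ind E)).liftQ (preTensorToCoind h hact hsup) <| by
    refine Submodule.span_le.2 ?_
    rintro _ ⟨s, u, x, rfl⟩
    rw [SetLike.mem_coe, LinearMap.mem_ker, map_sub, sub_eq_zero]
    exact indToCoind_rightAct h hact hsup u _ x

lemma tensorToCoind_mk (hact : IsGradedAction 𝒢.degB ℰ) (hsup : ⨆ n, ℰ n = ⊤)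
    (s : 𝒢.Ndual ⊗[ℂ] 𝒢.B) (x : 𝒢.Ind E) :
    tensorToCoind h hact hsup ((semiregular h).tensorMk ((semiregular h).carrier s) x) =
      indToCoind h hact hsup s x := rfl

/-- The map `N^⊛ ⊗ E → S_γ ⊗_U (U ⊗_B E)`. -/
def toTensorInd : 𝒢.Ndual ⊗[ℂ] E →ₗ[ℂ] (semiregular h).Tensor (𝒢.Ind E) :=
  TensorProduct.lift (semiregular h).tensorMk ∘ₗ TensorProduct.map
    ((semiregular h).carrier.toLinearMap ∘ₗ (TensorProduct.mk ℂ 𝒢.Ndual 𝒢.B).flip 1)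
    ((𝒢.indRel E).mkQ.restrictScalars ℂ ∘ₗ TensorProduct.mk ℂ 𝒢.U E 1)

omit [IsScalarTower ℂ 𝒢.B E] in
lemma toTensorInd_tmul (f : 𝒢.Ndual) (e : E) : toTensorInd h (f ⊗ₜ e) =
    (semiregular h).tensorMk ((semiregular h).carrier (f ⊗ₜ 1)) (indMk 1 e) := rfl

-- In s ⊗ (u ⊗ e) the factor u moves into s. Then s u is a sum of terms f ⊗ b = (f ⊗ 1) b, and b
-- moves on to e.
omit [IsScalarTower ℂ 𝒢.B E] in
lemma toTensorInd_surjective : Function.Surjective (toTensorInd h (E := E)) := by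
  rw [← LinearMap.range_eq_top, eq_top_iff]
  rintro x -
  induction x using tensor_induction with
  | add x y hx hy => exact add_mem hx hy
  | mk s x =>
    induction x using ind_induction with
    | add x y hx hy => rw [map_add]; exact add_mem hx hy
    | mk u e =>
      have h1 : (indMk u e : 𝒢.Ind E) = u • indMk 1 e := by rw [smul_indMk, mul_one]
      rw [h1, ← tensorMk_mulRight]
      obtain ⟨t, ht⟩ := (semiregular h).carrier.surjective ((semiregular h).mulRight u s)
      rw [← ht]
      clear ht
      induction t with
      | zero => rw [map_zero, map_zero, LinearMap.zero_apply]; exact zero_mem _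
      | add a b ha hb => rw [map_add, map_add, LinearMap.add_apply]; exact add_mem ha hb
      | tmul f b =>
        refine ⟨f ⊗ₜ (b • e), ?_⟩
        have h2 : (f ⊗ₜ b : 𝒢.Ndual ⊗[ℂ] 𝒢.B) = mulB b (f ⊗ₜ 1) := by rw [mulB_tmul, one_mul]
        rw [toTensorInd_tmul, h2, carrier_mulB, tensorMk_mulRight, smul_indMk, mul_one,
          ← indMk_mul_B, one_mul]

lemma tensorToCoind_toTensorInd (hact : IsGradedAction 𝒢.degB ℰ) (hsup : ⨆ n, ℰ n = ⊤)
    (hsup' : ⨆ n, twistDeg γ ℰ n = ⊤)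
    (t : 𝒢.Ndual ⊗[ℂ] E) : tensorToCoind h hact hsup (toTensorInd h t) =
      𝒢.toCoind (isGradedAction_twist h.graded hact) hsup'
        ((twist γ E).lTensor 𝒢.Ndual t) := by
  induction t with
  | zero => simp only [map_zero]
  | add a b ha hb => simp only [map_add, ha, hb]
  | tmul f e =>
    refine Coind.ext fun n => ?_
    rw [toTensorInd_tmul, tensorToCoind_mk, indToCoind_mk_toHom, MulOpposite.op_one, map_one,
      Module.End.one_apply, theta_N, toCoind_toHom_N, LinearEquiv.lTensor_tmul, dualHom_tmul,
      map_smul]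

/-- The isomorphism from N^⊛ ⊗ E to the coinduced module factors through a surjection onto S_γ ⊗_U
(U ⊗_B E). That surjection is then injective as well, and the other factor is bijective. -/
lemma tensorToCoind_bijective (hact : IsGradedAction 𝒢.degB ℰ) (hsup : ⨆ n, ℰ n = ⊤)
    (hbdd : ∃ m : ℤ, ∀ n < m, ℰ n = ⊥) : Function.Bijective (tensorToCoind h hact hsup) := by
  have hsup' : ⨆ n, twistDeg γ ℰ n = ⊤ := hsup
  have h1 : Function.Bijective (𝒢.toCoind (isGradedAction_twist h.graded hact) hsup' ∘
      (twist γ E).lTensor 𝒢.Ndual) :=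
    Function.Bijective.comp
      ⟨𝒢.toCoind_injective _ _, 𝒢.toCoind_surjective _ _ h.fg hbdd⟩ (LinearEquiv.bijective _)
  have h2 : (tensorToCoind h hact hsup) ∘ (toTensorInd h) =
      𝒢.toCoind (isGradedAction_twist h.graded hact) hsup' ∘ (twist γ E).lTensor 𝒢.Ndual :=
    funext (tensorToCoind_toTensorInd h hact hsup hsup')
  rw [← h2] at h1
  exact (Function.Bijective.of_comp_iff (tensorToCoind h hact hsup)
    ⟨h1.injective.of_comp, toTensorInd_surjective h⟩).1 h1

lemma tensorToCoind_mem (hact : IsGradedAction 𝒢.degB ℰ) (hsup : ⨆ n, ℰ n = ⊤) {n : ℤ}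
    {x : (semiregular h).Tensor (𝒢.Ind E)}
    (hx : x ∈ (semiregular h).tensorGrading (indDeg 𝒢 ℰ) n) :
    tensorToCoind h hact hsup x ∈ coindDeg 𝒢 (twistDeg γ ℰ) n := by
  obtain ⟨t, ht, rfl⟩ := hx
  refine map_mem_of_tensorDeg (f := (preTensorToCoind h hact hsup).restrictScalars ℂ)
    (fun i j hij s hs x hx => ?_) ht
  refine map_mem_of_indDeg (f := indToCoind h hact hsup ((semiregular h).carrier.symm s))
    (fun p q hpq u hu e he => ?_) hx
  rw [← hij, ← hpq, ← add_assoc, add_comm i p]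
  exact theta_mem h hact (rightAct_mem hu hs) he

/-- `S_γ ⊗_U (U ⊗_B E) ≅ 𝓗om_B(U, ℂ_γ ⊗ E)`. -/
theorem gradedIso_tensor_ind (hE : IsGradedModule 𝒢.degB ℰ)
    (hbdd : ∃ m : ℤ, ∀ n < m, ℰ n = ⊥) :
    GradedIso 𝒢.U ((semiregular h).tensorGrading (indDeg 𝒢 ℰ)) (coindDeg 𝒢 (twistDeg γ ℰ)) := by
  have hsup := hE.internal.submodule_iSup_eq_top
  have hind : iSupIndep (twistDeg γ ℰ) := hE.internal.submodule_iSupIndep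
  exact gradedIso_of_le ((semiregular h).iSup_tensorGrading (𝒢.iSup_indDeg hsup))
    (𝒢.iSupIndep_coindDeg hind)
    (LinearEquiv.ofBijective _ (tensorToCoind_bijective h hE.smul_mem hsup hbdd))
    fun n x hx => tensorToCoind_mem h hE.smul_mem hsup hx

/-- A central element `c` of `U` in `L_{≥0}` which acts on `E` as `k` acts on
`S_γ ⊗_U (U ⊗_B E)` as `k + γ(c)`. -/
theorem smul_tensor_ind (hE : IsGradedModule 𝒢.degB ℰ)
    (hbdd : ∃ m : ℤ, ∀ n < m, ℰ n = ⊥) {c : 𝒢.nonneg} (hc : ∀ u : 𝒢.U,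
      Commute (𝒢.ιB (ι ℂ c)) u) {k : ℂ} (hk : ∀ e : E, (ι ℂ c : 𝒢.B) • e = k • e)
    (x : (semiregular h).Tensor (𝒢.Ind E)) : 𝒢.ιB (ι ℂ c) • x = (k + γ c) • x := by
  have hsup := hE.internal.submodule_iSup_eq_top
  apply (tensorToCoind_bijective h hE.smul_mem hsup hbdd).injective
  rw [map_smul, LinearMap.map_smul_of_tower]
  generalize tensorToCoind h hE.smul_mem hsup x = φ
  refine Coind.ext_toHom (LinearMap.ext fun v => ?_)
  -- As c is central, (c φ)(v) = φ(v c) = φ(c v) = c φ(v), and on the twisted module c acts as k +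
  -- γ(c).
  rw [Coind.smul_toHom, ← (hc v).eq, Coind.toHom_B_mul]
  obtain ⟨e, he⟩ := (twist γ E).surjective (φ.toHom v)
  have h1 : ((k + γ c) • φ).toHom v = (k + γ c) • φ.toHom v := rfl
  rw [h1, ← he, smul_twist, shift_ι, add_smul, hk, algebraMap_smul, ← map_smul, add_smul]

end SemiregularBimodule

/-! ### Functoriality for graded isomorphisms -/

section Functoriality

lemma GradedIso.symm {A M M' : Type*} [Ring A] [AddCommGroup M] [AddCommGroup M']
    [Module ℂ M] [Module ℂ M'] [Module A M] [Module A M'] {ℳ : ℤ → Submodule ℂ M}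
    {ℳ' : ℤ → Submodule ℂ M'} (h : GradedIso A ℳ ℳ') : GradedIso A ℳ' ℳ := by
  obtain ⟨e, he⟩ := h
  exact ⟨e.symm, fun n x => by rw [he, e.apply_symm_apply]⟩

lemma GradedIso.trans {A M M' M'' : Type*} [Ring A] [AddCommGroup M] [AddCommGroup M']
    [AddCommGroup M''] [Module ℂ M] [Module ℂ M'] [Module ℂ M''] [Module A M] [Module A M']
    [Module A M''] {ℳ : ℤ → Submodule ℂ M} {ℳ' : ℤ → Submodule ℂ M'}
    {ℳ'' : ℤ → Submodule ℂ M''} (h : GradedIso A ℳ ℳ') (h' : GradedIso A ℳ' ℳ'') :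
    GradedIso A ℳ ℳ'' := by
  obtain ⟨e, he⟩ := h
  obtain ⟨e', he'⟩ := h'
  exact ⟨e.trans e', fun n x => by rw [he, he', LinearEquiv.trans_apply]⟩

end Functoriality

namespace LieGrading

variable {L : Type*} [LieRing L] [LieAlgebra ℂ L] {𝒢 : LieGrading L}
  {E E' : Type*} [AddCommGroup E] [Module ℂ E] [Module 𝒢.B E] [IsScalarTower ℂ 𝒢.B E]
  [AddCommGroup E'] [Module ℂ E'] [Module 𝒢.B E'] [IsScalarTower ℂ 𝒢.B E']
  {ℰ : ℤ → Submodule ℂ E} {ℰ' : ℤ → Submodule ℂ E'}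

lemma comp_mem_coindHom {g : E →ₗ[𝒢.B] E'} (hg : ∀ n, ∀ e ∈ ℰ n, g e ∈ ℰ' n) {j : ℤ}
    {φ : 𝒢.U →ₗ[ℂ] E} (hφ : φ ∈ coindHom 𝒢 ℰ j) :
    g.restrictScalars ℂ ∘ₗ φ ∈ coindHom 𝒢 ℰ' j := by
  refine ⟨fun b u => ?_, fun i u hu => hg _ _ (hφ.2 i u hu)⟩
  rw [LinearMap.comp_apply, hφ.1, LinearMap.restrictScalars_apply, map_smul]
  rfl

/-- The map of coinduced modules given by a graded map of `B`-modules. -/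
def coindMap (g : E →ₗ[𝒢.B] E') (hg : ∀ n, ∀ e ∈ ℰ n, g e ∈ ℰ' n) :
    Coind 𝒢 ℰ →ₗ[𝒢.U] Coind 𝒢 ℰ' where
  toFun φ := ⟨g.restrictScalars ℂ ∘ₗ φ.toHom, by
    obtain ⟨φ, hφ⟩ := φ
    change g.restrictScalars ℂ ∘ₗ φ ∈ _
    induction hφ using Submodule.iSup_induction' with
    | mem i φ hφ => exact Submodule.mem_iSup_of_mem i (comp_mem_coindHom hg hφ)
    | zero => rw [LinearMap.comp_zero]; exact zero_mem _
    | add a b _ _ ha hb => rw [LinearMap.comp_add]; exact add_mem ha hb⟩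
  map_add' φ ψ := Subtype.ext (LinearMap.comp_add _ _ _)
  map_smul' u φ := rfl

lemma coindMap_mem (g : E →ₗ[𝒢.B] E') (hg : ∀ n, ∀ e ∈ ℰ n, g e ∈ ℰ' n) {n : ℤ} {φ : Coind 𝒢 ℰ}
    (hφ : φ ∈ coindDeg 𝒢 ℰ n) : coindMap g hg φ ∈ coindDeg 𝒢 ℰ' n :=
  comp_mem_coindHom hg hφ

lemma gradedIso_coind (h : GradedIso 𝒢.B ℰ ℰ') :
    GradedIso 𝒢.U (coindDeg 𝒢 ℰ) (coindDeg 𝒢 ℰ') := by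
  obtain ⟨e, he⟩ := h
  have h1 : ∀ n, ∀ x ∈ ℰ n, e.toLinearMap x ∈ ℰ' n := fun n x hx => (he n x).1 hx
  have h2 : ∀ n, ∀ x ∈ ℰ' n, e.symm.toLinearMap x ∈ ℰ n := fun n x hx =>
    (he n _).2 (by rw [LinearEquiv.coe_coe, e.apply_symm_apply]; exact hx)
  have h3 : ∀ φ, coindMap e.symm.toLinearMap h2 (coindMap e.toLinearMap h1 φ) = φ := fun φ =>
    Coind.ext_toHom (LinearMap.ext fun u => e.symm_apply_apply _)
  have h4 : ∀ φ, coindMap e.toLinearMap h1 (coindMap e.symm.toLinearMap h2 φ) = φ := fun φ =>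
    Coind.ext_toHom (LinearMap.ext fun u => e.apply_symm_apply _)
  refine ⟨{ coindMap e.toLinearMap h1 with
    invFun := coindMap e.symm.toLinearMap h2
    left_inv := h3
    right_inv := h4 }, fun n φ => ⟨coindMap_mem _ h1, fun hφ => ?_⟩⟩
  rw [← h3 φ]
  exact coindMap_mem _ h2 hφ

/-- The map of induced modules given by a map of `B`-modules. -/
def indMap (g : E →ₗ[𝒢.B] E') : 𝒢.Ind E →ₗ[𝒢.U] 𝒢.Ind E' :=
  let F : 𝒢.Ind E →ₗ[ℂ] 𝒢.Ind E' :=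
    indLift ((𝒢.indRel E').mkQ.restrictScalars ℂ ∘ₗ (g.restrictScalars ℂ).lTensor 𝒢.U)
      fun u b e => by
        change indMk (u * 𝒢.ιB b) (g e) = indMk u (g (b • e))
        rw [indMk_mul_B, map_smul]
  { F with
    map_smul' := fun u x => by
      change F (u • x) = u • F x
      induction x using ind_induction with
      | add x y hx hy => rw [smul_add, map_add, map_add, hx, hy, smul_add]
      | mk v e => rfl }

lemma indMap_mk (g : E →ₗ[𝒢.B] E') (u : 𝒢.U) (e : E) : indMap g (indMk u e) = indMk u (g e) := rfl

lemma indMap_mem {g : E →ₗ[𝒢.B] E'} (hg : ∀ n, ∀ e ∈ ℰ n, g e ∈ ℰ' n) {n : ℤ} {x : 𝒢.Ind E}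
    (hx : x ∈ indDeg 𝒢 ℰ n) : indMap g x ∈ indDeg 𝒢 ℰ' n :=
  map_mem_of_indDeg (f := (indMap g).restrictScalars ℂ)
    (fun _ _ hij _ hu e he => hij ▸ indMk_mem hu (hg _ e he)) hx

lemma gradedIso_ind (h : GradedIso 𝒢.B ℰ ℰ') : GradedIso 𝒢.U (indDeg 𝒢 ℰ) (indDeg 𝒢 ℰ') := by
  obtain ⟨e, he⟩ := h
  have h1 : ∀ n, ∀ x ∈ ℰ n, e.toLinearMap x ∈ ℰ' n := fun n x hx => (he n x).1 hx
  have h2 : ∀ n, ∀ x ∈ ℰ' n, e.symm.toLinearMap x ∈ ℰ n := fun n x hx =>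
    (he n _).2 (by rw [LinearEquiv.coe_coe, e.apply_symm_apply]; exact hx)
  have h3 : ∀ x, indMap e.symm.toLinearMap (indMap e.toLinearMap x) = x := fun x => by
    induction x using ind_induction with
    | add x y hx hy => rw [map_add, map_add, hx, hy]
    | mk u x => rw [indMap_mk, indMap_mk, LinearEquiv.coe_coe, LinearEquiv.coe_coe,
        e.symm_apply_apply]
  have h4 : ∀ x, indMap e.toLinearMap (indMap e.symm.toLinearMap x) = x := fun x => by
    induction x using ind_induction with
    | add x y hx hy => rw [map_add, map_add, hx, hy]
    | mk u x => rw [indMap_mk, indMap_mk, LinearEquiv.coe_coe, LinearEquiv.coe_coe,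
        e.apply_symm_apply]
  refine ⟨{ indMap e.toLinearMap with
    invFun := indMap e.symm.toLinearMap
    left_inv := h3
    right_inv := h4 }, fun n x => ⟨indMap_mem h1, fun hx => ?_⟩⟩
  rw [← h3 x]
  exact indMap_mem h2 hx

end LieGrading

namespace SemiregularBimodule

open LieGrading

variable {L : Type*} [LieRing L] [LieAlgebra ℂ L] {𝒢 : LieGrading L}
  {γ : LieAlgebra.LieCharacter ℂ 𝒢.nonneg}

section HomFunctor

variable (S : SemiregularBimodule 𝒢 γ) {M M' : Type*} [AddCommGroup M] [Module ℂ M] [Module 𝒢.U M]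
  [IsScalarTower ℂ 𝒢.U M] [AddCommGroup M'] [Module ℂ M'] [Module 𝒢.U M']
  [IsScalarTower ℂ 𝒢.U M'] {ℳ : ℤ → Submodule ℂ M} {ℳ' : ℤ → Submodule ℂ M'}

variable {S} in
/-- An element of `𝓗om_U(S_γ, M)` as a map. -/
def Hom.toMap (φ : S.Hom ℳ) : S.Carrier →ₗ[ℂ] M := φ.1

variable {S} in
lemma Hom.ext_toMap {φ ψ : S.Hom ℳ} (h : φ.toMap = ψ.toMap) : φ = ψ := Subtype.ext h

variable {S} in
lemma Hom.toMap_smul (φ : S.Hom ℳ) (u : 𝒢.U) (s : S.Carrier) :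
    φ.toMap (u • s) = u • φ.toMap s := by
  obtain ⟨φ, hφ⟩ := φ
  change φ (u • s) = u • φ s
  induction hφ using Submodule.iSup_induction' with
  | mem i φ hφ => exact hφ.1 u s
  | zero => simp
  | add a b _ _ ha hb => rw [LinearMap.add_apply, LinearMap.add_apply, ha, hb, smul_add]

lemma comp_mem_homPart {g : M →ₗ[𝒢.U] M'} (hg : ∀ n, ∀ m ∈ ℳ n, g m ∈ ℳ' n) {j : ℤ}
    {φ : S.Carrier →ₗ[ℂ] M} (hφ : φ ∈ S.homPart ℳ j) :
    g.restrictScalars ℂ ∘ₗ φ ∈ S.homPart ℳ' j := by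
  refine ⟨fun b u => ?_, fun i u hu => hg _ _ (hφ.2 i u hu)⟩
  rw [LinearMap.comp_apply, hφ.1, LinearMap.restrictScalars_apply, map_smul]
  rfl

/-- The map `𝓗om_U(S_γ, M) → 𝓗om_U(S_γ, M')` given by a graded map `M → M'`. -/
def homMap (g : M →ₗ[𝒢.U] M') (hg : ∀ n, ∀ e ∈ ℳ n, g e ∈ ℳ' n) :
    S.Hom ℳ →ₗ[𝒢.U] S.Hom ℳ' where
  toFun φ := ⟨g.restrictScalars ℂ ∘ₗ φ.toMap, by
    obtain ⟨φ, hφ⟩ := φ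
    change g.restrictScalars ℂ ∘ₗ φ ∈ _
    induction hφ using Submodule.iSup_induction' with
    | mem i φ hφ => exact Submodule.mem_iSup_of_mem i (S.comp_mem_homPart hg hφ)
    | zero => rw [LinearMap.comp_zero]; exact zero_mem _
    | add a b _ _ ha hb => rw [LinearMap.comp_add]; exact add_mem ha hb⟩
  map_add' φ ψ := Subtype.ext (LinearMap.comp_add _ _ _)
  map_smul' u φ := rfl

lemma homMap_mem (g : M →ₗ[𝒢.U] M') (hg : ∀ n, ∀ e ∈ ℳ n, g e ∈ ℳ' n) {n : ℤ} {φ : S.Hom ℳ}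
    (hφ : φ ∈ S.homGrading ℳ n) : S.homMap g hg φ ∈ S.homGrading ℳ' n :=
  S.comp_mem_homPart hg hφ

lemma gradedIso_hom (h : GradedIso 𝒢.U ℳ ℳ') :
    GradedIso 𝒢.U (S.homGrading ℳ) (S.homGrading ℳ') := by
  obtain ⟨e, he⟩ := h
  have h1 : ∀ n, ∀ x ∈ ℳ n, e.toLinearMap x ∈ ℳ' n := fun n x hx => (he n x).1 hx
  have h2 : ∀ n, ∀ x ∈ ℳ' n, e.symm.toLinearMap x ∈ ℳ n := fun n x hx =>
    (he n _).2 (by rw [LinearEquiv.coe_coe, e.apply_symm_apply]; exact hx)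
  have h3 : ∀ φ, S.homMap e.symm.toLinearMap h2 (S.homMap e.toLinearMap h1 φ) = φ := fun φ =>
    Hom.ext_toMap (LinearMap.ext fun u => e.symm_apply_apply _)
  have h4 : ∀ φ, S.homMap e.toLinearMap h1 (S.homMap e.symm.toLinearMap h2 φ) = φ := fun φ =>
    Hom.ext_toMap (LinearMap.ext fun u => e.apply_symm_apply _)
  refine ⟨{ S.homMap e.toLinearMap h1 with
    invFun := S.homMap e.symm.toLinearMap h2
    left_inv := h3
    right_inv := h4 }, fun n φ => ⟨S.homMap_mem _ h1, fun hφ => ?_⟩⟩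
  rw [← h3 φ]
  exact S.homMap_mem _ h2 hφ

lemma iSupIndep_homGrading (hℳ : iSupIndep ℳ) : iSupIndep (S.homGrading ℳ) := by
  have hS : ⨆ n, S.deg n = ⊤ := iSup_tensorDeg 𝒢.iSup_degNdual 𝒢.iSup_degB
  exact iSupIndep_subtype (𝒯 := S.homPart ℳ) (iSupIndep_hom hS hℳ fun _ _ hφ => hφ.2) _

end HomFunctor

/-! ### The functor `𝓗om_U(S_γ, -)` on coinduced modules -/

variable (h : 𝒢.IsSemiInfinite γ) {E : Type*} [AddCommGroup E] [Module ℂ E] [Module 𝒢.B E]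
  [IsScalarTower ℂ 𝒢.B E] {ℰ : ℤ → Submodule ℂ E}

lemma indToCoind_mem (hact : IsGradedAction 𝒢.degB ℰ) (hsup : ⨆ n, ℰ n = ⊤) {i j : ℤ}
    {s : 𝒢.Ndual ⊗[ℂ] 𝒢.B} (hs : s ∈ tensorDeg 𝒢.degNdual 𝒢.degB i) {x : 𝒢.Ind E}
    (hx : x ∈ indDeg 𝒢 ℰ j) :
    indToCoind h hact hsup s x ∈ coindDeg 𝒢 (twistDeg γ ℰ) (i + j) := by
  refine map_mem_of_indDeg (f := indToCoind h hact hsup s) (fun p q hpq u hu e he => ?_) hx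
  rw [← hpq, ← add_assoc, add_comm i p]
  exact theta_mem h hact (rightAct_mem hu hs) he

lemma indToCoind_mem_homPart (hact : IsGradedAction 𝒢.degB ℰ) (hsup : ⨆ n, ℰ n = ⊤) {j : ℤ}
    {x : 𝒢.Ind E} (hx : x ∈ indDeg 𝒢 ℰ j) :
    (indToCoindLin h hact hsup).flip x ∘ₗ (semiregular h).carrier.symm.toLinearMap ∈
      (semiregular h).homPart (coindDeg 𝒢 (twistDeg γ ℰ)) j :=
  ⟨fun u _ => indToCoind_leftAct h hact hsup u _ x,
    fun _ _ hs => indToCoind_mem h hact hsup hs hx⟩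

/-- The map `U ⊗_B E → 𝓗om_U(S_γ, 𝓗om_B(U, ℂ_γ ⊗ E))`. -/
def indToHom (hact : IsGradedAction 𝒢.degB ℰ) (hsup : ⨆ n, ℰ n = ⊤) :
    𝒢.Ind E →ₗ[𝒢.U] (semiregular h).Hom (coindDeg 𝒢 (twistDeg γ ℰ)) where
  toFun x := ⟨(indToCoindLin h hact hsup).flip x ∘ₗ (semiregular h).carrier.symm.toLinearMap, by
    have hx : x ∈ ⨆ n, indDeg 𝒢 ℰ n := 𝒢.iSup_indDeg hsup ▸ Submodule.mem_top
    induction hx using Submodule.iSup_induction' with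
    | mem i x hx => exact Submodule.mem_iSup_of_mem i (indToCoind_mem_homPart h hact hsup hx)
    | zero => rw [map_zero, LinearMap.zero_comp]; exact zero_mem _
    | add a b _ _ ha hb => rw [map_add, LinearMap.add_comp]; exact add_mem ha hb⟩
  map_add' x y := Hom.ext_toMap (LinearMap.ext fun s =>
    map_add (indToCoind h hact hsup ((semiregular h).carrier.symm s)) x y)
  map_smul' u x := Hom.ext_toMap (LinearMap.ext fun s =>
    (indToCoind_rightAct h hact hsup u _ x).symm)

lemma indToHom_toMap (hact : IsGradedAction 𝒢.degB ℰ) (hsup : ⨆ n, ℰ n = ⊤) (x : 𝒢.Ind E)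
    (s : 𝒢.Ndual ⊗[ℂ] 𝒢.B) : (indToHom h hact hsup x).toMap ((semiregular h).carrier s) =
      indToCoind h hact hsup s x := rfl

/-- The map `N ⊗ E → U ⊗_B E`. -/
def toInd : 𝒢.N ⊗[ℂ] E →ₗ[ℂ] 𝒢.Ind E :=
  (𝒢.indRel E).mkQ.restrictScalars ℂ ∘ₗ 𝒢.ιN.toLinearMap.rTensor E

omit [IsScalarTower ℂ 𝒢.B E] in
lemma toInd_tmul (n : 𝒢.N) (e : E) : toInd (n ⊗ₜ[ℂ] e) = indMk (𝒢.ιN n) e := rfl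

omit [IsScalarTower ℂ 𝒢.B E] in
lemma toInd_surjective : Function.Surjective (toInd (𝒢 := 𝒢) (E := E)) := by
  rw [← LinearMap.range_eq_top, eq_top_iff]
  rintro x -
  induction x using ind_induction with
  | add x y hx hy => exact add_mem hx hy
  | mk u e =>
    induction u using 𝒢.induction_NB with
    | mul n b => rw [indMk_mul_B]; exact ⟨n ⊗ₜ (b • e), rfl⟩
    | add u v hu hv =>
      have : (indMk (u + v) e : 𝒢.Ind E) = indMk u e + indMk v e :=
        congrArg (𝒢.indRel E).mkQ (TensorProduct.add_tmul _ _ _)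
      rw [this]
      exact add_mem hu hv

/-- On n ⊗ e this is (f n)(1) e = f(n) e: the evaluation at 1 turns the map of (2) into the pairing
of N^⊛ with N. -/
lemma indToCoind_toInd (hact : IsGradedAction 𝒢.degB ℰ) (hsup : ⨆ n, ℰ n = ⊤) (f : 𝒢.Ndual)
    (t : 𝒢.N ⊗[ℂ] E) : (indToCoind h hact hsup (f ⊗ₜ 1) (toInd t)).toHom 1 =
      twist γ E (TensorProduct.lid ℂ E (f.toDual.rTensor E t)) := by
  induction t with
  | zero => simp only [map_zero]; rfl
  | add a b ha hb => simp only [map_add, ← ha, ← hb]; rfl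
  | tmul n e =>
    rw [toInd_tmul, indToCoind_mk_toHom, rightAct_N, LinearMap.rTensor_tmul,
      TensorProduct.lid_tmul]
    have h1 := theta_N γ (mulN f n) e 1
    rw [map_one] at h1
    rw [h1]
    congr 2
    exact congrArg f.toDual (mul_one n)

/-- Every element comes from N ⊗ E, where by `indToCoind_toInd` the values at 1 of the images of f ⊗
1 are the contractions with f; these detect tensors. -/
lemma indToHom_injective (hact : IsGradedAction 𝒢.degB ℰ) (hsup : ⨆ n, ℰ n = ⊤) :
    Function.Injective (indToHom h hact hsup) := by
  rw [injective_iff_map_eq_zero]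
  intro x hx
  obtain ⟨t, rfl⟩ := toInd_surjective x
  rw [𝒢.eq_zero_of_forall_dual t fun f => ?_, map_zero]
  rw [← (twist γ E).map_eq_zero_iff, ← indToCoind_toInd h hact hsup, ← indToHom_toMap, hx]
  rfl

/-- The map s ↦ φ(s)(1) respects the left action of B, so by `eq_top_of_left_closed` it is
determined on N^⊛ ⊗ 1. It determines φ, because φ(s)(v) = φ(v s)(1). -/
lemma hom_coind_ext {φ ψ : (semiregular h).Hom (coindDeg 𝒢 ℰ)}
    (hφ : ∀ f, (φ.toMap ((semiregular h).carrier (f ⊗ₜ 1))).toHom 1 =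
      (ψ.toMap ((semiregular h).carrier (f ⊗ₜ 1))).toHom 1) : φ = ψ := by
  have key : ∀ s, (φ.toMap s).toHom 1 = (ψ.toMap s).toHom 1 := by
    let T : (semiregular h).Hom (coindDeg 𝒢 ℰ) → 𝒢.Ndual ⊗[ℂ] 𝒢.B →ₗ[ℂ] E := fun φ =>
      (LinearMap.applyₗ (1 : 𝒢.U) ∘ₗ (⨆ j, coindHom 𝒢 ℰ j).subtype) ∘ₗ φ.toMap ∘ₗ
        (semiregular h).carrier.toLinearMap
    have h1 := eq_top_of_left_closed h (LinearMap.eqLocus (T φ) (T ψ)) hφ fun b s hs => by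
      have h2 : ∀ φ, T φ (leftAct h (𝒢.ιB b) s) = b • T φ s := fun φ => by
        have h3 : T φ (leftAct h (𝒢.ιB b) s) =
          (φ.toMap (𝒢.ιB b • (semiregular h).carrier s)).toHom 1 := rfl
        rw [h3, Hom.toMap_smul, Coind.smul_toHom, one_mul]
        have h4 := (φ.toMap ((semiregular h).carrier s)).toHom_B_mul b 1
        rw [mul_one] at h4
        exact h4
      rw [LinearMap.mem_eqLocus] at hs ⊢
      rw [h2, h2, hs]
    intro s
    exact LinearMap.mem_eqLocus.1 (h1.symm ▸ Submodule.mem_top :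
      (semiregular h).carrier.symm s ∈ LinearMap.eqLocus (T φ) (T ψ))
  refine Hom.ext_toMap (LinearMap.ext fun s => Coind.ext_toHom (LinearMap.ext fun v => ?_))
  have h2 := key (v • s)
  rwa [Hom.toMap_smul, Hom.toMap_smul, Coind.smul_toHom, Coind.smul_toHom, one_mul] at h2

/-- For φ of degree j, the map g(f) = φ(f ⊗ 1)(1) sends degree i of N^⊛ to E_{i+j}. So it lives on 0
≤ i ≤ m - j, and `exists_linear_on_dual` produces the element of N ⊗ E. -/
lemma indToHom_surjective (hact : IsGradedAction 𝒢.degB ℰ) (hsup : ⨆ n, ℰ n = ⊤)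
    (hbdd : ∃ m : ℤ, ∀ n > m, ℰ n = ⊥) : Function.Surjective (indToHom h hact hsup) := by
  obtain ⟨m, hm⟩ := hbdd
  rintro ⟨φ, hφ⟩
  induction hφ using Submodule.iSup_induction' with
  | mem j φ hφ =>
    let g : 𝒢.Ndual →ₗ[ℂ] E := (twist γ E).symm.toLinearMap ∘ₗ
      (LinearMap.applyₗ (1 : 𝒢.U) ∘ₗ (⨆ j, coindHom 𝒢 (twistDeg γ ℰ) j).subtype) ∘ₗ φ ∘ₗ
        (semiregular h).carrier.toLinearMap ∘ₗ (TensorProduct.mk ℂ 𝒢.Ndual 𝒢.B).flip 1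
    obtain ⟨t, ht⟩ := 𝒢.exists_linear_on_dual h.fg (Finset.Icc 0 (m - j)) g (fun i hi f hf => by
      rw [Finset.mem_Icc] at hi
      by_cases h0 : i < 0
      · rw [𝒢.degNdual_eq_bot h0, Submodule.mem_bot] at hf
        rw [hf, map_zero]
      · have h1 : f ⊗ₜ (1 : 𝒢.B) ∈ tensorDeg 𝒢.degNdual 𝒢.degB (i + 0) :=
          tmul_mem_tensorDeg hf (one_mem_envDeg _)
        have h2 := (hφ.2 _ _ h1).2 0 1 (one_mem_envDeg _)
        have h3 : g f ∈ ℰ (0 + (i + 0 + j)) := h2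
        rwa [hm _ (by omega), Submodule.mem_bot] at h3)
    refine ⟨toInd t, hom_coind_ext h fun f => ?_⟩
    rw [indToHom_toMap, indToCoind_toInd, ht]
    exact (twist γ E).apply_symm_apply _
  | zero => exact ⟨0, map_zero _⟩
  | add x y hx' hy' hx hy =>
    obtain ⟨a, ha⟩ := hx
    obtain ⟨b, hb⟩ := hy
    exact ⟨a + b, by rw [map_add, ha, hb]; rfl⟩

lemma gradedIso_ind_hom (hE : IsGradedModule 𝒢.degB ℰ) (hbdd : ∃ m : ℤ, ∀ n > m, ℰ n = ⊥) :
    GradedIso 𝒢.U (indDeg 𝒢 ℰ) ((semiregular h).homGrading (coindDeg 𝒢 (twistDeg γ ℰ))) := by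
  have hsup := hE.internal.submodule_iSup_eq_top
  have hind : iSupIndep (twistDeg γ ℰ) := hE.internal.submodule_iSupIndep
  exact gradedIso_of_le (𝒢.iSup_indDeg hsup)
    ((semiregular h).iSupIndep_homGrading (𝒢.iSupIndep_coindDeg hind))
    (LinearEquiv.ofBijective _ ⟨indToHom_injective h hE.smul_mem hsup,
      indToHom_surjective h hE.smul_mem hsup hbdd⟩)
    fun n x hx => indToCoind_mem_homPart h hE.smul_mem hsup hx

/-- Twisting by opposite characters does not change a module. -/
lemma gradedIso_twist_twist {χ : LieAlgebra.LieCharacter ℂ 𝒢.nonneg} (hχ : ∀ x, χ x = -γ x) :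
    GradedIso 𝒢.B (twistDeg γ (twistDeg χ ℰ)) ℰ :=
  ⟨{ ((twist χ E).trans (twist γ (𝒢.Twist χ E))).symm with
    map_smul' := fun b x => by
      obtain ⟨y, rfl⟩ := (twist γ (𝒢.Twist χ E)).surjective x
      obtain ⟨z, rfl⟩ := (twist χ E).surjective y
      rw [smul_twist, smul_twist, shift_neg_shift γ b hχ]
      rfl }, fun n x => Iff.rfl⟩

/-- `𝓗om_U(S_γ, 𝓗om_B(U, F)) ≅ U ⊗_B (ℂ_{-γ} ⊗ F)`. -/
theorem gradedIso_hom_coind {χ : LieAlgebra.LieCharacter ℂ 𝒢.nonneg} (hχ : ∀ x, χ x = -γ x)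
    (hE : IsGradedModule 𝒢.degB ℰ) (hbdd : ∃ m : ℤ, ∀ n > m, ℰ n = ⊥) :
    GradedIso 𝒢.U ((semiregular h).homGrading (coindDeg 𝒢 ℰ)) (indDeg 𝒢 (twistDeg χ ℰ)) := by
  have hgr : IsGradedCharacter χ := fun n hn x hx => by rw [hχ, h.graded n hn x hx, neg_zero]
  have hE' : IsGradedModule 𝒢.degB (twistDeg χ ℰ) :=
    ⟨hE.internal, isGradedAction_twist hgr hE.smul_mem⟩
  -- The previous isomorphism is applied to E = ℂ_{-γ} ⊗ F, whose twist by γ is F again.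
  exact ((semiregular h).gradedIso_hom (gradedIso_coind (gradedIso_twist_twist hχ))).symm.trans
    (gradedIso_ind_hom h hE' hbdd).symm

/-- A central element `c` of `U` in `L_{≥0}` which acts on `F` as `k` acts on
`𝓗om_U(S_γ, 𝓗om_B(U, F))` as `k - γ(c)`. -/
theorem smul_hom_coind {χ : LieAlgebra.LieCharacter ℂ 𝒢.nonneg} (hχ : ∀ x, χ x = -γ x)
    (hE : IsGradedModule 𝒢.degB ℰ) (hbdd : ∃ m : ℤ, ∀ n > m, ℰ n = ⊥) {c : 𝒢.nonneg}
    (hc : ∀ u : 𝒢.U, Commute (𝒢.ιB (ι ℂ c)) u) {k : ℂ} (hk : ∀ e : E, (ι ℂ c : 𝒢.B) • e = k • e)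
    (x : (semiregular h).Hom (coindDeg 𝒢 ℰ)) : 𝒢.ιB (ι ℂ c) • x = (k - γ c) • x := by
  obtain ⟨e, -⟩ := gradedIso_hom_coind h hχ hE hbdd
  apply e.injective
  have h1 : e ((k - γ c) • x) = (k - γ c) • e x := e.toLinearMap.map_smul_of_tower _ _
  rw [map_smul, h1]
  generalize e x = y
  induction y using ind_induction with
  | add x y hx hy => rw [smul_add, smul_add, hx, hy]
  | mk u y =>
    obtain ⟨z, rfl⟩ := (twist χ E).surjective y
    rw [smul_indMk, (hc u).eq, indMk_mul_B, smul_twist, shift_ι, add_smul, hk, algebraMap_smul,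
      hχ, ← add_smul, ← sub_eq_add_neg, map_smul]
    exact congrArg (𝒢.indRel _).mkQ (TensorProduct.tmul_smul _ _ _)

end SemiregularBimodule

/-! ### The anti-involution of the enveloping algebra -/

section Bar

variable {L : Type*} [LieRing L] [LieAlgebra ℂ L]

lemma unop_bar_mul (u v : Env L) :
    (bar L (u * v)).unop = (bar L v).unop * (bar L u).unop := by
  rw [map_mul, MulOpposite.unop_mul]

lemma unop_bar_ι (x : L) : (bar L (ι ℂ x)).unop = -ι ℂ x := by
  rw [bar_ι, MulOpposite.unop_neg, MulOpposite.unop_op]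

lemma unop_bar_unop_bar (u : Env L) : (bar L (bar L u).unop).unop = u := by
  induction u using env_induction_left with
  | one => simp
  | mul x u ih =>
    rw [unop_bar_mul, unop_bar_mul, ih, unop_bar_ι, map_neg, MulOpposite.unop_neg, unop_bar_ι,
      neg_neg]
  | add u v hu hv => rw [map_add, MulOpposite.unop_add, map_add, MulOpposite.unop_add, hu, hv]
  | smul c u hu => rw [map_smul, MulOpposite.unop_smul, map_smul, MulOpposite.unop_smul, hu]

lemma LieGrading.unop_bar_ιB (𝒢 : LieGrading L) (b : 𝒢.B) :
    (bar L (𝒢.ιB b)).unop = 𝒢.ιB (bar 𝒢.nonneg b).unop := by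
  induction b using env_induction_left with
  | one => simp
  | mul x u ih =>
    rw [map_mul, unop_bar_mul, unop_bar_mul, map_mul, ih, ιB_ι, unop_bar_ι, unop_bar_ι, map_neg,
      ιB_ι]
  | add u v hu hv => simp only [map_add, MulOpposite.unop_add, hu, hv]
  | smul c u hu => simp only [map_smul, MulOpposite.unop_smul, hu]

/-- The anti-involution as a linear map. -/
def barLin (L : Type*) [LieRing L] [LieAlgebra ℂ L] : Env L →ₗ[ℂ] Env L :=
  (MulOpposite.opLinearEquiv ℂ).symm.toLinearMap ∘ₗ (bar L).toLinearMap

end Bar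

namespace LieGrading

variable {L : Type*} [LieRing L] [LieAlgebra ℂ L] {𝒢 : LieGrading L}

/-! ### Coinduced modules as graded duals of induced modules -/

section Duality

variable {E E' : Type*} [AddCommGroup E] [Module ℂ E] [Module 𝒢.B E] [IsScalarTower ℂ 𝒢.B E]
  [AddCommGroup E'] [Module ℂ E'] [Module 𝒢.B E'] [IsScalarTower ℂ 𝒢.B E']

lemma pairing_smul {p : E →ₗ[ℂ] Module.Dual ℂ E'}
    (hp : ∀ (x : 𝒢.nonneg) e e', p ((ι ℂ x : 𝒢.B) • e) e' = -p e ((ι ℂ x : 𝒢.B) • e'))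
    (b : 𝒢.B) (e : E) (e' : E') : p (b • e) e' = p e ((bar 𝒢.nonneg b).unop • e') := by
  induction b using env_induction_left generalizing e' with
  | one => simp
  | mul x u ih => rw [mul_smul, hp, ih, unop_bar_mul, unop_bar_ι, mul_smul, neg_smul, smul_neg,
      map_neg]
  | add u v hu hv => rw [add_smul, map_add, LinearMap.add_apply, hu, hv, map_add,
      MulOpposite.unop_add, add_smul, map_add]
  | smul c u hu => rw [smul_assoc, map_smul p c, LinearMap.smul_apply, hu, map_smul (bar _) c,
      MulOpposite.unop_smul, smul_assoc, map_smul (p e) c]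

variable {ℰ : ℤ → Submodule ℂ E} {p : E →ₗ[ℂ] Module.Dual ℂ E'}
  (hp : ∀ (x : 𝒢.nonneg) e e', p ((ι ℂ x : 𝒢.B) • e) e' = -p e ((ι ℂ x : 𝒢.B) • e'))

/-- For an invariant pairing of `E` and `E'`, a `B`-linear map `φ : U → E` gives the functional
`u ⊗ e' ↦ ⟨φ(ū), e'⟩` on `U ⊗_B E'`. -/
def dualOfCoind (φ : Coind 𝒢 ℰ) : Module.Dual ℂ (𝒢.Ind E') :=
  indLift (TensorProduct.lift (p ∘ₗ φ.toHom ∘ₗ barLin L)) fun u b e' => by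
    change p (φ.toHom (bar L (u * 𝒢.ιB b)).unop) e' = p (φ.toHom (bar L u).unop) (b • e')
    rw [unop_bar_mul, unop_bar_ιB, φ.toHom_B_mul, pairing_smul hp, unop_bar_unop_bar]

lemma dualOfCoind_mk (φ : Coind 𝒢 ℰ) (u : 𝒢.U) (e' : E') :
    dualOfCoind hp φ (indMk u e') = p (φ.toHom (bar L u).unop) e' := rfl

variable {ℰ' : ℤ → Submodule ℂ E'}

lemma dualOfCoind_mem (hpair : ∀ i j, i + j ≠ 0 → ∀ e ∈ ℰ i, ∀ e' ∈ ℰ' j, p e e' = 0) {n : ℤ}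
    {φ : Coind 𝒢 ℰ} (hφ : φ ∈ coindDeg 𝒢 ℰ n) :
    dualOfCoind hp φ ∈ dualDeg (indDeg 𝒢 ℰ') n := by
  intro i hi x hx
  rw [← Submodule.mem_bot ℂ]
  refine map_mem_of_indDeg (f := dualOfCoind hp φ) (fun j k hjk u hu e' he' => ?_) hx
  rw [dualOfCoind_mk, Submodule.mem_bot]
  exact hpair (j + n) k (by omega) _ (hφ.2 j _ (unop_bar_mem_envDeg _ hu)) _ he'

/-- The map `dualOfCoind` with values in the graded dual. -/
def coindToDual (hpair : ∀ i j, i + j ≠ 0 → ∀ e ∈ ℰ i, ∀ e' ∈ ℰ' j, p e e' = 0) :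
    Coind 𝒢 ℰ →ₗ[𝒢.U] GradedDual (𝒢 := 𝒢) (isGradedAction_ind ℰ') where
  toFun φ := ⟨dualOfCoind hp φ, by
    have hφ : φ ∈ ⨆ n, coindDeg 𝒢 ℰ n := by rw [iSup_coindDeg]; trivial
    induction hφ using Submodule.iSup_induction' with
    | mem n φ hφ => exact Submodule.mem_iSup_of_mem n (dualOfCoind_mem hp hpair hφ)
    | zero =>
      have : dualOfCoind hp (0 : Coind 𝒢 ℰ) = 0 := ind_hom_ext fun u e' => by
        rw [dualOfCoind_mk]
        exact congrArg (fun z => z e') (map_zero p)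
      rw [this]; exact zero_mem _
    | add a b _ _ ha hb =>
      have : dualOfCoind hp (a + b) = dualOfCoind hp a + dualOfCoind hp b :=
        ind_hom_ext fun u e' => by
          rw [LinearMap.add_apply, dualOfCoind_mk, dualOfCoind_mk, dualOfCoind_mk]
          exact congrArg (fun z => z e') (map_add p _ _)
      rw [this]; exact add_mem ha hb⟩
  map_add' a b := Subtype.ext <| ind_hom_ext fun u e' => by
    change dualOfCoind hp (a + b) _ = dualOfCoind hp a _ + dualOfCoind hp b _
    rw [dualOfCoind_mk, dualOfCoind_mk, dualOfCoind_mk]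
    exact congrArg (fun z => z e') (map_add p _ _)
  map_smul' u φ := Subtype.ext <| ind_hom_ext fun v e' => by
    change dualOfCoind hp (u • φ) (indMk v e') = dualOfCoind hp φ ((bar L u).unop • indMk v e')
    rw [smul_indMk, dualOfCoind_mk, dualOfCoind_mk, Coind.smul_toHom, unop_bar_mul,
      unop_bar_unop_bar]

lemma coindToDual_injective (hpair : ∀ i j, i + j ≠ 0 → ∀ e ∈ ℰ i, ∀ e' ∈ ℰ' j, p e e' = 0)
    (hinj : Function.Injective p) : Function.Injective (coindToDual hp hpair) := by
  intro φ ψ h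
  refine Coind.ext_toHom (LinearMap.ext fun u => hinj (LinearMap.ext fun e' => ?_))
  have h1 : dualOfCoind hp φ = dualOfCoind hp ψ := congrArg Subtype.val h
  have h2 := LinearMap.congr_fun h1 (indMk (bar L u).unop e')
  rwa [dualOfCoind_mk, dualOfCoind_mk, unop_bar_unop_bar] at h2

/-- A functional f of degree n gives the map u ↦ p⁻¹(e' ↦ f(ū ⊗ e')). Its homogeneity uses `hdual`:
a vector that pairs to zero with all degrees other than -n lies in degree n. -/
lemma coindToDual_surjective (hpair : ∀ i j, i + j ≠ 0 → ∀ e ∈ ℰ i, ∀ e' ∈ ℰ' j, p e e' = 0)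
    (hbij : Function.Bijective p)
    (hdual : ∀ n, ∀ e, (∀ i, i + n ≠ 0 → ∀ e' ∈ ℰ' i, p e e' = 0) → e ∈ ℰ n) :
    Function.Surjective (coindToDual hp hpair) := by
  rintro ⟨f, hf⟩
  induction hf using Submodule.iSup_induction' with
  | mem n f hf =>
    let P := LinearEquiv.ofBijective p hbij
    let φ : 𝒢.U →ₗ[ℂ] E := P.symm.toLinearMap ∘ₗ (TensorProduct.curry
      (f ∘ₗ (𝒢.indRel E').mkQ.restrictScalars ℂ)) ∘ₗ barLin L
    have hφ1 : ∀ u e', p (φ u) e' = f (indMk (bar L u).unop e') := fun u e' =>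
      congrArg (fun z => z e') (P.apply_symm_apply _)
    have hφ : φ ∈ coindHom 𝒢 ℰ n := by
      refine ⟨fun b u => hbij.injective (LinearMap.ext fun e' => ?_), fun i u hu => ?_⟩
      · rw [hφ1, unop_bar_mul, unop_bar_ιB, indMk_mul_B, pairing_smul hp, hφ1]
      · refine hdual _ _ fun j hj e' he' => ?_
        rw [hφ1]
        exact hf (i + j) (by omega) _ (indMk_mem (unop_bar_mem_envDeg _ hu) he')
    refine ⟨⟨φ, Submodule.mem_iSup_of_mem n hφ⟩, Subtype.ext <| ind_hom_ext fun u e' => ?_⟩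
    change p (φ (bar L u).unop) e' = f (indMk u e')
    rw [hφ1, unop_bar_unop_bar]
  | zero => exact ⟨0, map_zero _⟩
  | add x y hx' hy' hx hy =>
    obtain ⟨a, ha⟩ := hx
    obtain ⟨b, hb⟩ := hy
    exact ⟨a + b, by rw [map_add, ha, hb]; rfl⟩

include hp in
/-- A perfect invariant pairing of `E` and `E'` identifies `𝓗om_B(U, E)` with the graded dual of
`U ⊗_B E'`. -/
theorem gradedIso_coind_dual (hsup' : ⨆ n, ℰ' n = ⊤)
    (hpair : ∀ i j, i + j ≠ 0 → ∀ e ∈ ℰ i, ∀ e' ∈ ℰ' j, p e e' = 0)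
    (hbij : Function.Bijective p)
    (hdual : ∀ n, ∀ e, (∀ i, i + n ≠ 0 → ∀ e' ∈ ℰ' i, p e e' = 0) → e ∈ ℰ n) :
    GradedIso 𝒢.U (coindDeg 𝒢 ℰ) (gradedDualDeg (𝒢 := 𝒢) (isGradedAction_ind ℰ')) :=
  gradedIso_of_le 𝒢.iSup_coindDeg
    (iSupIndep_subtype (iSupIndep_dualDeg (𝒢.iSup_indDeg hsup')) _)
    (LinearEquiv.ofBijective _ ⟨coindToDual_injective hp hpair hbij.injective,
      coindToDual_surjective hp hpair hbij hdual⟩)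
    fun _ _ hφ => dualOfCoind_mem hp hpair hφ

end Duality

lemma isGradedAction_degB_of_ι {E : Type*} [AddCommGroup E] [Module ℂ E] [Module 𝒢.B E]
    [IsScalarTower ℂ 𝒢.B E] {ℰ : ℤ → Submodule ℂ E}
    (h : ∀ i j, ∀ x ∈ 𝒢.partPiece 𝒢.nonneg i, ∀ e ∈ ℰ j, (ι ℂ x : 𝒢.B) • e ∈ ℰ (i + j)) :
    IsGradedAction 𝒢.degB ℰ := by
  intro i j b e hb he
  have h1 : 𝒢.degB i ≤ (ℰ (i + j)).comap ((𝒢.actB E).flip e) := by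
    refine Submodule.span_le.2 ?_
    clear hb
    rintro _ ⟨l, hl, rfl, rfl⟩
    change (l.map fun p => (ι ℂ p.2 : 𝒢.B)).prod • e ∈ ℰ ((l.map Prod.fst).sum + j)
    induction l with
    | nil => simpa using he
    | cons p l ih =>
      simp only [List.map_cons, List.prod_cons, mul_smul, List.sum_cons, add_assoc]
      exact h _ _ _ (hl p List.mem_cons_self) _ (ih fun q hq => hl q (List.mem_cons_of_mem _ hq))
  exact h1 hb

end LieGrading

/-! ### Representations of `𝔤` as modules over the elements of nonnegative degrees -/

namespace Affine

open LieGrading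

variable {𝔤 : Type*} [LieRing 𝔤] [LieAlgebra ℂ 𝔤] (Φ : InvariantForm 𝔤)

section AtLevel

variable (k : ℂ) (V : Type*) [AddCommGroup V] [Module ℂ V] [LieRingModule 𝔤 V] [LieModule ℂ 𝔤 V]

/-- The identification of the spaces `V` and `AtLevel Φ k V`. -/
def atLevel : V ≃ₗ[ℂ] AtLevel Φ k V := LinearEquiv.refl ℂ V

variable {V} in
lemma smul_atLevel (b : (grading Φ).B) (v : V) :
    b • atLevel Φ k V v = atLevel Φ k V (lift ℂ (levelRep Φ k V) b v) := rfl

variable {V} in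
lemma ι_smul_atLevel (x : (grading Φ).nonneg) (v : V) :
    (ι ℂ x : (grading Φ).B) • atLevel Φ k V v =
      atLevel Φ k V (⁅coeff Φ 0 x, v⁆ + (k * centralCoeff Φ x) • v) := by
  rw [smul_atLevel, lift_ι_apply]
  rfl

lemma coeff_zero_eq_zero {n : ℤ} (hn : n ≠ 0) {x : Affine Φ} (hx : x ∈ piece Φ n) :
    coeff Φ 0 x = 0 ∧ centralCoeff Φ x = 0 := by
  obtain ⟨a, z, hz, rfl⟩ := exists_of_mem_piece Φ hx
  simp [hz hn, hn.symm]

lemma iSup_atLevelDeg : ⨆ n, atLevelDeg Φ k V n = ⊤ := iSup_single (M := V)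

lemma isGradedModule_atLevel : IsGradedModule (grading Φ).degB (atLevelDeg Φ k V) where
  internal := by
    rw [DirectSum.isInternal_submodule_iff_iSupIndep_and_iSup_eq_top]
    exact ⟨iSupIndep_single (M := V), iSup_atLevelDeg Φ k V⟩
  smul_mem := isGradedAction_degB_of_ι fun i j x hx e he => by
    by_cases hj : j = 0
    · by_cases hi : i = 0
      · subst hi hj
        rw [atLevelDeg, if_pos (add_zero 0)]
        trivial
      · obtain ⟨v, rfl⟩ := (atLevel Φ k V).surjective e
        have := coeff_zero_eq_zero Φ hi (show (x : Affine Φ) ∈ piece Φ i from hx)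
        rw [ι_smul_atLevel, this.1, this.2, mul_zero, zero_smul, zero_lie, add_zero, map_zero]
        exact zero_mem _
    · rw [atLevelDeg, if_neg hj, Submodule.mem_bot] at he
      rw [he, smul_zero]
      exact zero_mem _

variable {k} in
/-- Twisting by a character that vanishes on `𝔤` shifts the level. -/
lemma gradedIso_twist_atLevel {z k' : ℂ} (h : k + z = k') :
    GradedIso (grading Φ).B (twistDeg (levelCharacter Φ z) (atLevelDeg Φ k V))
      (atLevelDeg Φ k' V) :=
  ⟨{ ((twist (levelCharacter Φ z) (AtLevel Φ k V)).symm.trans (atLevel Φ k V).symm).trans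
      (atLevel Φ k' V) with
    map_smul' := fun b x => by
      obtain ⟨y, rfl⟩ := (twist (levelCharacter Φ z) (AtLevel Φ k V)).surjective x
      obtain ⟨v, rfl⟩ := (atLevel Φ k V).surjective y
      have h1 : (lift ℂ (levelRep Φ k V)).comp ((grading Φ).shift (levelCharacter Φ z)) =
          lift ℂ (levelRep Φ k' V) := env_hom_ext fun x => by
        rw [AlgHom.comp_apply, shift_ι, map_add, lift_ι_apply, lift_ι_apply, AlgHom.commutes]
        refine LinearMap.ext fun v => ?_
        change (⁅coeff Φ 0 x, v⁆ + (k * centralCoeff Φ x) • v) + (z * centralCoeff Φ x) • v =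
          ⁅coeff Φ 0 x, v⁆ + (k' * centralCoeff Φ x) • v
        rw [add_assoc, ← add_smul, ← add_mul, h]
      exact congrArg (atLevel Φ k' V) (LinearMap.congr_fun (DFunLike.congr_fun h1 b) v) },
    fun n x => Iff.rfl⟩

end AtLevel

/-- A perfect invariant pairing of `V` and `V'` identifies the module coinduced from `V` at
level `-k` with the graded dual of the Weyl module of level `k` induced from `V'`. -/
lemma gradedIso_coind_weylDual {V V' : Type*} [AddCommGroup V] [Module ℂ V] [LieRingModule 𝔤 V]
    [LieModule ℂ 𝔤 V] [AddCommGroup V'] [Module ℂ V'] [LieRingModule 𝔤 V'] [LieModule ℂ 𝔤 V']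
    {k k' : ℂ} (hk : k' = -k) (p : V →ₗ[ℂ] Module.Dual ℂ V') (hp : ∀ (x : 𝔤) v v',
      p ⁅x, v⁆ v' = -p v ⁅x, v'⁆) (hbij : Function.Bijective p) :
    GradedIso (grading Φ).U (coindDeg (grading Φ) (atLevelDeg Φ k' V)) (weylDualDeg Φ k V') := by
  let P : AtLevel Φ k' V →ₗ[ℂ] Module.Dual ℂ (AtLevel Φ k V') := p
  refine gradedIso_coind_dual (p := P) (fun x e e' => ?_) (iSup_atLevelDeg Φ k V') ?_ hbij ?_
  · obtain ⟨v, rfl⟩ := (atLevel Φ k' V).surjective e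
    obtain ⟨v', rfl⟩ := (atLevel Φ k V').surjective e'
    rw [ι_smul_atLevel, ι_smul_atLevel]
    change p (⁅coeff Φ 0 x, v⁆ + (k' * centralCoeff Φ x) • v) v' =
      -p v (⁅coeff Φ 0 x, v'⁆ + (k * centralCoeff Φ x) • v')
    rw [map_add, map_smul, LinearMap.add_apply, LinearMap.smul_apply, hp, map_add, map_smul, hk,
      neg_add, ← smul_neg, neg_mul, neg_smul, smul_neg]
  · intro i j hij e he e' he'
    by_cases hi : i = 0
    · rw [atLevelDeg, if_neg (by omega), Submodule.mem_bot] at he'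
      rw [he', map_zero]
    · rw [atLevelDeg, if_neg hi, Submodule.mem_bot] at he
      rw [he, map_zero, LinearMap.zero_apply]
  · intro n e he
    by_cases hn : n = 0
    · rw [atLevelDeg, if_pos hn]; trivial
    · have h0 : P e = 0 := LinearMap.ext fun e' => he 0 (by omega) e' (by
        rw [atLevelDeg, if_pos rfl]; trivial)
      rw [hbij.injective (h0.trans (map_zero P).symm)]
      exact zero_mem _

section SemiInfinite

variable {z : ℂ} (h : (grading Φ).IsSemiInfinite (levelCharacter Φ z))
  {V V' : Type*} [AddCommGroup V] [Module ℂ V] [LieRingModule 𝔤 V]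
  [LieModule ℂ 𝔤 V] [AddCommGroup V'] [Module ℂ V'] [LieRingModule 𝔤 V'] [LieModule ℂ 𝔤 V']
  {k k' : ℂ} (hk : k + z = -k')

include hk

/-- `S_γ ⊗_U -` maps Weyl modules to graded duals of Weyl modules. -/
theorem gradedIso_tensor_weyl (p : V →ₗ[ℂ] Module.Dual ℂ V')
    (hp : ∀ (x : 𝔤) v v', p ⁅x, v⁆ v' = -p v ⁅x, v'⁆) (hbij : Function.Bijective p) :
    GradedIso (grading Φ).U
      ((semiregular h).tensorGrading (weylDeg Φ k V))
      (weylDualDeg Φ k' V') :=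
  ((SemiregularBimodule.gradedIso_tensor_ind h (isGradedModule_atLevel Φ k V)
    ⟨0, fun _ hn => if_neg hn.ne⟩).trans
    (gradedIso_coind (gradedIso_twist_atLevel Φ V hk))).trans
    (gradedIso_coind_weylDual Φ rfl p hp hbij)

/-- `𝓗om_U(S_γ, -)` maps graded duals of Weyl modules to Weyl modules. -/
theorem gradedIso_hom_weylDual (p : V' →ₗ[ℂ] Module.Dual ℂ V)
    (hp : ∀ (x : 𝔤) v' v, p ⁅x, v'⁆ v = -p v' ⁅x, v⁆) (hbij : Function.Bijective p) :
    GradedIso (grading Φ).U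
      ((semiregular h).homGrading (weylDualDeg Φ k' V))
      (weylDeg Φ k V') := by
  have hχ : ∀ x, levelCharacter Φ (-z) x = -levelCharacter Φ z x := fun x => neg_mul _ _
  exact (((semiregular h).gradedIso_hom
    (gradedIso_coind_weylDual Φ rfl p hp hbij).symm).trans
    (SemiregularBimodule.gradedIso_hom_coind h hχ (isGradedModule_atLevel Φ (-k') V')
      ⟨0, fun n hn => if_neg hn.ne'⟩)).trans
    (gradedIso_ind (gradedIso_twist_atLevel Φ V' (by rw [← hk]; ring)))

end SemiInfinite

end Affine

/-! ### Irreducible representations with the same highest weight are isomorphic -/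

section HighestWeight

open LieAlgebra LieAlgebra.IsKilling LieModule

variable {𝔤 : Type*} [LieRing 𝔤] [LieAlgebra ℂ 𝔤] [FiniteDimensional ℂ 𝔤] [IsSimple ℂ 𝔤]
  {H : LieSubalgebra ℂ 𝔤} [H.IsCartanSubalgebra]

/-- The sum of the fundamental coweights takes the value `ht(α)` at every root `α`. -/
lemma exists_eval_eq_height (b : (rootSystem H).Base) :
    ∃ h : H, ∀ α : H.root, α.1 h = (b.height α : ℂ) := by
  have hli : LinearIndependent ℂ fun i : b.support => (rootSystem H).root i := b.linearIndepOn_root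
  -- A linear form on the dual of H with value 1 at each simple root; by reflexivity it is
  -- evaluation at an element of H.
  obtain ⟨g, hg⟩ := (Finsupp.linearCombination ℂ (fun _ : b.support => (1 : ℂ)) ∘ₗ
    hli.repr).exists_extend
  refine ⟨(Module.evalEquiv ℂ H).symm g, fun α => ?_⟩
  have h1 : ∀ f : Module.Dual ℂ H, f ((Module.evalEquiv ℂ H).symm g) = g f := fun f => by
    rw [Module.apply_evalEquiv_symm_apply]
  have h2 : ∀ i ∈ b.support, g ((rootSystem H).root i) = 1 := fun i hi => by
    have h3 := LinearMap.congr_fun hg ⟨(rootSystem H).root i, Submodule.subset_span ⟨⟨i, hi⟩, rfl⟩⟩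
    rw [LinearMap.comp_apply, LinearMap.comp_apply] at h3
    refine h3.trans ?_
    rw [hli.repr_eq_single ⟨i, hi⟩ _ rfl,
      Finsupp.linearCombination_single, smul_eq_mul, mul_one]
  obtain ⟨f, -, -, hf⟩ := b.exists_root_eq_sum_int α
  rw [b.height_eq_sum hf]
  have h4 : α.1 ((Module.evalEquiv ℂ H).symm g) =
    (rootSystem H).root α ((Module.evalEquiv ℂ H).symm g) := rfl
  rw [h4, h1, hf, map_sum, Int.cast_sum]
  refine Finset.sum_congr rfl fun i hi => ?_
  rw [map_zsmul, h2 i hi, zsmul_eq_mul, mul_one]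

/-- A subspace that contains the Cartan subalgebra and all root spaces is everything. -/
lemma eq_top_of_cartan_of_rootSpace (P : Submodule ℂ 𝔤) (hH : ∀ h : H, (h : 𝔤) ∈ P)
    (hP : ∀ α : H.root, ∀ x ∈ rootSpace H α.1, x ∈ P) : P = ⊤ := by
  have h1 := congrArg LieSubmodule.toSubmodule (iSup_genWeightSpace_eq_top' ℂ H 𝔤)
  rw [LieSubmodule.iSup_toSubmodule, LieSubmodule.top_toSubmodule] at h1
  rw [eq_top_iff, ← h1]
  refine iSup_le fun α x hx => ?_
  by_cases hα : α.IsZero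
  · have h2 : x ∈ rootSpace H (0 : H → ℂ) := by rw [← hα.eq]; exact hx
    rw [rootSpace_zero_eq] at h2
    exact hH ⟨x, h2⟩
  · exact hP ⟨α, by simpa using hα⟩ x hx

/-- The subrepresentation generated by a highest weight vector `w` of weight `lam` is contained in
the sum of `ℂ w` and weight spaces for lower weights. -/
lemma exists_submodule_of_highest (b : (rootSystem H).Base) {W : Type*} [AddCommGroup W]
    [Module ℂ W] (ρ : 𝔤 →ₗ⁅ℂ⁆ Module.End ℂ W) {w : W} {lam : Module.Dual ℂ H}
    (h1 : ∀ h : H, ρ h w = lam h • w)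
    (h2 : ∀ α : H.root, b.IsPos α → ∀ x ∈ rootSpace H α.1, ρ x w = 0) :
    ∃ Z : Submodule ℂ W, w ∈ Z ∧ (∀ x, ∀ z ∈ Z, ρ x z ∈ Z) ∧
      ∀ z ∈ Z, (∃ h : H, ∃ c : ℂ, ρ h z = c • z ∧ ρ h w = c • w ∧
        ∀ α : H.root, α.1 h = (b.height α : ℂ)) → z ∈ Submodule.span ℂ {w} := by
  -- Only closure under negative root spaces is imposed; stability under all of 𝔤 is proved next.
  -- This keeps control of the weights below that of w.
  let Z : Submodule ℂ W := sInf {P | w ∈ P ∧ ∀ α : H.root, ¬ b.IsPos α →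
    ∀ x ∈ rootSpace H α.1, ∀ z ∈ P, ρ x z ∈ P}
  have hw : w ∈ Z := Submodule.mem_sInf.2 fun P hP => hP.1
  have hneg : ∀ α : H.root, ¬ b.IsPos α → ∀ x ∈ rootSpace H α.1, ∀ z ∈ Z, ρ x z ∈ Z :=
    fun α hα x hx z hz => Submodule.mem_sInf.2 fun P hP =>
      hP.2 α hα x hx z (Submodule.mem_sInf.1 hz P hP)
  have hle : ∀ P : Submodule ℂ W, w ∈ P → (∀ α : H.root, ¬ b.IsPos α →
      ∀ x ∈ rootSpace H α.1, ∀ z ∈ P, ρ x z ∈ P) → Z ≤ P := fun P h3 h4 => sInf_le ⟨h3, h4⟩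
  have hact : ∀ x, ∀ z ∈ Z, ρ x z ∈ Z := by
    -- Q collects the vectors of Z that 𝔤 maps into Z. It contains w and is closed under negative
    -- root spaces, since x y z = [x, y] z + y x z, so minimality gives Z ≤ Q.
    let Q : Submodule ℂ W := Z ⊓ ⨅ x : 𝔤, Z.comap (ρ x)
    have hQ : ∀ z, z ∈ Q ↔ z ∈ Z ∧ ∀ x, ρ x z ∈ Z := fun z => by
      simp [Q, Submodule.mem_iInf]
    have hZQ : Z ≤ Q := by
      refine hle Q ((hQ w).2 ⟨hw, fun x => ?_⟩) fun α hα y hy z hz => ?_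
      · have h3 := eq_top_of_cartan_of_rootSpace (H := H)
          (Z.comap (LinearMap.applyₗ w ∘ₗ (ρ : 𝔤 →ₗ[ℂ] Module.End ℂ W))) (fun h => by
            change ρ h w ∈ Z
            rw [h1]; exact Submodule.smul_mem _ _ hw) fun α x hx => by
            change ρ x w ∈ Z
            by_cases hα : b.IsPos α
            · rw [h2 α hα x hx]; exact zero_mem _
            · exact hneg α hα x hx w hw
        exact (h3 ▸ Submodule.mem_top : x ∈ Z.comap _)
      · rw [hQ] at hz ⊢
        refine ⟨hz.2 y, fun x => ?_⟩
        have h3 : ρ x (ρ y z) = ρ ⁅x, y⁆ z + ρ y (ρ x z) := by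
          rw [LieHom.map_lie, LieRing.of_associative_ring_bracket, LinearMap.sub_apply,
            Module.End.mul_apply, Module.End.mul_apply, sub_add_cancel]
        rw [h3]
        exact add_mem (hz.2 _) (hneg α hα y hy _ (hz.2 x))
    exact fun x z hz => ((hQ z).1 (hZQ hz)).2 x
  refine ⟨Z, hw, hact, ?_⟩
  rintro z hz ⟨h, c, hzc, hwc, hh⟩
  let T : Submodule ℂ W := ⨆ μ : {μ : ℂ // μ ≠ c}, (ρ h).eigenspace μ
  -- A negative root has height -(m + 1), so it lowers the eigenvalue of h by a positive integer.
  -- Thus Z lies in ℂ w plus the eigenspaces for c - 1, c - 2, and so on.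
  let K : ℕ → Submodule ℂ W := fun n => (ρ h).eigenspace (c - (n + 1))
  let K' : Submodule ℂ W := Submodule.span ℂ {w} ⊔ ⨆ n, K n
  have hshift : ∀ α : H.root, ∀ x ∈ rootSpace H α.1, ∀ μ : ℂ, ∀ y, ρ h y = μ • y →
      ρ h (ρ x y) = (μ + b.height α) • ρ x y := by
    intro α x hx μ y hy
    have h3 : ρ h (ρ x y) = ρ ⁅(h : 𝔤), x⁆ y + ρ x (ρ h y) := by
      rw [LieHom.map_lie, LieRing.of_associative_ring_bracket, LinearMap.sub_apply,
        Module.End.mul_apply, Module.End.mul_apply, sub_add_cancel]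
    have h4 : ⁅(h : 𝔤), x⁆ = α.1 h • x := lie_eq_smul_of_mem_rootSpace hx h
    rw [h3, h4, hy, map_smul, map_smul, LinearMap.smul_apply, hh, ← add_smul, add_comm]
  have hheight : ∀ α : H.root, ¬ b.IsPos α → ∃ m : ℕ, (b.height α : ℂ) = -(m + 1) := by
    intro α hα
    have h3 := b.height_ne_zero α
    rw [b.isPos_iff] at hα
    refine ⟨(-b.height α - 1).toNat, ?_⟩
    have h4 : (((-b.height α - 1).toNat : ℤ) : ℂ) = ((-b.height α - 1 : ℤ) : ℂ) := by
      rw [Int.toNat_of_nonneg (by omega)]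
    rw [Int.cast_natCast] at h4
    rw [h4]
    push_cast
    ring
  have hZK : Z ≤ K' := by
    refine hle K' (Submodule.mem_sup_left (Submodule.mem_span_singleton_self w)) ?_
    intro α hα x hx y hy
    obtain ⟨m, hm⟩ := hheight α hα
    obtain ⟨y1, hy1, y2, hy2, rfl⟩ := Submodule.mem_sup.1 hy
    rw [map_add]
    refine Submodule.mem_sup_right (add_mem ?_ ?_)
    · obtain ⟨a, rfl⟩ := Submodule.mem_span_singleton.1 hy1
      rw [map_smul]
      refine Submodule.smul_mem _ _ (Submodule.mem_iSup_of_mem m ?_)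
      rw [Module.End.mem_eigenspace_iff, hshift α x hx c w hwc, hm]
      rfl
    · clear hy hy1
      induction hy2 using Submodule.iSup_induction' with
      | mem n y hy =>
        refine Submodule.mem_iSup_of_mem (n + m + 1) ?_
        rw [Module.End.mem_eigenspace_iff] at hy ⊢
        rw [hshift α x hx _ y hy, hm]
        push_cast
        congr 1
        ring
      | zero => rw [map_zero]; exact zero_mem _
      | add a b _ _ ha hb => rw [map_add]; exact add_mem ha hb
  obtain ⟨y1, hy1, y2, hy2, rfl⟩ := Submodule.mem_sup.1 (hZK hz)
  -- If z has eigenvalue c, so does its lower part y2, which also lies in the sum of the other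
  -- eigenspaces and hence vanishes.
  have h5 : y2 ∈ (ρ h).eigenspace c := by
    obtain ⟨a, rfl⟩ := Submodule.mem_span_singleton.1 hy1
    rw [Module.End.mem_eigenspace_iff]
    rw [map_add, map_smul, hwc, smul_add, smul_comm] at hzc
    exact add_left_cancel hzc
  have h6 : y2 ∈ ⨆ μ, ⨆ (_ : μ ≠ c), (ρ h).eigenspace μ := by
    refine (iSup_le fun n => ?_ : ⨆ n, K n ≤ _) hy2
    refine le_iSup₂_of_le (c - (n + 1)) (fun h7 => ?_) le_rfl
    have h8 : ((n + 1 : ℕ) : ℂ) = 0 := by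
      push_cast
      linear_combination -h7
    exact absurd (Nat.cast_eq_zero.1 h8) (Nat.succ_ne_zero n)
  rw [Submodule.disjoint_def.1 ((ρ h).eigenspaces_iSupIndep c) _ h5 h6, add_zero]
  exact hy1

variable {V W : Type*} [AddCommGroup V] [Module ℂ V] [LieRingModule 𝔤 V] [LieModule ℂ 𝔤 V]
  [AddCommGroup W] [Module ℂ W] [LieRingModule 𝔤 W] [LieModule ℂ 𝔤 W]

omit [FiniteDimensional ℂ 𝔤] [IsSimple ℂ 𝔤] in
lemma eq_bot_or_eq_top_of_irreducible [LieModule.IsIrreducible ℂ 𝔤 V] (P : Submodule ℂ V)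
    (hP : ∀ (x : 𝔤), ∀ v ∈ P, ⁅x, v⁆ ∈ P) : P = ⊥ ∨ P = ⊤ := by
  rcases eq_bot_or_eq_top (⟨P, fun {x v} hv => hP x v hv⟩ : LieSubmodule ℂ 𝔤 V) with h | h
  · exact Or.inl (congrArg LieSubmodule.toSubmodule h)
  · exact Or.inr (congrArg LieSubmodule.toSubmodule h)

/-- Irreducible representations with the same highest weight are isomorphic. -/
lemma exists_equiv_of_highestWeight (b : (rootSystem H).Base) {lam : Module.Dual ℂ H}
    [LieModule.IsIrreducible ℂ 𝔤 V] [LieModule.IsIrreducible ℂ 𝔤 W]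
    (hV : HasHighestWeight b lam V) (hW : HasHighestWeight b lam W) :
    ∃ e : V ≃ₗ[ℂ] W, ∀ (x : 𝔤) v, e ⁅x, v⁆ = ⁅x, e v⁆ := by
  obtain ⟨v, hv0, hvH, hvp⟩ := hV
  obtain ⟨w, hw0, hwH, hwp⟩ := hW
  let ρ : 𝔤 →ₗ⁅ℂ⁆ Module.End ℂ (V × W) :=
    { toFun := fun x => (toEnd ℂ 𝔤 V x).prodMap (toEnd ℂ 𝔤 W x)
      map_add' := fun x y => by rw [map_add, map_add, LinearMap.prodMap_add]
      map_smul' := fun c x => by rw [map_smul, map_smul, LinearMap.prodMap_smul]; rfl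
      map_lie' := fun {x y} => by
        refine LinearMap.ext fun z => ?_
        change (⁅⁅x, y⁆, z.1⁆, ⁅⁅x, y⁆, z.2⁆) =
          (⁅x, ⁅y, z.1⁆⁆ - ⁅y, ⁅x, z.1⁆⁆, ⁅x, ⁅y, z.2⁆⁆ - ⁅y, ⁅x, z.2⁆⁆)
        rw [lie_lie, lie_lie] }
  have hρ : ∀ x z, ρ x z = (⁅x, z.1⁆, ⁅x, z.2⁆) := fun x z => rfl
  have hwt : ∀ h : H, ρ h (v, w) = lam h • (v, w) := fun h => by
    rw [hρ, hvH, hwH]; rfl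
  -- The subrepresentation of V × W generated by (v, w) will be the graph of the isomorphism.
  obtain ⟨Z, hZ, hact, hspan⟩ := exists_submodule_of_highest b ρ hwt
    fun α hα x hx => by rw [hρ, hvp α hα x hx, hwp α hα x hx]; rfl
  obtain ⟨h, hh⟩ := exists_eval_eq_height b
  -- The vector (v, 0) has the same h-eigenvalue as (v, w), so inside Z it would be a multiple of
  -- (v, w), which is impossible.
  have hv : (v, (0 : W)) ∉ Z := fun h1 => by
    obtain ⟨a, ha⟩ := Submodule.mem_span_singleton.1 (hspan _ h1
      ⟨h, lam h, by rw [hρ, hvH, lie_zero, Prod.smul_mk, smul_zero], hwt h, hh⟩)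
    have h3 := congrArg Prod.snd ha
    have h4 := congrArg Prod.fst ha
    rcases smul_eq_zero.1 h3 with h5 | h5
    · exact hv0 (h4.symm.trans (by rw [h5, zero_smul]; rfl))
    · exact hw0 h5
  have hw : ((0 : V), w) ∉ Z := fun h1 => by
    obtain ⟨a, ha⟩ := Submodule.mem_span_singleton.1 (hspan _ h1
      ⟨h, lam h, by rw [hρ, hwH, lie_zero, Prod.smul_mk, smul_zero], hwt h, hh⟩)
    have h3 := congrArg Prod.snd ha
    have h4 := congrArg Prod.fst ha
    rcases smul_eq_zero.1 h4 with h5 | h5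
    · exact hw0 (h3.symm.trans (by rw [h5, zero_smul]; rfl))
    · exact hv0 h5
  -- By irreducibility the intersections of Z with the two factors are zero and its two projections
  -- are onto, so both projections are isomorphisms.
  have i1 : Z.comap (LinearMap.inl ℂ V W) = ⊥ :=
    (eq_bot_or_eq_top_of_irreducible (𝔤 := 𝔤) _ fun x y hy => by
      have := hact x _ hy
      rw [hρ] at this
      simpa using this).resolve_right fun h1 => hv (h1 ▸ Submodule.mem_top :
        v ∈ Z.comap (LinearMap.inl ℂ V W))
  have i2 : Z.comap (LinearMap.inr ℂ V W) = ⊥ :=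
    (eq_bot_or_eq_top_of_irreducible (𝔤 := 𝔤) _ fun x y hy => by
      have := hact x _ hy
      rw [hρ] at this
      simpa using this).resolve_right fun h1 => hw (h1 ▸ Submodule.mem_top :
        w ∈ Z.comap (LinearMap.inr ℂ V W))
  have s1 : Z.map (LinearMap.fst ℂ V W) = ⊤ :=
    (eq_bot_or_eq_top_of_irreducible (𝔤 := 𝔤) _ fun x y hy => by
      obtain ⟨z, hz, rfl⟩ := hy
      exact ⟨ρ x z, hact x z hz, rfl⟩).resolve_left fun h1 => hv0 (by
        have : v ∈ Z.map (LinearMap.fst ℂ V W) := ⟨_, hZ, rfl⟩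
        rwa [h1, Submodule.mem_bot] at this)
  have s2 : Z.map (LinearMap.snd ℂ V W) = ⊤ :=
    (eq_bot_or_eq_top_of_irreducible (𝔤 := 𝔤) _ fun x y hy => by
      obtain ⟨z, hz, rfl⟩ := hy
      exact ⟨ρ x z, hact x z hz, rfl⟩).resolve_left fun h1 => hw0 (by
        have : w ∈ Z.map (LinearMap.snd ℂ V W) := ⟨_, hZ, rfl⟩
        rwa [h1, Submodule.mem_bot] at this)
  let f1 : Z ≃ₗ[ℂ] V := LinearEquiv.ofBijective (LinearMap.fst ℂ V W ∘ₗ Z.subtype) ⟨by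
      rw [← LinearMap.ker_eq_bot, LinearMap.ker_eq_bot']
      rintro ⟨⟨x, y⟩, hz⟩ (hx : x = 0)
      subst hx
      have hy : y ∈ Z.comap (LinearMap.inr ℂ V W) := hz
      rw [i2, Submodule.mem_bot] at hy
      subst hy
      rfl, fun x => by
      obtain ⟨z, hz, hzx⟩ := (s1 ▸ Submodule.mem_top : x ∈ Z.map (LinearMap.fst ℂ V W))
      exact ⟨⟨z, hz⟩, hzx⟩⟩
  let f2 : Z ≃ₗ[ℂ] W := LinearEquiv.ofBijective (LinearMap.snd ℂ V W ∘ₗ Z.subtype) ⟨by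
      rw [← LinearMap.ker_eq_bot, LinearMap.ker_eq_bot']
      rintro ⟨⟨x, y⟩, hz⟩ (hy : y = 0)
      subst hy
      have hx : x ∈ Z.comap (LinearMap.inl ℂ V W) := hz
      rw [i1, Submodule.mem_bot] at hx
      subst hx
      rfl, fun x => by
      obtain ⟨z, hz, hzx⟩ := (s2 ▸ Submodule.mem_top : x ∈ Z.map (LinearMap.snd ℂ V W))
      exact ⟨⟨z, hz⟩, hzx⟩⟩
  refine ⟨f1.symm.trans f2, fun x y => ?_⟩
  obtain ⟨z, rfl⟩ := f1.surjective y
  have h1 : ⁅x, f1 z⁆ = f1 ⟨ρ x z, hact x z z.2⟩ := rfl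
  rw [h1, LinearEquiv.trans_apply, LinearEquiv.trans_apply, f1.symm_apply_apply,
    f1.symm_apply_apply]
  rfl

omit [FiniteDimensional ℂ 𝔤] [IsSimple ℂ 𝔤] in
/-- The dual of a finite-dimensional irreducible representation is irreducible. -/
lemma isIrreducible_dual [FiniteDimensional ℂ V] [LieModule.IsIrreducible ℂ 𝔤 V] :
    LieModule.IsIrreducible ℂ 𝔤 (Module.Dual ℂ V) := by
  have hnt : Nontrivial V := by
    have : Nontrivial (LieSubmodule ℂ 𝔤 V) := inferInstance
    exact (LieSubmodule.nontrivial_iff ℂ 𝔤 V).1 this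
  refine LieModule.IsIrreducible.mk fun N hN => ?_
  -- The common kernel in V of the functionals in N is a subrepresentation, hence 0 or V; in finite
  -- dimension it determines N.
  have h1 := eq_bot_or_eq_top_of_irreducible (𝔤 := 𝔤) (N : Submodule ℂ (Module.Dual ℂ V)).dualCoannihilator
    fun x v hv => by
      rw [Submodule.mem_dualCoannihilator] at hv ⊢
      intro φ hφ
      have h2 := hv _ (N.lie_mem (x := x) hφ)
      rw [Module.Dual.lie_apply, neg_eq_zero] at h2
      exact h2
  have h3 := Subspace.dualCoannihilator_dualAnnihilator_eq (W := (N : Submodule ℂ (Module.Dual ℂ V)))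
  rcases h1 with h1 | h1
  · rw [h1, Submodule.dualAnnihilator_bot] at h3
    exact (LieSubmodule.toSubmodule_inj _ _).1 h3.symm
  · rw [h1, Submodule.dualAnnihilator_top] at h3
    exact absurd ((LieSubmodule.toSubmodule_inj _ _).1 h3.symm) hN

/-- There is a perfect invariant pairing of irreducible representations with highest
weights `λ` and `λ*`. -/
lemma exists_invariant_pairing (b : (rootSystem H).Base) {lam lam' : Module.Dual ℂ H}
    (hV : IsHighestWeightModule b lam V) (hW : IsHighestWeightModule b lam' W)
    (hdual : HasHighestWeight b lam' (Module.Dual ℂ V)) :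
    ∃ p : W →ₗ[ℂ] Module.Dual ℂ V, (∀ (x : 𝔤) w v, p ⁅x, w⁆ v = -p w ⁅x, v⁆) ∧
      Function.Bijective p ∧ Function.Bijective p.flip := by
  have := hV.finite
  have := hV.irreducible
  have := hW.irreducible
  have := isIrreducible_dual (𝔤 := 𝔤) (V := V)
  obtain ⟨e, he⟩ := exists_equiv_of_highestWeight b hW.highest hdual
  refine ⟨e, fun x w v => ?_, e.bijective, ?_⟩
  · rw [LinearEquiv.coe_coe, he, Module.Dual.lie_apply]
  · have h1 : e.toLinearMap.flip = e.toLinearMap.dualMap ∘ₗ (Module.evalEquiv ℂ V).toLinearMap := by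
      ext v w
      rfl
    rw [h1]
    exact (e.dualMap.bijective).comp (Module.evalEquiv ℂ V).bijective

end HighestWeight

/-! ### The length of the highest coroot -/

section HighestRoot

open LieAlgebra LieAlgebra.IsKilling

variable {𝔤 : Type*} [LieRing 𝔤] [LieAlgebra ℂ 𝔤] [FiniteDimensional ℂ 𝔤] [IsSimple ℂ 𝔤]
  {H : LieSubalgebra ℂ 𝔤} [H.IsCartanSubalgebra] {b : (rootSystem H).Base} {θ : H.root}

/-- A sum of simple roots takes a natural number as value at the sum of the fundamental coweights,
and this value is 0 only for the empty sum. Applied to θ - α, this gives both claims. -/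
lemma IsHighestRoot.height_le (hθ : IsHighestRoot b θ) (α : H.root) :
    b.height α ≤ b.height θ ∧ (b.height α = b.height θ → α = θ) := by
  obtain ⟨h, hh⟩ := exists_eval_eq_height b
  have key : ∀ x ∈ AddSubmonoid.closure ((rootSystem H).root '' b.support),
      ∃ m : ℕ, x h = m ∧ (m = 0 → x = 0) := by
    intro x hx
    induction hx using AddSubmonoid.closure_induction with
    | mem x hx =>
      obtain ⟨i, hi, rfl⟩ := hx
      refine ⟨1, (hh i).trans ?_, fun h1 => absurd h1 one_ne_zero⟩
      rw [b.height_one_of_mem_support hi]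
      simp
    | zero => exact ⟨0, by simp, fun _ => rfl⟩
    | add x y _ _ hx hy =>
      obtain ⟨m, hm, hm'⟩ := hx
      obtain ⟨l, hl, hl'⟩ := hy
      refine ⟨m + l, by rw [LinearMap.add_apply, hm, hl, Nat.cast_add], fun h1 => ?_⟩
      rw [hm' (by omega), hl' (by omega), add_zero]
  obtain ⟨m, hm, hm'⟩ := key _ (hθ α)
  have h1 : ((b.height θ - b.height α : ℤ) : ℂ) = ((m : ℤ) : ℂ) := by
    rw [Int.cast_natCast, ← hm, LinearMap.sub_apply, Int.cast_sub, ← hh, ← hh]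
    rfl
  have h2 : b.height θ - b.height α = m := Int.cast_injective h1
  refine ⟨by omega, fun h3 => ?_⟩
  have h4 := hm' (by omega)
  exact ((rootSystem H).root.injective (sub_eq_zero.1 h4)).symm

/-- The root -θ has height at most that of θ, so the nonzero height of θ is positive. -/
lemma IsHighestRoot.isPos (hθ : IsHighestRoot b θ) : b.IsPos θ := by
  have h1 := (hθ.height_le ((rootSystem H).reflectionPerm θ θ)).1
  have h2 := b.height_reflectionPerm_self θ
  have h3 := b.height_ne_zero θ
  rw [b.isPos_iff]
  change b.height ((rootSystem H).reflectionPerm θ θ) = _ at h2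
  omega

/-- A positive root other than `θ` takes the value `0` or `1` on the coroot of `θ`. -/
lemma IsHighestRoot.pairingIn_eq (hθ : IsHighestRoot b θ) {α : H.root} (hα : b.IsPos α)
    (hne : α ≠ θ) :
    (rootSystem H).pairingIn ℤ α θ = 0 ∨ (rootSystem H).pairingIn ℤ α θ = 1 := by
  have hroot : (rootSystem H).root ((rootSystem H).reflectionPerm θ α) =
      (rootSystem H).root α + (-(rootSystem H).pairingIn ℤ α θ) • (rootSystem H).root θ := by
    rw [RootPairing.root_reflectionPerm, RootPairing.reflection_apply_root,
      ← (rootSystem H).algebraMap_pairingIn ℤ, neg_smul, sub_eq_add_neg,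
      eq_intCast, Int.cast_smul_eq_zsmul]
  -- Let n = ⟨α, θ^∨⟩. The root α - n θ and its negative have height at most ht θ, so |ht α - n ht
  -- θ| ≤ ht θ. With 0 < ht α < ht θ this leaves only n = 0 and n = 1.
  have h1 := b.height_add_zsmul hroot
  have h2 := hθ.height_le ((rootSystem H).reflectionPerm θ α)
  have h3 := hθ.height_le ((rootSystem H).reflectionPerm ((rootSystem H).reflectionPerm θ α)
    ((rootSystem H).reflectionPerm θ α))
  have h4 : b.height ((rootSystem H).reflectionPerm ((rootSystem H).reflectionPerm θ α)
    ((rootSystem H).reflectionPerm θ α)) = -b.height ((rootSystem H).reflectionPerm θ α) :=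
    b.height_reflectionPerm_self _
  have h5 := hθ.isPos
  have h6 := hθ.height_le α
  rw [b.isPos_iff] at h5 hα
  have h7 : b.height α < b.height θ := lt_of_le_of_ne h6.1 fun h => hne (h6.2 h)
  rw [h4, h1, smul_eq_mul] at h3
  rw [h1, smul_eq_mul] at h2
  have h2 := h2.1
  have h3 := h3.1
  generalize (rootSystem H).pairingIn ℤ α θ = n at *
  by_contra! h8
  rcases lt_or_ge n 0 with h9 | h9
  · nlinarith
  · have : 2 ≤ n := by omega
    nlinarith

-- Negative roots contribute as much as positive ones. On positive roots other than θ the pairing is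
-- 0 or 1 and equals its square; θ itself contributes 4 = 2 + 2. Since the sum over positive roots
-- is 2⟨ρ, θ^∨⟩, the total is 4h^∨.
open Classical in
lemma IsHighestRoot.sum_sq (hθ : IsHighestRoot b θ) :
    (∑ α : H.root, (rootSystem H).pairingIn ℤ α θ ^ 2 : ℤ) =
      2 * (∑ α : H.root with b.IsPos α, (rootSystem H).pairingIn ℤ α θ + 2) := by
  have h1 : ∑ α : H.root with ¬ b.IsPos α, (rootSystem H).pairingIn ℤ α θ ^ 2 =
      ∑ α : H.root with b.IsPos α, (rootSystem H).pairingIn ℤ α θ ^ 2 := by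
    let _ := (rootSystem H).indexNeg
    refine Finset.sum_nbij' (fun α => -α) (fun α => -α) ?_ ?_ ?_ ?_ ?_
    · intro α hα
      rw [Finset.mem_filter] at hα ⊢
      exact ⟨Finset.mem_univ _, (RootPairing.Base.IsPos.neg_iff_not b α).2 hα.2⟩
    · intro α hα
      rw [Finset.mem_filter] at hα ⊢
      refine ⟨Finset.mem_univ _, fun h => ?_⟩
      exact (RootPairing.Base.IsPos.neg_iff_not b α).1 h hα.2
    · intro α _; exact neg_neg α
    · intro α _; exact neg_neg α
    · intro α _
      have : (rootSystem H).pairingIn ℤ (-α) θ = -(rootSystem H).pairingIn ℤ α θ :=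
        (rootSystem H).pairingIn_reflectionPerm_self_left ℤ α θ
      rw [this, neg_sq]
  have hθθ : (rootSystem H).pairingIn ℤ θ θ = 2 := (rootSystem H).pairingIn_same ℤ θ
  have h2 : ∑ α : H.root with b.IsPos α, (rootSystem H).pairingIn ℤ α θ ^ 2 =
      ∑ α : H.root with b.IsPos α, (rootSystem H).pairingIn ℤ α θ + 2 := by
    have hmem : θ ∈ Finset.univ.filter fun α : H.root => b.IsPos α := by
      simpa using hθ.isPos
    rw [← Finset.sum_erase_add _ _ hmem, ← Finset.sum_erase_add _ _ hmem, hθθ]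
    have : ∑ α ∈ (Finset.univ.filter fun α : H.root => b.IsPos α).erase θ,
        (rootSystem H).pairingIn ℤ α θ ^ 2 =
        ∑ α ∈ (Finset.univ.filter fun α : H.root => b.IsPos α).erase θ,
        (rootSystem H).pairingIn ℤ α θ := by
      refine Finset.sum_congr rfl fun α hα => ?_
      rw [Finset.mem_erase, Finset.mem_filter] at hα
      rcases hθ.pairingIn_eq hα.2.2 hα.1 with h | h <;> rw [h] <;> rfl
    rw [this]
    ring
  rw [← Finset.sum_filter_add_sum_filter_not _ (fun α => b.IsPos α), h1, h2]
  ring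

/-- The Killing form takes the value `4 h^∨` at the coroot of the highest root. -/
lemma IsHighestRoot.killingForm_coroot (hθ : IsHighestRoot b θ) :
    killingForm ℂ 𝔤 ((rootSystem H).coroot θ) ((rootSystem H).coroot θ) = 4 * dualCoxeter b θ ∧
      dualCoxeter b θ ≠ 0 := by
  classical
  have h1 : killingForm ℂ 𝔤 ((rootSystem H).coroot θ) ((rootSystem H).coroot θ) =
      ((∑ α : H.root, (rootSystem H).pairingIn ℤ α θ ^ 2 : ℤ) : ℂ) := by
    have h2 : (rootSystem H).CorootForm ((rootSystem H).coroot θ) ((rootSystem H).coroot θ) =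
      killingForm ℂ 𝔤 ((rootSystem H).coroot θ) ((rootSystem H).coroot θ) := by
      rw [corootForm_rootSystem_eq_killing]
      rfl
    rw [← h2, RootPairing.corootForm_apply_apply, Int.cast_sum]
    refine Finset.sum_congr rfl fun α _ => ?_
    rw [RootPairing.root'_coroot_eq_pairing, ← (rootSystem H).algebraMap_pairingIn ℤ]
    simp [sq]
  have h3 : 4 * dualCoxeter b θ =
      ((∑ α : H.root, (rootSystem H).pairingIn ℤ α θ ^ 2 : ℤ) : ℂ) := by
    rw [hθ.sum_sq, dualCoxeter]
    push_cast
    have : ∑ α : H.root with b.IsPos α, (((rootSystem H).pairingIn ℤ α θ : ℤ) : ℂ) =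
        ∑ α : H.root with b.IsPos α, (rootSystem H).pairing α θ :=
      Finset.sum_congr rfl fun α _ => (rootSystem H).algebraMap_pairingIn ℤ α θ
    rw [this]
    ring
  -- If h^∨ were zero, the sum of squares would vanish, but its term at θ is 4.
  refine ⟨h1.trans h3.symm, fun h4 => ?_⟩
  rw [h4, mul_zero] at h3
  have h5 : (∑ α : H.root, (rootSystem H).pairingIn ℤ α θ ^ 2 : ℤ) = 0 := by exact_mod_cast h3.symm
  have h6 := (Finset.sum_eq_zero_iff_of_nonneg fun α _ => sq_nonneg _).1 h5 θ (Finset.mem_univ θ)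
  have hθθ : (rootSystem H).pairingIn ℤ θ θ = 2 := (rootSystem H).pairingIn_same ℤ θ
  rw [hθθ] at h6
  norm_num at h6

/-- The Killing form is `2 h^∨` times the normalized form. -/
lemma IsHighestRoot.killingForm_eq (hθ : IsHighestRoot b θ) (x y : 𝔤) :
    killingForm ℂ 𝔤 x y = 2 * dualCoxeter b θ * (normalizedForm θ).form x y := by
  obtain ⟨h1, h2⟩ := hθ.killingForm_coroot
  change _ = 2 * dualCoxeter b θ * ((2 / _) * killingForm ℂ 𝔤 x y)
  rw [h1]
  field_simp
  ring

variable (𝔤) in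
/-- A simple Lie algebra is spanned by brackets. -/
lemma span_lie_eq_top : Submodule.span ℂ {z : 𝔤 | ∃ x y : 𝔤, ⁅x, y⁆ = z} = ⊤ := by
  have h1 : ⁅(⊤ : LieIdeal ℂ 𝔤), (⊤ : LieIdeal ℂ 𝔤)⁆ = ⊤ :=
    (IsSimple.eq_bot_or_eq_top (R := ℂ) _).resolve_left fun h =>
      IsSimple.non_abelian (R := ℂ) (L := 𝔤) ⟨fun x y => by
        have : ⁅x, y⁆ ∈ ⁅(⊤ : LieIdeal ℂ 𝔤), (⊤ : LieIdeal ℂ 𝔤)⁆ :=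
          LieSubmodule.lie_mem_lie (LieSubmodule.mem_top x) (LieSubmodule.mem_top y)
        rwa [h, LieSubmodule.mem_bot] at this⟩
  have h2 := congrArg LieSubmodule.toSubmodule h1
  rw [LieSubmodule.lieIdeal_oper_eq_linear_span] at h2
  rw [eq_top_iff]
  refine le_of_eq_of_le h2.symm (Submodule.span_mono ?_)
  rintro _ ⟨x, y, rfl⟩
  exact ⟨x, y, rfl⟩

end HighestRoot

/-! ### The critical character of an affine Lie algebra -/

namespace Affine

open LieAlgebra

variable {𝔤 : Type*} [LieRing 𝔤] [LieAlgebra ℂ 𝔤] (Φ : InvariantForm 𝔤)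

lemma fg_piece [FiniteDimensional ℂ 𝔤] (n : ℤ) : (piece Φ n).FG := by
  refine Submodule.FG.sup ?_ ?_
  · rw [LinearMap.range_eq_map]
    exact (Module.finite_def.1 inferInstance).map _
  · split_ifs
    · exact Submodule.fg_span_singleton _
    · exact Submodule.fg_bot

lemma current_mem_piece (n : ℤ) (a : 𝔤) : current Φ n a ∈ piece Φ n :=
  Submodule.mem_sup_left ⟨a, rfl⟩

lemma exists_eq_current {n : ℤ} (hn : n ≠ 0) {x : Affine Φ} (hx : x ∈ piece Φ n) :
    ∃ a, x = current Φ n a := by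
  obtain ⟨a, z, hz, rfl⟩ := exists_of_mem_piece Φ hx
  exact ⟨a, by rw [hz hn, zero_smul, add_zero]⟩

/-- The element `x(n)` of the subalgebra of elements of negative degrees. -/
def currentNeg (n : ℤ) (hn : n < 0) : 𝔤 →ₗ[ℂ] (grading Φ).neg where
  toFun x := ⟨current Φ n x, (grading Φ).mem_neg hn (current_mem_piece Φ n x)⟩
  map_add' x y := Subtype.ext (map_add _ x y)
  map_smul' c x := Subtype.ext (map_smul _ c x)

lemma coe_currentNeg (n : ℤ) (hn : n < 0) (x : 𝔤) :
    (currentNeg Φ n hn x : Affine Φ) = current Φ n x := rfl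

/-- Since 𝔤 = [𝔤, 𝔤], every x(-m-2) is a sum of brackets of elements y(-1) and z(-m-1); no central
term arises because the total degree is not 0. -/
lemma adjoin_degree_neg_one
    (hspan : Submodule.span ℂ {z : 𝔤 | ∃ x y : 𝔤, ⁅x, y⁆ = z} = ⊤) :
    Algebra.adjoin ℂ ((ι ℂ : (grading Φ).neg →ₗ⁅ℂ⁆ (grading Φ).N) ''
      {Y | Y ∈ (grading Φ).partPiece (grading Φ).neg (-1)}) = ⊤ := by
  set A := Algebra.adjoin ℂ ((ι ℂ : (grading Φ).neg →ₗ⁅ℂ⁆ (grading Φ).N) ''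
      {Y | Y ∈ (grading Φ).partPiece (grading Φ).neg (-1)}) with hA
  have key : ∀ (m : ℕ) (x : 𝔤), (ι ℂ (currentNeg Φ (-(m + 1)) (by omega) x) : (grading Φ).N) ∈ A := by
    intro m
    induction m with
    | zero =>
      refine fun x => Algebra.subset_adjoin ⟨_, ?_, rfl⟩
      exact current_mem_piece Φ _ x
    | succ m ih =>
      intro x
      have h1 : x ∈ Submodule.span ℂ {z : 𝔤 | ∃ x y : 𝔤, ⁅x, y⁆ = z} := hspan ▸ Submodule.mem_top
      induction h1 using Submodule.span_induction with
      | mem z hz =>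
        obtain ⟨x, y, rfl⟩ := hz
        have h2 : currentNeg Φ (-((m + 1 : ℕ) + 1)) (by omega) ⁅x, y⁆ =
            ⁅currentNeg Φ (-1) (by omega) x, currentNeg Φ (-(m + 1)) (by omega) y⁆ := by
          refine Subtype.ext ?_
          rw [LieSubalgebra.coe_bracket, coe_currentNeg, coe_currentNeg, coe_currentNeg,
            lie_current, if_neg (by omega), zero_smul, add_zero]
          congr 2
          push_cast
          ring
        rw [h2, LieHom.map_lie, LieRing.of_associative_ring_bracket]
        have h3 : (ι ℂ (currentNeg Φ (-1) (by omega) x) : (grading Φ).N) ∈ A :=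
          Algebra.subset_adjoin ⟨_, current_mem_piece Φ _ x, rfl⟩
        exact sub_mem (mul_mem h3 (ih y)) (mul_mem (ih y) h3)
      | zero => rw [map_zero, map_zero]; exact zero_mem _
      | add a b _ _ ha hb => rw [map_add, map_add]; exact add_mem ha hb
      | smul c a _ ha => rw [map_smul, map_smul]; exact Subalgebra.smul_mem _ ha c
  refine eq_top_iff.2 fun u _ => mem_of_ι_mem A (fun Y => ?_) u
  have hY : Y ∈ ⨆ n, (grading Φ).partPiece (grading Φ).neg n :=
    ((grading Φ).iSup_partPiece {n | n < 0} _).ge trivial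
  induction hY using Submodule.iSup_induction' with
  | mem n Y hY =>
    rcases lt_or_ge n 0 with hn | hn
    · obtain ⟨m, rfl⟩ : ∃ m : ℕ, n = -(m + 1) := ⟨(-n - 1).toNat, by omega⟩
      obtain ⟨a, ha⟩ := exists_eq_current Φ hn.ne (show (Y : Affine Φ) ∈ piece Φ _ from hY)
      have : Y = currentNeg Φ _ hn a := Subtype.ext ha
      rw [this]
      exact key m a
    · have h1 := (grading Φ).partPiece_eq_bot {n | n < 0}
        (fun i (hi : i < 0) j (hj : j < 0) => show i + j < 0 from add_neg hi hj)
        (n := n) (by simpa using hn)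
      have h2 : Y = 0 := (Submodule.mem_bot ℂ).1 (h1.le hY)
      rw [h2, map_zero]
      exact zero_mem _
  | zero => rw [map_zero]; exact zero_mem _
  | add a b _ _ ha hb => rw [map_add]; exact add_mem ha hb

lemma mem_iSup_piece (x : Affine Φ) : x ∈ ⨆ n, piece Φ n :=
  (grading Φ).iSup_piece ▸ Submodule.mem_top

lemma coeff_zero_lie_current (a : 𝔤) (x : Affine Φ) :
    coeff Φ 0 ⁅current Φ (-1) a, x⁆ = ⁅a, coeff Φ 1 x⁆ := by
  have hx := mem_iSup_piece Φ x
  induction hx using Submodule.iSup_induction' with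
  | mem n x hx =>
    obtain ⟨c, z, -, rfl⟩ := exists_of_mem_piece Φ hx
    rw [lie_add, lie_smul, lie_center, smul_zero, add_zero, lie_current]
    by_cases hn : n = 1
    · subst hn; simp
    · have h1 : -1 + n ≠ 0 := by omega
      simp [h1, h1.symm, Ne.symm hn]
  | zero => simp
  | add x y _ _ hx hy => rw [lie_add, map_add, hx, hy, map_add, lie_add]

lemma centralCoeff_lie_current (x : Affine Φ) (a : 𝔤) :
    centralCoeff Φ ⁅x, current Φ (-1) a⁆ = Φ.form (coeff Φ 1 x) a := by
  have hx := mem_iSup_piece Φ x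
  induction hx using Submodule.iSup_induction' with
  | mem n x hx =>
    obtain ⟨c, z, -, rfl⟩ := exists_of_mem_piece Φ hx
    rw [add_lie, smul_lie, center_lie, smul_zero, add_zero, lie_current]
    by_cases hn : n = 1
    · subst hn; simp
    · have h1 : n + -1 ≠ 0 := by omega
      simp [h1, Ne.symm hn]
  | zero => simp
  | add x y _ _ hx hy => rw [add_lie, map_add, hx, hy, map_add, map_add, LinearMap.add_apply]

lemma coeff_zero_neg (Y : (grading Φ).neg) : coeff Φ 0 Y = 0 ∧ centralCoeff Φ Y = 0 := by
  obtain ⟨Y, hY⟩ := Y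
  change Y ∈ ⨆ n : {n : ℤ | n < 0}, piece Φ n at hY
  change coeff Φ 0 Y = 0 ∧ centralCoeff Φ Y = 0
  induction hY using Submodule.iSup_induction' with
  | mem i Y hY => exact coeff_zero_eq_zero Φ (ne_of_lt i.2) hY
  | zero => simp
  | add a b _ _ ha hb => simp [ha.1, ha.2, hb.1, hb.2]

lemma coeff_zero_pB (x : Affine Φ) :
    coeff Φ 0 ((grading Φ).pB x) = coeff Φ 0 x ∧
      centralCoeff Φ ((grading Φ).pB x) = centralCoeff Φ x := by
  have h1 := coeff_zero_neg Φ ((grading Φ).pN x)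
  constructor
  · conv_rhs => rw [← (grading Φ).pN_add_pB x, map_add, h1.1, zero_add]
  · conv_rhs => rw [← (grading Φ).pN_add_pB x, map_add, h1.2, zero_add]

/-- Bracketing with degree -1 keeps positive degrees nonnegative and c is central, so only the
t⁰-coefficient of Z matters. This is why a finite family suffices to express the trace. -/
lemma pN_lie_current (Z : (grading Φ).nonneg) (a : 𝔤) :
    (grading Φ).pN ⁅(Z : Affine Φ), current Φ (-1) a⁆ =
      currentNeg Φ (-1) (by omega) ⁅coeff Φ 0 Z, a⁆ := by
  obtain ⟨Z, hZ⟩ := Z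
  change Z ∈ ⨆ n : {n : ℤ | 0 ≤ n}, piece Φ n at hZ
  change (grading Φ).pN ⁅Z, current Φ (-1) a⁆ = currentNeg Φ (-1) (by omega) ⁅coeff Φ 0 Z, a⁆
  induction hZ using Submodule.iSup_induction' with
  | mem i Z hZ =>
    obtain ⟨i, hi⟩ := i
    change 0 ≤ i at hi
    change Z ∈ piece Φ i at hZ
    rcases hi.eq_or_lt with rfl | hi
    · obtain ⟨c, z, -, rfl⟩ := exists_of_mem_piece Φ hZ
      rw [add_lie, smul_lie, center_lie, smul_zero, add_zero, lie_current, if_neg (by omega),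
        zero_smul, add_zero, zero_add]
      have h1 : coeff Φ 0 (current Φ 0 c + z • center Φ) = c := by simp
      rw [h1]
      exact (grading Φ).pN_neg (currentNeg Φ (-1) (by omega) ⁅c, a⁆)
    · rw [(coeff_zero_eq_zero Φ hi.ne' hZ).1, zero_lie, map_zero]
      have h1 : ⁅Z, current Φ (-1) a⁆ ∈ (grading Φ).nonneg :=
        (grading Φ).mem_nonneg (n := i + -1) (by omega)
          ((grading Φ).lie_mem hZ (current_mem_piece Φ (-1) a))
      exact (grading Φ).pN_nonneg ⟨_, h1⟩
  | zero => simp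
  | add x y _ _ hx hy => rw [add_lie, map_add, hx, hy, map_add, add_lie, map_add]

/-- If the Killing form is `z` times the chosen form, the character of level `z` is
semi-infinite. -/
lemma isSemiInfinite_levelCharacter [FiniteDimensional ℂ 𝔤] {z : ℂ}
    (hspan : Submodule.span ℂ {z : 𝔤 | ∃ x y : 𝔤, ⁅x, y⁆ = z} = ⊤)
    (hz : ∀ x y, killingForm ℂ 𝔤 x y = z * Φ.form x y) :
    (grading Φ).IsSemiInfinite (levelCharacter Φ z) where
  fg := fg_piece Φ
  gen := adjoin_degree_neg_one Φ hspan
  graded n hn x hx := by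
    change z * centralCoeff Φ x = 0
    rw [(coeff_zero_eq_zero Φ hn (show (x : Affine Φ) ∈ piece Φ n from hx)).2, mul_zero]
  trace Y hY := by
    obtain ⟨y, hy⟩ := exists_eq_current Φ (n := -1) (by omega) (show (Y : Affine Φ) ∈ _ from hY)
    let e := Module.finBasis ℂ 𝔤
    let coeff0 : (grading Φ).nonneg →ₗ[ℂ] 𝔤 := coeff Φ 0 ∘ₗ (grading Φ).nonneg.toSubmodule.subtype
    -- The family consists of the e_i(0) for a basis e_i of 𝔤, with the coordinates of the
    -- t⁰-coefficient as functionals.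
    let X : Fin (Module.finrank ℂ 𝔤) → (grading Φ).nonneg := fun i =>
      ⟨current Φ 0 (e i), (grading Φ).mem_nonneg le_rfl (current_mem_piece Φ 0 (e i))⟩
    have hX : ∀ i, coeff Φ 0 (X i : Affine Φ) = e i := fun i => by
      change coeff Φ 0 (current Φ 0 (e i)) = e i
      simp
    refine ⟨_, X, fun i => e.coord i ∘ₗ coeff0, fun Z => ?_, fun Z => ?_⟩
    · rw [hy, pN_lie_current]
      have h1 : ∀ i, (grading Φ).pN ⁅(X i : Affine Φ), current Φ (-1) y⁆ =
          currentNeg Φ (-1) (by omega) ⁅e i, y⁆ := fun i => by rw [pN_lie_current, hX]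
      simp only [h1, ← map_smul, ← map_sum, ← smul_lie, ← sum_lie]
      congr 2
      exact e.sum_repr (coeff Φ 0 Z)
    · change _ = z * centralCoeff Φ ((grading Φ).pB _ : Affine Φ)
      -- The coefficient of c in [Z, y(-1)] is (Z₁, y), with Z₁ the coefficient of t in Z;
      -- multiplied by z it becomes the Killing form.
      rw [(coeff_zero_pB Φ _).2, hy, centralCoeff_lie_current, ← hz]
      have h1 : ∀ i, (e.coord i ∘ₗ coeff0)
          ((grading Φ).pB ⁅((grading Φ).pN ⁅(X i : Affine Φ), current Φ (-1) y⁆ : Affine Φ),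
            (Z : Affine Φ)⁆) = e.coord i ⁅⁅e i, y⁆, coeff Φ 1 Z⁆ := fun i => by
        rw [pN_lie_current, hX]
        change e.coord i (coeff Φ 0 ((grading Φ).pB _ : Affine Φ)) = _
        rw [(coeff_zero_pB Φ _).1, coe_currentNeg, coeff_zero_lie_current]
      simp only [h1]
      -- The trace of ad Z₁ ad y in the basis e_i, term by term: [[e_i, y], Z₁] = [Z₁, [y, e_i]].
      rw [killingForm_apply_apply, LinearMap.trace_eq_matrix_trace ℂ e, Matrix.trace]
      refine Finset.sum_congr rfl fun i _ => ?_
      rw [Matrix.diag_apply, LinearMap.toMatrix_apply, LinearMap.comp_apply, ad_apply, ad_apply,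
        Module.Basis.coord_apply, ← lie_skew, ← lie_skew y (e i), lie_neg]

lemma center_mem_nonneg : center Φ ∈ (grading Φ).nonneg :=
  (grading Φ).mem_nonneg le_rfl (show center Φ ∈ piece Φ 0 by simpa using mem_piece Φ 0 0 1 (by simp))

lemma ιB_center : (grading Φ).ιB (ι ℂ ⟨center Φ, center_mem_nonneg Φ⟩) = centerU Φ :=
  (grading Φ).ιB_ι _

lemma commute_center (u : (grading Φ).U) :
    Commute ((grading Φ).ιB (ι ℂ ⟨center Φ, center_mem_nonneg Φ⟩)) u := by
  rw [ιB_center]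
  induction u using env_induction_left with
  | one => exact Commute.one_right _
  | mul x u hu =>
    refine Commute.mul_right ?_ hu
    have h1 := (ι ℂ : Affine Φ →ₗ⁅ℂ⁆ (grading Φ).U).map_lie (center Φ) x
    rw [center_lie, map_zero, LieRing.of_associative_ring_bracket] at h1
    exact (sub_eq_zero.1 h1.symm)
  | add u v hu hv => exact hu.add_right hv
  | smul c u hu => exact hu.smul_right c

end Affine

end

end SemiInf

end

/-! ### The semi-regular bimodule at the critical character and its two functors -/

theorem mainTheorem6 {𝔤 : Type*} [LieRing 𝔤] [LieAlgebra ℂ 𝔤] [FiniteDimensional ℂ 𝔤]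
    [LieAlgebra.IsSimple ℂ 𝔤] (H : LieSubalgebra ℂ 𝔤) [H.IsCartanSubalgebra]
    (b : (LieAlgebra.IsKilling.rootSystem H).Base) (θ : H.root) (hθ : IsHighestRoot b θ) :
    -- the semi-regular bimodule exists and is unique
    ∃ S : SemiregularBimodule (affineGrading θ) (criticalCharacter b θ),
      (∀ S' : SemiregularBimodule (affineGrading θ)
        (criticalCharacter b θ), S' = S) ∧
      -- `S_γ ⊗_U (U ⊗_B E) ≅ 𝓗om_B(U, ℂ_γ ⊗ E)`
      (∀ (E : Type*) [AddCommGroup E] [Module ℂ E] [Module (affineGrading θ).B E]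
        [IsScalarTower ℂ (affineGrading θ).B E] (ℰ : ℤ → Submodule ℂ E),
        IsGradedModule (affineGrading θ).degB ℰ →
        (∃ m : ℤ, ∀ n < m, ℰ n = ⊥) →
        GradedIso (affineGrading θ).U
          (S.tensorGrading ((affineGrading θ).indDeg ℰ))
          ((affineGrading θ).coindDeg
            (LieGrading.twistDeg (criticalCharacter b θ) ℰ)) ∧
        ∀ k : ℂ, (∀ e : E, Affine.centerB (normalizedForm θ) • e = k • e) →
          ∀ x : S.Tensor ((affineGrading θ).Ind E),
            Affine.centerU (normalizedForm θ) • x =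
              (-dualLevel b θ k) • x) ∧
      -- `𝓗om_U(S_γ, 𝓗om_B(U, F)) ≅ U ⊗_B (ℂ_{-γ} ⊗ F)`
      (∀ (F : Type*) [AddCommGroup F] [Module ℂ F] [Module (affineGrading θ).B F]
        [IsScalarTower ℂ (affineGrading θ).B F] (ℱ : ℤ → Submodule ℂ F),
        IsGradedModule (affineGrading θ).degB ℱ →
        (∃ m : ℤ, ∀ n > m, ℱ n = ⊥) →
        GradedIso (affineGrading θ).U
          (S.homGrading ((affineGrading θ).coindDeg ℱ))
          ((affineGrading θ).indDeg
            (LieGrading.twistDeg (negCriticalCharacter b θ) ℱ)) ∧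
        ∀ k : ℂ, (∀ f : F, Affine.centerB (normalizedForm θ) • f =
            (-dualLevel b θ k) • f) →
          ∀ x : S.Hom ((affineGrading θ).coindDeg ℱ),
            Affine.centerU (normalizedForm θ) • x = k • x) ∧
      -- `V` and `V'` are models of `V_λ` and `V_{λ*}`
      (∀ (k : ℂ) (lam lam' : Module.Dual ℂ H)
        (V : Type*) [AddCommGroup V] [Module ℂ V] [LieRingModule 𝔤 V] [LieModule ℂ 𝔤 V]
        (V' : Type*) [AddCommGroup V'] [Module ℂ V'] [LieRingModule 𝔤 V'] [LieModule ℂ 𝔤 V'],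
        IsHighestWeightModule b lam V → IsHighestWeightModule b lam' V' →
        HasHighestWeight b lam' (Module.Dual ℂ V) →
        GradedIso (affineGrading θ).U
          (S.tensorGrading (Affine.weylDeg (normalizedForm θ) k V))
          (Affine.weylDualDeg (normalizedForm θ) (dualLevel b θ k) V') ∧
        GradedIso (affineGrading θ).U
          (S.homGrading
            (Affine.weylDualDeg (normalizedForm θ) (dualLevel b θ k) V))
          (Affine.weylDeg (normalizedForm θ) k V')) := by
  -- The value 2h^∨ of γ at c is exactly the ratio of the Killing form to the normalized form.
  have h : (affineGrading θ).IsSemiInfinite (criticalCharacter b θ) :=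
    Affine.isSemiInfinite_levelCharacter _ (span_lie_eq_top 𝔤) hθ.killingForm_eq
  have hc := Affine.commute_center (normalizedForm θ)
  have hγ : ∀ z : ℂ, Affine.levelCharacter (normalizedForm θ) z
      ⟨Affine.center _, Affine.center_mem_nonneg _⟩ = z := fun z => by
    change z * Affine.centralCoeff _ (Affine.center _) = z
    rw [Affine.centralCoeff_center, mul_one]
  refine ⟨LieGrading.semiregular h, fun S' => LieGrading.eq_semiregular h S', ?_, ?_, ?_⟩
  · intro E _ _ _ _ ℰ hE hb
    refine ⟨SemiregularBimodule.gradedIso_tensor_ind h hE hb, fun k hk x => ?_⟩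
    have h1 := SemiregularBimodule.smul_tensor_ind h hE hb hc hk x
    rw [Affine.ιB_center, hγ] at h1
    -- The general scalar k + γ(c) = k + 2h^∨ is minus the dual level of k.
    rw [h1, dualLevel]
    congr 1
    ring
  · intro F _ _ _ _ ℱ hF hb
    have hχ : ∀ x, negCriticalCharacter b θ x = -criticalCharacter b θ x :=
      fun x => neg_mul _ _
    refine ⟨SemiregularBimodule.gradedIso_hom_coind h hχ hF hb, fun k hk x => ?_⟩
    have h1 := SemiregularBimodule.smul_hom_coind h hχ hF hb hc hk x
    rw [Affine.ιB_center, hγ] at h1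
    -- Here the level of F is 2h^∨ + k, and subtracting γ(c) leaves k.
    rw [h1, dualLevel]
    congr 1
    ring
  · intro k lam lam' V _ _ _ _ V' _ _ _ _ hV hV' hdual
    obtain ⟨p, hp, hbij, hbij'⟩ := exists_invariant_pairing b hV hV' hdual
    have hk : k + 2 * dualCoxeter b θ = -dualLevel b θ k := by
      rw [dualLevel]
      ring
    -- The pairing is perfect on both sides: its transpose V → (V')^* serves the tensor functor, and
    -- V' → V^* serves the Hom functor.
    exact ⟨Affine.gradedIso_tensor_weyl _ h hk p.flip
        (fun x v v' => by rw [LinearMap.flip_apply, LinearMap.flip_apply, hp, neg_neg]) hbij',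
      Affine.gradedIso_hom_weylDual _ h hk p hp hbij⟩
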